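/- Let $k$ be an algebraically closed field of characteristic zero, $\mathfrak g$ a Lie algebra over $k$, and let $H=U(\mathfrak g)[[h]]$, regarded as a bialgebra over $k[[h]]$ with the coefficientwise coproduct $\Delta$ and counit $\varepsilon$; tensor products are $h$-adically completed, so $H\otimes H=(U(\mathfrak g)\otimes_k U(\mathfrak g))[[h]]$. A *twisted endomorphism* of $H$ is a pair $(f,F)$ of a $k[[h]]$-algebra endomorphism $f$ of $H$ and an invertible element $F\in H\otimes H$ such that $F\,\Delta(f(x))=(f\otimes f)(\Delta(x))\,F$ for all $x\in H$, $(F\otimes 1)(\Delta\otimes I)(F)=(1\otimes F)(I\otimes\Delta)(F)$ and $(\varepsilon\otimes I)(F)=(I\otimes\varepsilon)(F)=1$. Composition is $(f',F')\circ(f,F)=(f'f,(f'\otimes f')(F)F')$, and the *twisted automorphisms* are the invertible twisted endomorphisms. Two of them, $(f,F)$ and $(f',F')$, are *gauge isomorphic* if there is an invertible $a\in H$ with $af(x)=f'(x)a$ for all $x\in H$ and $F'\Delta(a)=(a\otimes a)F$. Gauge isomorphism is compatible with composition, so the gauge classes of twisted automorphisms form a group $\mathrm{Aut}_{\mathbf{Tw}}(H)$.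 An *invariant twist* is an $F$ such that $(1,F)$ is a twisted automorphism. Let $\mathrm{Out}_{bialg}(H)$ be the group of bialgebra automorphisms of $H$ modulo conjugations $x\mapsto axa^{-1}$ by invertible elements $a$ with $\Delta(a)=a\otimes a$, and let $(\Lambda^2\mathfrak g)^{\mathfrak g}\subset\mathfrak g\otimes\mathfrak g$ be the space of $\mathfrak g$-invariant skew-symmetric tensors. Then: 1. Every twisted automorphism of $H$ is gauge isomorphic to a composite $(1,F)\circ(f,1)$, where $F$ is an invariant twist and $f$ is a bialgebra automorphism of $H$. 2. Consequently, the action $X\mapsto(f\otimes f)(X)$ of bialgebra automorphisms induces an action of $\mathrm{Out}_{bialg}(H)$ on the additive group $(\Lambda^2\mathfrak g)^{\mathfrak g}[[h]]$, and there is a group isomorphism $$\mathrm{Out}_{bialg}(H)\ltimes(\Lambda^2\mathfrak g)^{\mathfrak g}[[h]]\;\cong\;\mathrm{Aut}_{\mathbf{Tw}}(H)$$ for this action, which sends the class of a bialgebra automorphism $f$ to the gauge class of $(f,1)$ and $X\in(\Lambda^2\mathfrak g)^{\mathfrak g}[[h]]$ to the gauge class of $(1,\exp(hX))$; in particular $\exp(hX)$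 is an invariant twist. The image of $(\Lambda^2\mathfrak g)^{\mathfrak g}[[h]]$ is the set of gauge classes of invariant twists. -/

import Mathlib

open scoped PowerSeries TensorProduct

noncomputable section

namespace TwistedUEA

/-! ### Formal power series with noncommutative coefficients, as algebras over `k⟦h⟧`

`A⟦X⟧` is the algebra `A[[h]]`; the variable `X` plays the role of `h`. -/

section Series

variable {k : Type*} [Field k] {A B D : Type*} [Ring A] [Algebra k A] [Ring B] [Algebra k B]
  [Ring D] [Algebra k D]

/-- `A[[h]]` is a `k[[h]]`-algebra, also for noncommutative `A`. -/
instance (priority := 50) seriesAlgebra : Algebra k⟦X⟧ A⟦X⟧ :=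
  RingHom.toAlgebra' (PowerSeries.map (algebraMap k A)) (fun c x => by
    ext n
    rw [PowerSeries.coeff_mul, PowerSeries.coeff_mul, ← Finset.Nat.sum_antidiagonal_swap]
    refine Finset.sum_congr rfl fun p _ => ?_
    simp only [Prod.fst_swap, Prod.snd_swap, PowerSeries.coeff_map]
    exact Algebra.commutes _ _)

theorem seriesAlgebraMap (c : k⟦X⟧) :
    algebraMap k⟦X⟧ A⟦X⟧ c = PowerSeries.map (algebraMap k A) c := rfl

theorem algHom_X_mul (f : A⟦X⟧ →ₐ[k⟦X⟧] B⟦X⟧) (T : A⟦X⟧) :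
    f (PowerSeries.X * T) = PowerSeries.X * f T := by
  have h := f.commutes (PowerSeries.X : k⟦X⟧)
  rw [seriesAlgebraMap, seriesAlgebraMap, PowerSeries.map_X, PowerSeries.map_X] at h
  rw [map_mul, h]

theorem series_eq (T : A⟦X⟧) : T = PowerSeries.C (PowerSeries.coeff 0 T) +
    PowerSeries.X * PowerSeries.mk fun n => PowerSeries.coeff (n + 1) T := by
  ext n
  cases n with
  | zero => simp
  | succ n => simp [PowerSeries.coeff_succ_X_mul]

/-- An additive map on `A[[h]]` which is `h`-linear is determined by its values on constants. -/
theorem eq_of_const {M : Type*} [Ring M] (φ ψ : A⟦X⟧ →+ M⟦X⟧)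
    (hφ : ∀ T, φ (PowerSeries.X * T) = PowerSeries.X * φ T)
    (hψ : ∀ T, ψ (PowerSeries.X * T) = PowerSeries.X * ψ T)
    (h : ∀ a, φ (PowerSeries.C a) = ψ (PowerSeries.C a)) (T : A⟦X⟧) : φ T = ψ T := by
  have hφ' : ∀ T, φ T = φ (PowerSeries.C (PowerSeries.coeff 0 T)) + PowerSeries.X *
      φ (PowerSeries.mk fun n => PowerSeries.coeff (n + 1) T) := fun T => by
    rw [← hφ, ← map_add, ← series_eq]
  have hψ' : ∀ T, ψ T = ψ (PowerSeries.C (PowerSeries.coeff 0 T)) + PowerSeries.X *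
      ψ (PowerSeries.mk fun n => PowerSeries.coeff (n + 1) T) := fun T => by
    rw [← hψ, ← map_add, ← series_eq]
  ext n
  induction n generalizing T with
  | zero => rw [hφ', hψ', h]; simp
  | succ n ih =>
    rw [hφ', hψ', h, map_add, map_add, PowerSeries.coeff_succ_X_mul,
      PowerSeries.coeff_succ_X_mul, ih]

theorem algHom_ext_const {f g : A⟦X⟧ →ₐ[k⟦X⟧] B⟦X⟧}
    (h : ∀ a, f (PowerSeries.C a) = g (PowerSeries.C a)) : f = g :=
  AlgHom.ext fun T => eq_of_const (f : A⟦X⟧ →+ B⟦X⟧) (g : A⟦X⟧ →+ B⟦X⟧)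
    (algHom_X_mul f) (algHom_X_mul g) h T

/-- The `k[[h]]`-linear, `h`-adically continuous extension of `u : A → B[[h]]` to `A[[h]]`:
`∑ aᵣ hʳ ↦ ∑ u(aᵣ) hʳ`. -/
def extendFun (u : A →ₐ[k] B⟦X⟧) : A⟦X⟧ →+ B⟦X⟧ where
  toFun T := PowerSeries.mk fun n => ∑ p ∈ Finset.HasAntidiagonal.antidiagonal n,
    PowerSeries.coeff p.1 (u (PowerSeries.coeff p.2 T))
  map_zero' := by ext n; simp
  map_add' S T := by ext n; simp [Finset.sum_add_distrib]

theorem coeff_extendFun (u : A →ₐ[k] B⟦X⟧) (T : A⟦X⟧) (n : ℕ) :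
    PowerSeries.coeff n (extendFun u T) = ∑ p ∈ Finset.HasAntidiagonal.antidiagonal n,
      PowerSeries.coeff p.1 (u (PowerSeries.coeff p.2 T)) :=
  PowerSeries.coeff_mk n fun n => ∑ p ∈ Finset.HasAntidiagonal.antidiagonal n,
    PowerSeries.coeff p.1 (u (PowerSeries.coeff p.2 T))

theorem extendFun_C (u : A →ₐ[k] B⟦X⟧) (a : A) : extendFun u (PowerSeries.C a) = u a := by
  ext n
  rw [coeff_extendFun, Finset.sum_eq_single (n, 0)]
  · simp
  · rintro ⟨p, q⟩ hp hne
    have hq : q ≠ 0 := by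
      rintro rfl
      simp at hp
      exact hne (by simp [hp])
    simp [PowerSeries.coeff_C, hq]
  · intro h
    simp at h

theorem extendFun_X_mul (u : A →ₐ[k] B⟦X⟧) (T : A⟦X⟧) :
    extendFun u (PowerSeries.X * T) = PowerSeries.X * extendFun u T := by
  ext n
  cases n with
  | zero => simp [coeff_extendFun]
  | succ n =>
    rw [coeff_extendFun, PowerSeries.coeff_succ_X_mul, coeff_extendFun,
      Finset.Nat.sum_antidiagonal_succ']
    simp [PowerSeries.coeff_succ_X_mul]

theorem X_mul_left_comm' (S T : A⟦X⟧) :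
    S * (PowerSeries.X * T) = PowerSeries.X * (S * T) := by
  rw [← mul_assoc, (PowerSeries.commute_X S).eq, mul_assoc]

theorem extendFun_mul (u : A →ₐ[k] B⟦X⟧) (S T : A⟦X⟧) :
    extendFun u (S * T) = extendFun u S * extendFun u T := by
  have h1 : ∀ (s : A) (T : A⟦X⟧),
      extendFun u (PowerSeries.C s * T) = u s * extendFun u T := by
    intro s T
    refine eq_of_const ((extendFun u).comp (AddMonoidHom.mulLeft (PowerSeries.C s)))
      ((AddMonoidHom.mulLeft (u s)).comp (extendFun u)) ?_ ?_ ?_ T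
    · intro T
      simp [X_mul_left_comm', extendFun_X_mul]
    · intro T
      simp [X_mul_left_comm', extendFun_X_mul]
    · intro a
      simp only [AddMonoidHom.comp_apply, AddMonoidHom.coe_mulLeft]
      rw [← map_mul, extendFun_C, extendFun_C, map_mul]
  refine eq_of_const ((extendFun u).comp (AddMonoidHom.mulRight T))
    ((AddMonoidHom.mulRight (extendFun u T)).comp (extendFun u)) ?_ ?_ ?_ S
  · intro S
    simp [mul_assoc, extendFun_X_mul]
  · intro S
    simp [mul_assoc, extendFun_X_mul]
  · intro a
    simp [h1, extendFun_C]

/-- The `k[[h]]`-algebra homomorphism `A[[h]] → B[[h]]` extending `u : A → B[[h]]`. -/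
def extend (u : A →ₐ[k] B⟦X⟧) : A⟦X⟧ →ₐ[k⟦X⟧] B⟦X⟧ where
  toFun := extendFun u
  map_zero' := map_zero _
  map_add' := map_add _
  map_one' := by
    have h := extendFun_C u 1
    rwa [map_one (PowerSeries.C : A →+* A⟦X⟧), map_one u] at h
  map_mul' := extendFun_mul u
  commutes' c := by
    ext n
    rw [coeff_extendFun, Finset.sum_eq_single (0, n)]
    · simp only [seriesAlgebraMap, PowerSeries.coeff_map, AlgHom.commutes,
        PowerSeries.algebraMap_apply]
      simp
    · rintro ⟨p, q⟩ hp hne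
      have hq : p ≠ 0 := by
        rintro rfl
        simp at hp
        exact hne (by simp [hp])
      simp only [seriesAlgebraMap, PowerSeries.coeff_map, AlgHom.commutes,
        PowerSeries.algebraMap_apply]
      simp [PowerSeries.coeff_C, hq]
    · intro h
      simp at h

theorem extend_C (u : A →ₐ[k] B⟦X⟧) (a : A) : extend u (PowerSeries.C a) = u a :=
  extendFun_C u a

/-- The restriction of a `k[[h]]`-algebra map to the constants. -/
def restrictConst (f : A⟦X⟧ →ₐ[k⟦X⟧] B⟦X⟧) : A →ₐ[k] B⟦X⟧ where
  toFun a := f (PowerSeries.C a)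
  map_zero' := by simp
  map_add' := by simp
  map_one' := by simp
  map_mul' := by simp
  commutes' c := by
    have h := f.commutes (PowerSeries.C c)
    simpa only [seriesAlgebraMap, PowerSeries.map_C, PowerSeries.algebraMap_apply] using h

/-- The coefficientwise extension `A[[h]] → B[[h]]` of an algebra map `A → B`. -/
def coeffwise (u : A →ₐ[k] B) : A⟦X⟧ →ₐ[k⟦X⟧] B⟦X⟧ where
  __ := PowerSeries.map (u : A →+* B)
  commutes' c := by
    ext n
    simp [seriesAlgebraMap]

theorem coeffwise_C (u : A →ₐ[k] B) (a : A) :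
    coeffwise u (PowerSeries.C a) = PowerSeries.C (u a) :=
  PowerSeries.map_C _ _

/-- `x ↦ x ⊗ 1`, `A[[h]] → (A ⊗ B)[[h]]`. -/
def inl : A⟦X⟧ →ₐ[k⟦X⟧] (A ⊗[k] B)⟦X⟧ := coeffwise Algebra.TensorProduct.includeLeft

/-- `y ↦ 1 ⊗ y`, `B[[h]] → (A ⊗ B)[[h]]`. -/
def inr : B⟦X⟧ →ₐ[k⟦X⟧] (A ⊗[k] B)⟦X⟧ := coeffwise Algebra.TensorProduct.includeRight

theorem coeffwise_commute (u : A →ₐ[k] D) (v : B →ₐ[k] D) (h : ∀ a b, Commute (u a) (v b))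
    (x : A⟦X⟧) (y : B⟦X⟧) : Commute (coeffwise u x) (coeffwise v y) := by
  change coeffwise u x * coeffwise v y = coeffwise v y * coeffwise u x
  ext n
  rw [PowerSeries.coeff_mul, PowerSeries.coeff_mul, ← Finset.Nat.sum_antidiagonal_swap]
  refine Finset.sum_congr rfl fun p _ => ?_
  exact h _ _

theorem inl_inr_commute (x : A⟦X⟧) (y : B⟦X⟧) :
    Commute (inl (k := k) (B := B) x) (inr (k := k) (A := A) y) :=
  coeffwise_commute _ _ (fun a b => by
    simp [Commute, SemiconjBy, Algebra.TensorProduct.tmul_mul_tmul]) x y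

/-- The (completed) tensor product `f ⊗ f' : (A ⊗ B)[[h]] → (A' ⊗ B')[[h]]` of two
`k[[h]]`-algebra maps `f : A[[h]] → A'[[h]]` and `f' : B[[h]] → B'[[h]]`: the continuous
`k[[h]]`-linear map with `a ⊗ b ↦ f(a) ⊗ f'(b)`. Here `(A ⊗ B)[[h]]` is the `h`-adically completed
tensor product of `A[[h]]` and `B[[h]]` over `k[[h]]`. -/
def tensorMap {A' B' : Type*} [Ring A'] [Algebra k A'] [Ring B'] [Algebra k B']
    (f : A⟦X⟧ →ₐ[k⟦X⟧] A'⟦X⟧) (f' : B⟦X⟧ →ₐ[k⟦X⟧] B'⟦X⟧) :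
    (A ⊗[k] B)⟦X⟧ →ₐ[k⟦X⟧] (A' ⊗[k] B')⟦X⟧ :=
  extend (Algebra.TensorProduct.lift (restrictConst (inl.comp f)) (restrictConst (inr.comp f'))
    (fun _ _ => inl_inr_commute _ _))

/-- Two `k[[h]]`-algebra maps out of `(A ⊗ B)[[h]]` agreeing on both factors are equal. -/
theorem tensor_ext {f g : (A ⊗[k] B)⟦X⟧ →ₐ[k⟦X⟧] D⟦X⟧}
    (h1 : f.comp inl = g.comp inl) (h2 : f.comp inr = g.comp inr) : f = g := by
  have h : restrictConst f = restrictConst g := by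
    refine Algebra.TensorProduct.ext ?_ ?_
    · ext a
      have := DFunLike.congr_fun h1 (PowerSeries.C a)
      simp only [AlgHom.comp_apply, inl, coeffwise_C] at this
      exact congrArg _ this
    · ext a
      have := DFunLike.congr_fun h2 (PowerSeries.C a)
      simp only [AlgHom.comp_apply, inr, coeffwise_C] at this
      exact congrArg _ this
  exact algHom_ext_const fun a => DFunLike.congr_fun h a

section
variable {A' B' : Type*} [Ring A'] [Algebra k A'] [Ring B'] [Algebra k B']

theorem tensorMap_comp_inl (f : A⟦X⟧ →ₐ[k⟦X⟧] A'⟦X⟧) (f' : B⟦X⟧ →ₐ[k⟦X⟧] B'⟦X⟧) :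
    (tensorMap f f').comp inl = inl.comp f := by
  refine algHom_ext_const fun a => ?_
  simp only [AlgHom.comp_apply]
  rw [inl, coeffwise_C, tensorMap, extend_C]
  simp [restrictConst]

theorem tensorMap_comp_inr (f : A⟦X⟧ →ₐ[k⟦X⟧] A'⟦X⟧) (f' : B⟦X⟧ →ₐ[k⟦X⟧] B'⟦X⟧) :
    (tensorMap f f').comp inr = inr.comp f' := by
  refine algHom_ext_const fun a => ?_
  simp only [AlgHom.comp_apply]
  rw [inr, coeffwise_C, tensorMap, extend_C]
  simp [restrictConst]

theorem tensorMap_inl (f : A⟦X⟧ →ₐ[k⟦X⟧] A'⟦X⟧) (f' : B⟦X⟧ →ₐ[k⟦X⟧] B'⟦X⟧) (x : A⟦X⟧) :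
    tensorMap f f' (inl x) = inl (f x) := DFunLike.congr_fun (tensorMap_comp_inl f f') x

theorem tensorMap_inr (f : A⟦X⟧ →ₐ[k⟦X⟧] A'⟦X⟧) (f' : B⟦X⟧ →ₐ[k⟦X⟧] B'⟦X⟧) (x : B⟦X⟧) :
    tensorMap f f' (inr x) = inr (f' x) := DFunLike.congr_fun (tensorMap_comp_inr f f') x

end

/-- Conjugation by a unit as a `k[[h]]`-algebra map. -/
def conjHom (a : (A⟦X⟧)ˣ) : A⟦X⟧ →ₐ[k⟦X⟧] A⟦X⟧ where
  toFun x := a * x * (a⁻¹ : (A⟦X⟧)ˣ)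
  map_zero' := by simp
  map_add' := by simp [mul_add, add_mul]
  map_one' := by simp
  map_mul' := by simp [mul_assoc]
  commutes' c := by
    rw [← Algebra.commutes, mul_assoc]; simp

end Series

/-! ### The bialgebra `U(g)[[h]]` -/

section UEA

variable (k : Type*) [Field k] (g : Type*) [LieRing g] [LieAlgebra k g]

/-- The universal enveloping algebra. -/
abbrev U := UniversalEnvelopingAlgebra k g

attribute [local instance] LieRing.ofAssociativeRing

/-- The coproduct of `U(g)`, determined by `x ↦ x ⊗ 1 + 1 ⊗ x` for `x ∈ g`. -/
def comul₀ : U k g →ₐ[k] U k g ⊗[k] U k g :=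
  UniversalEnvelopingAlgebra.lift k
    { toFun := fun x => UniversalEnvelopingAlgebra.ι k x ⊗ₜ[k] (1 : U k g) +
        (1 : U k g) ⊗ₜ[k] UniversalEnvelopingAlgebra.ι k x
      map_add' := fun x y => by
        simp only [map_add, TensorProduct.add_tmul, TensorProduct.tmul_add]; abel
      map_smul' := fun c x => by
        simp only [map_smul, TensorProduct.smul_tmul', TensorProduct.tmul_smul, smul_add,
          RingHom.id_apply]
      map_lie' := fun {x y} => by
        simp only [LieHom.map_lie, LieRing.of_associative_ring_bracket, mul_add, add_mul,
          Algebra.TensorProduct.tmul_mul_tmul, one_mul, mul_one, TensorProduct.sub_tmul,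
          TensorProduct.tmul_sub]
        abel }

/-- The counit of `U(g)`, determined by `x ↦ 0` for `x ∈ g`. -/
def counit₀ : U k g →ₐ[k] k := UniversalEnvelopingAlgebra.lift k (0 : g →ₗ⁅k⁆ k)

/-- `H = U(g)[[h]]`. -/
abbrev H := (U k g)⟦X⟧

/-- The completed tensor square `H ⊗ H = (U(g) ⊗ U(g))[[h]]`. -/
abbrev H2 := (U k g ⊗[k] U k g)⟦X⟧

/-- The completed tensor cube `H ⊗ H ⊗ H`. -/
abbrev H3 := (U k g ⊗[k] (U k g ⊗[k] U k g))⟦X⟧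

variable {k g}

/-- The coproduct `Δ : H → H ⊗ H`, acting coefficientwise. -/
def comul : H k g →ₐ[k⟦X⟧] H2 k g := coeffwise (comul₀ k g)

/-- The counit `ε : H → k[[h]]`, acting coefficientwise. -/
def counit : H k g →+* k⟦X⟧ := PowerSeries.map (counit₀ k g : U k g →+* k)

/-- `F ↦ F ⊗ 1`. -/
def tmulOne : H2 k g →ₐ[k⟦X⟧] H3 k g :=
  coeffwise ((Algebra.TensorProduct.assoc k k k (U k g) (U k g) (U k g)).toAlgHom.comp
    Algebra.TensorProduct.includeLeft)

/-- `F ↦ 1 ⊗ F`. -/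
def oneTmul : H2 k g →ₐ[k⟦X⟧] H3 k g := coeffwise Algebra.TensorProduct.includeRight

/-- `Δ ⊗ I`. -/
def comulLeft : H2 k g →ₐ[k⟦X⟧] H3 k g :=
  coeffwise ((Algebra.TensorProduct.assoc k k k (U k g) (U k g) (U k g)).toAlgHom.comp
    (Algebra.TensorProduct.map (comul₀ k g) (AlgHom.id k _)))

/-- `I ⊗ Δ`. -/
def comulRight : H2 k g →ₐ[k⟦X⟧] H3 k g :=
  coeffwise (Algebra.TensorProduct.map (AlgHom.id k _) (comul₀ k g))

/-- `ε ⊗ I`. -/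
def counitLeft : H2 k g →ₐ[k⟦X⟧] H k g :=
  coeffwise ((Algebra.TensorProduct.lid k (U k g)).toAlgHom.comp
    (Algebra.TensorProduct.map (counit₀ k g) (AlgHom.id k _)))

/-- `I ⊗ ε`. -/
def counitRight : H2 k g →ₐ[k⟦X⟧] H k g :=
  coeffwise ((Algebra.TensorProduct.rid k k (U k g)).toAlgHom.comp
    (Algebra.TensorProduct.map (AlgHom.id k _) (counit₀ k g)))

/-- The element `a ⊗ a` of `H ⊗ H`. -/
def tmulSelf (a : H k g) : H2 k g := inl a * inr a

theorem tmulOne_inl (x : H k g) : tmulOne (inl x) = (inl x : H3 k g) := by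
  have h : (tmulOne (k := k) (g := g)).comp inl = inl := algHom_ext_const fun a => by
    simp only [AlgHom.comp_apply, inl, tmulOne, coeffwise_C]
    simp [Algebra.TensorProduct.one_def]
  exact DFunLike.congr_fun h x

theorem tmulOne_inr (x : H k g) : tmulOne (inr x) = (inr (inl x : H2 k g) : H3 k g) := by
  have h : (tmulOne (k := k) (g := g)).comp inr = inr.comp inl := algHom_ext_const fun a => by
    simp only [AlgHom.comp_apply, inl, inr, tmulOne, coeffwise_C]
    simp
  exact DFunLike.congr_fun h x

theorem comulLeft_inl (x : H k g) : comulLeft (inl x) = tmulOne (comul x) := by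
  have h : (comulLeft (k := k) (g := g)).comp inl = (tmulOne (k := k) (g := g)).comp comul :=
    algHom_ext_const fun a => by
      simp only [AlgHom.comp_apply, inl, comulLeft, tmulOne, comul, coeffwise_C]
      simp
  exact DFunLike.congr_fun h x

theorem comulLeft_inr (x : H k g) : comulLeft (inr x) = (inr (inr x : H2 k g) : H3 k g) := by
  have h : (comulLeft (k := k) (g := g)).comp inr = inr.comp inr :=
    algHom_ext_const fun a => by
      simp only [AlgHom.comp_apply, inr, comulLeft, coeffwise_C]
      simp [Algebra.TensorProduct.one_def]
  exact DFunLike.congr_fun h x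

theorem comulRight_inl (x : H k g) : comulRight (inl x) = (inl x : H3 k g) := by
  have h : (comulRight (k := k) (g := g)).comp inl = inl :=
    algHom_ext_const fun a => by
      simp only [AlgHom.comp_apply, inl, comulRight, coeffwise_C]
      simp
  exact DFunLike.congr_fun h x

theorem comulRight_inr (x : H k g) : comulRight (inr x) = (oneTmul (comul x) : H3 k g) := by
  have h : (comulRight (k := k) (g := g)).comp inr = (oneTmul (k := k) (g := g)).comp comul :=
    algHom_ext_const fun a => by
      simp only [AlgHom.comp_apply, inr, comulRight, oneTmul, comul, coeffwise_C]
      simp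
  exact DFunLike.congr_fun h x

theorem counit_algebraMap (c : k⟦X⟧) : counit (algebraMap k⟦X⟧ (H k g) c) = c := by
  ext n
  simp [counit, seriesAlgebraMap]

theorem counit_X_mul (T : H k g) : counit (PowerSeries.X * T) = PowerSeries.X * counit T := by
  rw [map_mul, counit, PowerSeries.map_X]

theorem counitLeft_inl (x : H k g) :
    counitLeft (inl x) = algebraMap k⟦X⟧ (H k g) (counit x) := by
  ext n
  rw [seriesAlgebraMap]
  simp [counitLeft, inl, coeffwise, counit, Algebra.algebraMap_eq_smul_one]

theorem counitLeft_inr (x : H k g) : counitLeft (inr x) = x := by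
  ext n
  simp [counitLeft, inr, coeffwise]

theorem counitRight_inl (x : H k g) : counitRight (inl x) = x := by
  ext n
  simp [counitRight, inl, coeffwise]

theorem counitRight_inr (x : H k g) :
    counitRight (inr x) = algebraMap k⟦X⟧ (H k g) (counit x) := by
  ext n
  rw [seriesAlgebraMap]
  simp [counitRight, inr, coeffwise, counit, Algebra.algebraMap_eq_smul_one]

theorem comul_ι (x : g) : comul (PowerSeries.C (UniversalEnvelopingAlgebra.ι k x)) =
    inl (PowerSeries.C (UniversalEnvelopingAlgebra.ι k x)) +
    inr (PowerSeries.C (UniversalEnvelopingAlgebra.ι k x)) := by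
  rw [comul, inl, inr, coeffwise_C, coeffwise_C, coeffwise_C, comul₀,
    UniversalEnvelopingAlgebra.lift_ι_apply, ← map_add]
  rfl

theorem counitLeft_comul (x : H k g) : counitLeft (comul x) = x := by
  have h : ((Algebra.TensorProduct.lid k (U k g)).toAlgHom.comp
      (Algebra.TensorProduct.map (counit₀ k g) (AlgHom.id k _))).comp (comul₀ k g) =
      AlgHom.id k _ := by
    ext x
    simp [comul₀, counit₀, -UniversalEnvelopingAlgebra.ι_apply,
      UniversalEnvelopingAlgebra.lift_ι_apply]
  ext n
  exact DFunLike.congr_fun h _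

theorem tmulOne_commute (F : H2 k g) (x : H k g) :
    Commute (tmulOne F) (inr (inr x : H2 k g) : H3 k g) := by
  have h : (inr (inr x : H2 k g) : H3 k g) = coeffwise
      ((Algebra.TensorProduct.includeRight (R := k) (A := U k g) (B := U k g ⊗[k] U k g)).comp
        Algebra.TensorProduct.includeRight) x := by
    ext n
    simp [inr, coeffwise]
  rw [h]
  refine coeffwise_commute _ _ (fun a b => ?_) F x
  induction a with
  | zero => simp
  | tmul a c => simp [Commute, SemiconjBy, Algebra.TensorProduct.tmul_mul_tmul]
  | add a c ha hc => rw [map_add]; exact ha.add_left hc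

theorem tensorMap_id : tensorMap (AlgHom.id k⟦X⟧ (H k g)) (AlgHom.id k⟦X⟧ (H k g)) =
    AlgHom.id k⟦X⟧ (H2 k g) :=
  tensor_ext (by rw [tensorMap_comp_inl]; rfl) (by rw [tensorMap_comp_inr]; rfl)

theorem tensorMap_tensorMap (f f' : H k g →ₐ[k⟦X⟧] H k g) (Z : H2 k g) :
    tensorMap f f (tensorMap f' f' Z) = tensorMap (f.comp f') (f.comp f') Z := by
  have h : (tensorMap f f).comp (tensorMap f' f') = tensorMap (f.comp f') (f.comp f') := by
    refine tensor_ext ?_ ?_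
    · ext1 x; simp [tensorMap_inl]
    · ext1 x; simp [tensorMap_inr]
  exact DFunLike.congr_fun h Z

theorem tmulOne_tensorMap (f : H k g →ₐ[k⟦X⟧] H k g) (Z : H2 k g) :
    tmulOne (tensorMap f f Z) = tensorMap f (tensorMap f f) (tmulOne Z) := by
  have h : tmulOne.comp (tensorMap f f) = (tensorMap f (tensorMap f f)).comp tmulOne := by
    refine tensor_ext ?_ ?_
    · ext1 x; simp [tensorMap_inl, tmulOne_inl]
    · ext1 x; simp [tensorMap_inl, tensorMap_inr, tmulOne_inr]
  exact DFunLike.congr_fun h Z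

theorem oneTmul_tensorMap (f : H k g →ₐ[k⟦X⟧] H k g) (Z : H2 k g) :
    oneTmul (tensorMap f f Z) = tensorMap f (tensorMap f f) (oneTmul Z) :=
  (tensorMap_inr _ _ _).symm

theorem tensorMap_tmulSelf (f : H k g →ₐ[k⟦X⟧] H k g) (a : H k g) :
    tensorMap f f (tmulSelf a) = tmulSelf (f a) := by
  simp [tmulSelf, tensorMap_inl, tensorMap_inr]

theorem tmulSelf_one : tmulSelf (1 : H k g) = 1 := by simp [tmulSelf]

theorem tmulSelf_mul (a b : H k g) : tmulSelf (a * b) = tmulSelf a * tmulSelf b := by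
  simp only [tmulSelf, map_mul]
  rw [mul_assoc, mul_assoc, ← mul_assoc (inl b), (inl_inr_commute b a).eq, mul_assoc]

/-! ### Twisted endomorphisms and automorphisms -/

variable (k g) in
/-- A twisted endomorphism `(f, F)` of the bialgebra `H = U(g)[[h]]`: a `k[[h]]`-algebra
endomorphism `f` and an invertible `F ∈ H ⊗ H` with `F Δ(f(x)) = (f ⊗ f)(Δ(x)) F`, satisfying the
2-cocycle condition and the normalisation condition. -/
@[ext]
structure TwistedEnd where
  hom : H k g →ₐ[k⟦X⟧] H k g
  twist : (H2 k g)ˣ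
  conj : ∀ x, (twist : H2 k g) * comul (hom x) = tensorMap hom hom (comul x) * twist
  cocycle : tmulOne (twist : H2 k g) * comulLeft (twist : H2 k g) =
    oneTmul (twist : H2 k g) * comulRight (twist : H2 k g)
  norm_left : counitLeft (twist : H2 k g) = 1
  norm_right : counitRight (twist : H2 k g) = 1

namespace TwistedEnd

theorem counit_hom (T : TwistedEnd k g) (x : H k g) : counit (T.hom x) = counit x := by
  have h0 : ∀ y : g, counit (T.hom (PowerSeries.C (UniversalEnvelopingAlgebra.ι k y))) = 0 := by
    intro y
    have h := congrArg counitLeft (T.conj (PowerSeries.C (UniversalEnvelopingAlgebra.ι k y)))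
    rw [map_mul, map_mul, T.norm_left, one_mul, mul_one, counitLeft_comul, comul_ι, map_add,
      map_add, tensorMap_inl, tensorMap_inr, counitLeft_inl, counitLeft_inr] at h
    have h' := congrArg counit (left_eq_add.mp (h.trans (add_comm _ _)))
    rwa [counit_algebraMap, map_zero] at h'
  have h1 : ∀ a : U k g, counit (T.hom (PowerSeries.C a)) = counit (PowerSeries.C a) := by
    let u : U k g →ₐ[k] k⟦X⟧ :=
      { toRingHom := (counit.comp (T.hom : H k g →+* H k g)).comp PowerSeries.C
        commutes' := fun c => by
          have h := (restrictConst T.hom).commutes c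
          change counit (restrictConst T.hom (algebraMap k _ c)) = _
          rw [h, PowerSeries.algebraMap_apply]
          simp [counit] }
    let v : U k g →ₐ[k] k⟦X⟧ :=
      { toRingHom := counit.comp PowerSeries.C
        commutes' := fun c => by
          simp [counit] }
    have huv : u = v := by
      ext y
      have e1 : u (UniversalEnvelopingAlgebra.ι k y) = 0 := h0 y
      have e2 : v (UniversalEnvelopingAlgebra.ι k y) = 0 := by
        change counit (PowerSeries.C (UniversalEnvelopingAlgebra.ι k y)) = 0
        rw [counit, PowerSeries.map_C]
        change PowerSeries.C (counit₀ k g (UniversalEnvelopingAlgebra.ι k y)) = 0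
        rw [counit₀, UniversalEnvelopingAlgebra.lift_ι_apply]
        simp
      exact congrArg _ (e1.trans e2.symm)
    exact fun a => DFunLike.congr_fun huv a
  exact eq_of_const ((counit.comp (T.hom : H k g →+* H k g)).toAddMonoidHom)
    ((counit : H k g →+* k⟦X⟧).toAddMonoidHom)
    (fun S => by
      change counit (T.hom (PowerSeries.X * S)) = PowerSeries.X * counit (T.hom S)
      rw [algHom_X_mul, counit_X_mul])
    (fun S => counit_X_mul S) h1 x

theorem counitLeft_tensorMap (T : TwistedEnd k g) (Z : H2 k g) :
    counitLeft (tensorMap T.hom T.hom Z) = T.hom (counitLeft Z) := by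
  have h : counitLeft.comp (tensorMap T.hom T.hom) = T.hom.comp counitLeft := by
    refine tensor_ext ?_ ?_
    · ext1 x; simp [tensorMap_inl, counitLeft_inl, counit_hom]
    · ext1 x; simp [tensorMap_inr, counitLeft_inr]
  exact DFunLike.congr_fun h Z

theorem counitRight_tensorMap (T : TwistedEnd k g) (Z : H2 k g) :
    counitRight (tensorMap T.hom T.hom Z) = T.hom (counitRight Z) := by
  have h : counitRight.comp (tensorMap T.hom T.hom) = T.hom.comp counitRight := by
    refine tensor_ext ?_ ?_
    · ext1 x; simp [tensorMap_inl, counitRight_inl]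
    · ext1 x; simp [tensorMap_inr, counitRight_inr, counit_hom]
  exact DFunLike.congr_fun h Z

theorem comulLeft_tensorMap (T : TwistedEnd k g) (Z : H2 k g) :
    tmulOne (T.twist : H2 k g) * comulLeft (tensorMap T.hom T.hom Z) =
      tensorMap T.hom (tensorMap T.hom T.hom) (comulLeft Z) * tmulOne (T.twist : H2 k g) := by
  let a : (H3 k g)ˣ := Units.map ((tmulOne : H2 k g →ₐ[k⟦X⟧] H3 k g) : H2 k g →* H3 k g) T.twist
  have h : ((conjHom a).comp comulLeft).comp (tensorMap T.hom T.hom) =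
      (tensorMap T.hom (tensorMap T.hom T.hom)).comp comulLeft := by
    refine tensor_ext ?_ ?_
    · ext1 x
      change (a : H3 k g) * comulLeft (tensorMap T.hom T.hom (inl x)) * (a⁻¹ : (H3 k g)ˣ) =
        tensorMap T.hom (tensorMap T.hom T.hom) (comulLeft (inl x))
      rw [Units.mul_inv_eq_iff_eq_mul]
      change tmulOne (T.twist : H2 k g) * _ = _ * tmulOne (T.twist : H2 k g)
      rw [tensorMap_inl, comulLeft_inl, comulLeft_inl, ← map_mul, T.conj, map_mul,
        tmulOne_tensorMap]
    · ext1 x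
      change (a : H3 k g) * comulLeft (tensorMap T.hom T.hom (inr x)) * (a⁻¹ : (H3 k g)ˣ) =
        tensorMap T.hom (tensorMap T.hom T.hom) (comulLeft (inr x))
      rw [Units.mul_inv_eq_iff_eq_mul]
      change tmulOne (T.twist : H2 k g) * _ = _ * tmulOne (T.twist : H2 k g)
      rw [tensorMap_inr, comulLeft_inr, comulLeft_inr, tensorMap_inr, tensorMap_inr]
      exact tmulOne_commute _ _
  have h' := DFunLike.congr_fun h Z
  change (a : H3 k g) * comulLeft (tensorMap T.hom T.hom Z) * (a⁻¹ : (H3 k g)ˣ) =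
    tensorMap T.hom (tensorMap T.hom T.hom) (comulLeft Z) at h'
  rwa [Units.mul_inv_eq_iff_eq_mul] at h'

theorem comulRight_tensorMap (T : TwistedEnd k g) (Z : H2 k g) :
    oneTmul (T.twist : H2 k g) * comulRight (tensorMap T.hom T.hom Z) =
      tensorMap T.hom (tensorMap T.hom T.hom) (comulRight Z) * oneTmul (T.twist : H2 k g) := by
  let a : (H3 k g)ˣ := Units.map ((oneTmul : H2 k g →ₐ[k⟦X⟧] H3 k g) : H2 k g →* H3 k g) T.twist
  have h : ((conjHom a).comp comulRight).comp (tensorMap T.hom T.hom) =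
      (tensorMap T.hom (tensorMap T.hom T.hom)).comp comulRight := by
    refine tensor_ext ?_ ?_
    · ext1 x
      change (a : H3 k g) * comulRight (tensorMap T.hom T.hom (inl x)) * (a⁻¹ : (H3 k g)ˣ) =
        tensorMap T.hom (tensorMap T.hom T.hom) (comulRight (inl x))
      rw [Units.mul_inv_eq_iff_eq_mul]
      change oneTmul (T.twist : H2 k g) * _ = _ * oneTmul (T.twist : H2 k g)
      rw [tensorMap_inl, comulRight_inl, comulRight_inl, tensorMap_inl]
      exact (inl_inr_commute _ _).symm
    · ext1 x
      change (a : H3 k g) * comulRight (tensorMap T.hom T.hom (inr x)) * (a⁻¹ : (H3 k g)ˣ) =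
        tensorMap T.hom (tensorMap T.hom T.hom) (comulRight (inr x))
      rw [Units.mul_inv_eq_iff_eq_mul]
      change oneTmul (T.twist : H2 k g) * _ = _ * oneTmul (T.twist : H2 k g)
      rw [tensorMap_inr, comulRight_inr, comulRight_inr, ← map_mul, T.conj, map_mul,
        oneTmul_tensorMap]
  have h' := DFunLike.congr_fun h Z
  change (a : H3 k g) * comulRight (tensorMap T.hom T.hom Z) * (a⁻¹ : (H3 k g)ˣ) =
    tensorMap T.hom (tensorMap T.hom T.hom) (comulRight Z) at h'
  rwa [Units.mul_inv_eq_iff_eq_mul] at h'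

/-- The composition `(f', F') ∘ (f, F) = (f' f, (f' ⊗ f')(F) F')`. -/
def comp (T S : TwistedEnd k g) : TwistedEnd k g where
  hom := T.hom.comp S.hom
  twist := Units.map ((tensorMap T.hom T.hom : H2 k g →ₐ[k⟦X⟧] H2 k g) : H2 k g →* H2 k g)
    S.twist * T.twist
  conj x := by
    change tensorMap T.hom T.hom (S.twist : H2 k g) * (T.twist : H2 k g) *
        comul (T.hom (S.hom x)) = tensorMap (T.hom.comp S.hom) (T.hom.comp S.hom) (comul x) *
        (tensorMap T.hom T.hom (S.twist : H2 k g) * (T.twist : H2 k g))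
    rw [mul_assoc, T.conj, ← mul_assoc, ← map_mul, S.conj, map_mul, tensorMap_tensorMap,
      mul_assoc]
  cocycle := by
    change tmulOne (tensorMap T.hom T.hom (S.twist : H2 k g) * (T.twist : H2 k g)) *
        comulLeft (tensorMap T.hom T.hom (S.twist : H2 k g) * (T.twist : H2 k g)) =
      oneTmul (tensorMap T.hom T.hom (S.twist : H2 k g) * (T.twist : H2 k g)) *
        comulRight (tensorMap T.hom T.hom (S.twist : H2 k g) * (T.twist : H2 k g))
    rw [map_mul, map_mul, map_mul, map_mul, mul_assoc, mul_assoc,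
      ← mul_assoc (tmulOne (T.twist : H2 k g)), ← mul_assoc (oneTmul (T.twist : H2 k g)),
      T.comulLeft_tensorMap, T.comulRight_tensorMap, mul_assoc, mul_assoc, T.cocycle,
      tmulOne_tensorMap, oneTmul_tensorMap, ← mul_assoc, ← map_mul, S.cocycle, map_mul,
      mul_assoc]
  norm_left := by
    change counitLeft (tensorMap T.hom T.hom (S.twist : H2 k g) * (T.twist : H2 k g)) = 1
    rw [map_mul, T.counitLeft_tensorMap, S.norm_left, T.norm_left, map_one, one_mul]
  norm_right := by
    change counitRight (tensorMap T.hom T.hom (S.twist : H2 k g) * (T.twist : H2 k g)) = 1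
    rw [map_mul, T.counitRight_tensorMap, S.norm_right, T.norm_right, map_one, one_mul]

variable (k g) in
/-- The identity twisted endomorphism `(id, 1)`. -/
def id : TwistedEnd k g where
  hom := AlgHom.id _ _
  twist := 1
  conj x := by
    rw [tensorMap_id, Units.val_one, one_mul, mul_one, AlgHom.id_apply, AlgHom.id_apply]
  cocycle := by rw [Units.val_one, map_one, map_one, map_one, map_one]
  norm_left := by rw [Units.val_one, map_one]
  norm_right := by rw [Units.val_one, map_one]

theorem comp_hom (T S : TwistedEnd k g) : (comp T S).hom = T.hom.comp S.hom := rfl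

theorem comp_twist (T S : TwistedEnd k g) : ((comp T S).twist : H2 k g) =
    tensorMap T.hom T.hom (S.twist : H2 k g) * (T.twist : H2 k g) := rfl

theorem id_hom : (id k g).hom = AlgHom.id k⟦X⟧ (H k g) := rfl

theorem id_twist : (((id k g).twist : (H2 k g)ˣ) : H2 k g) = 1 := rfl

theorem id_comp (T : TwistedEnd k g) : comp (id k g) T = T := by
  refine TwistedEnd.ext ?_ (Units.ext ?_)
  · rw [comp_hom, id_hom, AlgHom.id_comp]
  · rw [comp_twist, id_twist, mul_one, id_hom, tensorMap_id, AlgHom.id_apply]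

theorem comp_id (T : TwistedEnd k g) : comp T (id k g) = T := by
  refine TwistedEnd.ext ?_ (Units.ext ?_)
  · rw [comp_hom, id_hom, AlgHom.comp_id]
  · rw [comp_twist, id_twist, map_one, one_mul]

theorem comp_assoc (T S R : TwistedEnd k g) : comp (comp T S) R = comp T (comp S R) := by
  refine TwistedEnd.ext ?_ (Units.ext ?_)
  · rw [comp_hom, comp_hom, comp_hom, comp_hom, AlgHom.comp_assoc]
  · rw [comp_twist, comp_twist, comp_twist, comp_twist, comp_hom, map_mul, tensorMap_tensorMap,
      mul_assoc]

/-- Twisted endomorphisms form a monoid under composition, with unit `(id, 1)`. -/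
instance : Monoid (TwistedEnd k g) where
  mul := comp
  one := id k g
  one_mul := id_comp
  mul_one := comp_id
  mul_assoc := comp_assoc

theorem mul_hom (T S : TwistedEnd k g) (x : H k g) : (T * S).hom x = T.hom (S.hom x) := rfl

theorem mul_twist (T S : TwistedEnd k g) : ((T * S).twist : H2 k g) =
    tensorMap T.hom T.hom (S.twist : H2 k g) * (T.twist : H2 k g) := rfl

variable (k g) in
/-- The first component `(f, F) ↦ f`. -/
def homPart : TwistedEnd k g →* (H k g →ₐ[k⟦X⟧] H k g) where
  toFun T := T.hom
  map_one' := rfl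
  map_mul' _ _ := rfl

/-- `a` is a gauge transformation `(f, F) → (f', F')`: `a f(x) = f'(x) a` for all `x`, and
`F' Δ(a) = (a ⊗ a) F`. -/
def IsGauge (a : H k g) (T S : TwistedEnd k g) : Prop :=
  (∀ x, a * T.hom x = S.hom x * a) ∧
    (S.twist : H2 k g) * comul a = tmulSelf a * (T.twist : H2 k g)

/-- Gauge isomorphism: there is an invertible gauge transformation. -/
def GaugeIso (T S : TwistedEnd k g) : Prop := ∃ a : (H k g)ˣ, IsGauge (a : H k g) T S

theorem GaugeIso.refl (T : TwistedEnd k g) : GaugeIso T T :=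
  ⟨1, by simp, by simp [tmulSelf_one]⟩

theorem GaugeIso.symm {T S : TwistedEnd k g} : GaugeIso T S → GaugeIso S T := by
  rintro ⟨a, h1, h2⟩
  refine ⟨a⁻¹, fun x => ?_, ?_⟩
  · rw [← Units.mul_right_inj a, ← Units.mul_left_inj a]
    simp [mul_assoc, h1]
  · have e1 : tmulSelf (a : H k g) * tmulSelf ((a⁻¹ : (H k g)ˣ) : H k g) = 1 := by
      rw [← tmulSelf_mul, Units.mul_inv, tmulSelf_one]
    have e2 : tmulSelf ((a⁻¹ : (H k g)ˣ) : H k g) * tmulSelf (a : H k g) = 1 := by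
      rw [← tmulSelf_mul, Units.inv_mul, tmulSelf_one]
    have e3 : comul (a : H k g) * comul ((a⁻¹ : (H k g)ˣ) : H k g) = 1 := by
      rw [← map_mul, Units.mul_inv, map_one]
    calc (T.twist : H2 k g) * comul ((a⁻¹ : (H k g)ˣ) : H k g)
        = tmulSelf ((a⁻¹ : (H k g)ˣ) : H k g) * (tmulSelf (a : H k g) * T.twist) *
            comul ((a⁻¹ : (H k g)ˣ) : H k g) := by rw [← mul_assoc _ _ (T.twist : H2 k g), e2, one_mul]
      _ = _ := by rw [← h2, mul_assoc, mul_assoc, e3, mul_one]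

theorem GaugeIso.trans {T S R : TwistedEnd k g} :
    GaugeIso T S → GaugeIso S R → GaugeIso T R := by
  rintro ⟨a, h1, h2⟩ ⟨b, h3, h4⟩
  refine ⟨b * a, fun x => ?_, ?_⟩
  · rw [Units.val_mul, mul_assoc, h1, ← mul_assoc, h3, mul_assoc]
  · rw [Units.val_mul, map_mul, ← mul_assoc, h4, mul_assoc, h2, tmulSelf_mul, mul_assoc]

theorem GaugeIso.mul {T T' S S' : TwistedEnd k g} :
    GaugeIso T T' → GaugeIso S S' → GaugeIso (T * S) (T' * S') := by
  rintro ⟨a, h1, h2⟩ ⟨b, h3, h4⟩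
  have h5 : ∀ Z : H2 k g, tensorMap T'.hom T'.hom Z * tmulSelf (a : H k g) =
      tmulSelf (a : H k g) * tensorMap T.hom T.hom Z := by
    let c : (H2 k g)ˣ := ⟨tmulSelf (a : H k g), tmulSelf ((a⁻¹ : (H k g)ˣ) : H k g),
      by rw [← tmulSelf_mul, Units.mul_inv, tmulSelf_one],
      by rw [← tmulSelf_mul, Units.inv_mul, tmulSelf_one]⟩
    have h : (conjHom c).comp (tensorMap T.hom T.hom) = tensorMap T'.hom T'.hom := by
      refine tensor_ext ?_ ?_
      · ext1 x
        change (c : H2 k g) * tensorMap T.hom T.hom (inl x) * (c⁻¹ : (H2 k g)ˣ) =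
          tensorMap T'.hom T'.hom (inl x)
        rw [Units.mul_inv_eq_iff_eq_mul]
        change inl (a : H k g) * inr (a : H k g) * _ = _ * (inl (a : H k g) * inr (a : H k g))
        rw [tensorMap_inl, tensorMap_inl, mul_assoc, ← (inl_inr_commute _ _).eq, ← mul_assoc,
          ← map_mul, h1, map_mul, mul_assoc]
      · ext1 x
        change (c : H2 k g) * tensorMap T.hom T.hom (inr x) * (c⁻¹ : (H2 k g)ˣ) =
          tensorMap T'.hom T'.hom (inr x)
        rw [Units.mul_inv_eq_iff_eq_mul]
        change inl (a : H k g) * inr (a : H k g) * _ = _ * (inl (a : H k g) * inr (a : H k g))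
        rw [tensorMap_inr, tensorMap_inr, mul_assoc, ← map_mul, h1, map_mul, ← mul_assoc,
          (inl_inr_commute _ _).eq, mul_assoc]
    intro Z
    have h' := DFunLike.congr_fun h Z
    change (c : H2 k g) * tensorMap T.hom T.hom Z * (c⁻¹ : (H2 k g)ˣ) = _ at h'
    rw [Units.mul_inv_eq_iff_eq_mul] at h'
    exact h'.symm
  refine ⟨a * Units.map ((T.hom : H k g →ₐ[k⟦X⟧] H k g) : H k g →* H k g) b, fun x => ?_, ?_⟩
  · change (a : H k g) * T.hom (b : H k g) * T.hom (S.hom x) =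
      T'.hom (S'.hom x) * ((a : H k g) * T.hom (b : H k g))
    rw [mul_assoc, ← map_mul, h3, map_mul, ← mul_assoc, h1, mul_assoc]
  · change tensorMap T'.hom T'.hom (S'.twist : H2 k g) * (T'.twist : H2 k g) *
        comul ((a : H k g) * T.hom (b : H k g)) =
      tmulSelf ((a : H k g) * T.hom (b : H k g)) *
        (tensorMap T.hom T.hom (S.twist : H2 k g) * (T.twist : H2 k g))
    rw [map_mul, mul_assoc, ← mul_assoc (T'.twist : H2 k g), h2, mul_assoc (tmulSelf _), T.conj,
      ← mul_assoc, h5, mul_assoc, ← mul_assoc (tensorMap T.hom T.hom (S'.twist : H2 k g)),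
      ← map_mul, h4, map_mul, tensorMap_tmulSelf, tmulSelf_mul]
    simp only [mul_assoc]

end TwistedEnd

variable (k g)

/-- The group of twisted automorphisms of `U(g)[[h]]`: the invertible twisted endomorphisms. -/
abbrev TwistedAut := (TwistedEnd k g)ˣ

/-- The group of invariant twists: twisted automorphisms `(1, F)` whose first component is the
identity. For these the first condition says that `F` commutes with `Δ(H)`. -/
def invariantTwists : Subgroup (TwistedAut k g) :=
  (Units.map (TwistedEnd.homPart k g)).ker

/-- Gauge isomorphism, as a congruence on the group of twisted automorphisms. -/
def gaugeCon : Con (TwistedAut k g) where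
  r T S := TwistedEnd.GaugeIso (T : TwistedEnd k g) (S : TwistedEnd k g)
  iseqv := ⟨fun _ => .refl _, fun h => h.symm, fun h h' => h.trans h'⟩
  mul' h h' := h.mul h'

/-- The group of gauge classes of twisted automorphisms. -/
abbrev GaugeClasses := (gaugeCon k g).Quotient

variable {k g} in
/-- The gauge class of a twisted automorphism. -/
def gaugeClass (T : TwistedAut k g) : GaugeClasses k g := (T : (gaugeCon k g).Quotient)

/-! ### Bialgebra automorphisms -/

/-- The monoid of bialgebra endomorphisms of `U(g)[[h]]` (over `k[[h]]`). -/
def bialgEnd : Submonoid (H k g →ₐ[k⟦X⟧] H k g) where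
  carrier := {f | (∀ x, comul (f x) = tensorMap f f (comul x)) ∧ ∀ x, counit (f x) = counit x}
  one_mem' := ⟨fun x => by
    change comul x = tensorMap (AlgHom.id _ _) (AlgHom.id _ _) (comul x)
    rw [tensorMap_id]; rfl, fun _ => rfl⟩
  mul_mem' {f f'} h h' := ⟨fun x => by
    change comul (f (f' x)) = tensorMap (f.comp f') (f.comp f') (comul x)
    rw [h.1, h'.1, tensorMap_tensorMap], fun x => by
    change counit (f (f' x)) = _
    rw [h.2, h'.2]⟩

/-- The group of bialgebra automorphisms of `U(g)[[h]]`. -/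
abbrev BialgAut := (bialgEnd k g)ˣ

variable {k g}

/-- The underlying algebra endomorphism of a bialgebra automorphism. -/
def BialgAut.toHom (f : BialgAut k g) : H k g →ₐ[k⟦X⟧] H k g := ((f : bialgEnd k g) : _)

theorem BialgAut.toHom_inv (f : BialgAut k g) (x : H k g) :
    BialgAut.toHom f (BialgAut.toHom f⁻¹ x) = x :=
  DFunLike.congr_fun (congrArg Subtype.val f.mul_inv) x

/-- `f ↦ (f, 1)`, from bialgebra automorphisms to twisted automorphisms. -/
def ofBialg : BialgAut k g →* TwistedAut k g := Units.map
  { toFun := fun f => ⟨f, 1, fun x => by simp [f.2.1 x], by simp, by simp, by simp⟩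
    map_one' := rfl
    map_mul' := fun f f' => TwistedEnd.ext rfl (Units.ext (by
      rw [TwistedEnd.mul_twist]; simp)) }

/-- An invertible element of `H` is group-like if `Δ(a) = a ⊗ a`. -/
def IsGrouplike (a : (H k g)ˣ) : Prop := comul (a : H k g) = tmulSelf (a : H k g)

variable (k g)

/-- The inner bialgebra automorphisms: conjugations `x ↦ a x a⁻¹` by group-like elements. -/
def innerBialg : Subgroup (BialgAut k g) where
  carrier := {f | ∃ a : (H k g)ˣ, IsGrouplike a ∧
    ∀ x, BialgAut.toHom f x = a * x * (a⁻¹ : (H k g)ˣ)}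
  one_mem' := ⟨1, by simp [IsGrouplike, tmulSelf_one], fun x => by
    simp [BialgAut.toHom]⟩
  mul_mem' := by
    rintro f f' ⟨a, ha, hf⟩ ⟨b, hb, hf'⟩
    refine ⟨a * b, ?_, fun x => ?_⟩
    · rw [IsGrouplike] at *
      rw [Units.val_mul, map_mul, ha, hb, tmulSelf_mul]
    · change BialgAut.toHom f (BialgAut.toHom f' x) = _
      rw [hf, hf']
      simp [mul_assoc]
  inv_mem' := by
    rintro f ⟨a, ha, hf⟩
    refine ⟨a⁻¹, ?_, fun x => ?_⟩
    · rw [IsGrouplike] at *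
      have e1 : tmulSelf ((a⁻¹ : (H k g)ˣ) : H k g) * tmulSelf (a : H k g) = 1 := by
        rw [← tmulSelf_mul, Units.inv_mul, tmulSelf_one]
      have e3 : comul (a : H k g) * comul ((a⁻¹ : (H k g)ˣ) : H k g) = 1 := by
        rw [← map_mul, Units.mul_inv, map_one]
      rw [ha] at e3
      exact (left_inv_eq_right_inv e1 e3).symm
    · have h := hf (BialgAut.toHom f⁻¹ x)
      rw [BialgAut.toHom_inv] at h
      conv_rhs => rw [h]
      simp [mul_assoc]

instance innerBialg_normal : (innerBialg k g).Normal where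
  conj_mem := by
    rintro f ⟨a, ha, hf⟩ q
    refine ⟨Units.map ((BialgAut.toHom q : H k g →ₐ[k⟦X⟧] H k g) : H k g →* H k g) a, ?_,
      fun x => ?_⟩
    · rw [IsGrouplike] at *
      change comul (BialgAut.toHom q (a : H k g)) = tmulSelf (BialgAut.toHom q (a : H k g))
      rw [← tensorMap_tmulSelf, ← ha]
      exact q.val.2.1 _
    · change BialgAut.toHom q (BialgAut.toHom f (BialgAut.toHom q⁻¹ x)) =
        BialgAut.toHom q (a : H k g) * x * BialgAut.toHom q ((a⁻¹ : (H k g)ˣ) : H k g)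
      rw [hf, map_mul, map_mul, BialgAut.toHom_inv]

/-- The group of outer bialgebra automorphisms of `U(g)[[h]]`. -/
abbrev OutBialg := BialgAut k g ⧸ innerBialg k g

/-! ### Invariant skew-symmetric tensors and their exponentials -/

/-- `(Λ² g)^g`: the skew-symmetric tensors in `g ⊗ g` which are invariant under the adjoint
action of `g`. -/
def invSkew : Submodule k (g ⊗[k] g) where
  carrier := {t | TensorProduct.comm k g g t = -t ∧ ∀ x : g, ⁅x, t⁆ = 0}
  zero_mem' := by simp
  add_mem' {s t} hs ht := ⟨by rw [map_add, hs.1, ht.1, neg_add], fun x => by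
    rw [lie_add, hs.2, ht.2, add_zero]⟩
  smul_mem' c t ht := ⟨by rw [map_smul, ht.1, smul_neg], fun x => by
    rw [lie_smul, ht.2, smul_zero]⟩

/-- `(Λ² g)^g[[h]]`: the sequence `(Xₙ)` stands for the formal series `∑ Xₙ hⁿ`. -/
abbrev InvSkewSeries := ℕ → invSkew k g

variable {k g}

/-- The series `∑ Xₙ hⁿ` as an element of `(U(g) ⊗ U(g))[[h]]`. -/
def InvSkewSeries.toH2 (x : InvSkewSeries k g) : H2 k g :=
  PowerSeries.mk fun n => TensorProduct.map
    ((UniversalEnvelopingAlgebra.ι k : g →ₗ⁅k⁆ U k g) : g →ₗ[k] U k g)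
    ((UniversalEnvelopingAlgebra.ι k : g →ₗ⁅k⁆ U k g) : g →ₗ[k] U k g) (x n : g ⊗[k] g)

/-- `exp(h Y) = ∑ₘ (h Y)ᵐ / m!` for a formal power series `Y`. Since `(h Y)ᵐ` is divisible by `hᵐ`,
only the terms with `m ≤ n` contribute to the coefficient of `hⁿ`. -/
def expH (Y : H2 k g) : H2 k g := PowerSeries.mk fun n =>
  ∑ m ∈ Finset.range (n + 1),
    ((m.factorial : k)⁻¹) • PowerSeries.coeff n ((PowerSeries.X * Y) ^ m)

end UEA

end TwistedUEA

end

open scoped PowerSeries TensorProduct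

noncomputable section

namespace TwistedUEA

/-! ### The Poincaré–Birkhoff–Witt module -/

/-! The twist F of a twisted automorphism reduces modulo h to a unit of U(g) ⊗ U(g) = U(g × g). By
Poincaré–Birkhoff–Witt such a unit is a scalar, and the normalisation makes it 1
(`TwistedEnd.coeff_zero_twist`). If F is 1 modulo hⁿ, then its coefficient at hⁿ is a normalised
2-cocycle of the coalgebra U(g), so everything rests on the description of these cocycles.

`IsCocycle.exists_decomposition` writes such a cocycle as a skew tensor in g ⊗ g plus a coboundary
Δ(b) - b ⊗ 1 - 1 ⊗ b. The tool is the doubling map D, the coproduct followed by multiplication. In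
characteristic zero U(g) is spanned by the powers xⁿ with x in g, and D xⁿ = 2ⁿ xⁿ, so the
eigenspaces of D grade U(g), with g in degree one. Contracting the cocycle identity by
multiplications shows that F - τF has degree one in both legs and that (D ⊗ D)F is 2F plus a
coboundary plus F - τF. On normalised tensors D ⊗ D only has eigenvalues 2^(i+j) with i, j ≥ 1,
never 2, so these relations determine F.

Order by order, the skew part is then absorbed into exp(hX) and the coboundary is removed by a gauge
transformation 1 + hⁿ b. In the limit (`TwistedEnd.exists_gauge_hexp`) the twist becomes exp(hX),
which commutes with Δ(H). The conjugated endomorphism is therefore a bialgebra automorphism, which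
is the factorisation in the first claim.

For the group structure, the commutator of two invariant skew tensors is a symmetric cocycle, hence
the coboundary of a central element. It commutes with both tensors, so the short
Baker–Campbell–Hausdorff formula applies, and its error term is the coboundary of a central gauge
transformation (`expTwist_mul_gaugeIso`). Hence X ↦ [(1, exp(hX))] is additive. Injectivity comes
from the flip: exp(hX)Δ(a) = a ⊗ a is turned into exp(-hX)Δ(a) = a ⊗ a, so exp(2hX) = 1, X = 0 and a
is group-like. -/

/-- The universal enveloping algebra is generated by the Lie algebra. -/
theorem adjoin_range_ι {k L : Type*} [Field k] [LieRing L] [LieAlgebra k L] :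
    Algebra.adjoin k (Set.range (UniversalEnvelopingAlgebra.ι k : L → U k L)) = ⊤ := by
  let _ : LieRing (U k L) := LieRing.ofAssociativeRing
  let B := Algebra.adjoin k (Set.range (UniversalEnvelopingAlgebra.ι k : L → U k L))
  let _ : LieRing B := LieRing.ofAssociativeRing
  let j : L →ₗ⁅k⁆ B :=
    { toFun := fun x => ⟨UniversalEnvelopingAlgebra.ι k x, Algebra.subset_adjoin ⟨x, rfl⟩⟩
      map_add' := fun x y => Subtype.ext (map_add _ x y)
      map_smul' := fun c x => Subtype.ext (map_smul _ c x)
      map_lie' := fun {x y} => Subtype.ext (LieHom.map_lie _ x y) }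
  have h : B.val.comp (UniversalEnvelopingAlgebra.lift k j) = AlgHom.id k (U k L) := by
    refine UniversalEnvelopingAlgebra.hom_ext k (LieHom.ext fun x => ?_)
    change B.val (UniversalEnvelopingAlgebra.lift k j (UniversalEnvelopingAlgebra.ι k x)) =
      UniversalEnvelopingAlgebra.ι k x
    rw [UniversalEnvelopingAlgebra.lift_ι_apply]
    rfl
  rw [eq_top_iff]
  intro u _
  have hu : B.val (UniversalEnvelopingAlgebra.lift k j u) = u := DFunLike.congr_fun h u
  rw [← hu]
  exact Subtype.property _

namespace PBW

section Module

variable {k L I : Type*} [Field k] [LieRing L] [LieAlgebra k L]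

/-- The monic monomial with exponent `M`. -/
abbrev mono (k : Type*) {I : Type*} [Field k] (M : I →₀ ℕ) : MvPolynomial I k :=
  MvPolynomial.monomial M 1

/-- Polynomials all of whose monomials have degree less than `n`. -/
def degLT (k I : Type*) [Field k] (n : ℕ) : Submodule k (MvPolynomial I k) :=
  Submodule.span k {p | ∃ M : I →₀ ℕ, M.degree < n ∧ p = mono k M}

theorem mono_mem_degLT {M : I →₀ ℕ} {n : ℕ} (h : M.degree < n) : mono k M ∈ degLT k I n :=
  Submodule.subset_span ⟨M, h, rfl⟩

theorem degLT_mono {m n : ℕ} (h : m ≤ n) : degLT k I m ≤ degLT k I n :=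
  Submodule.span_mono fun _ ⟨M, hM, e⟩ => ⟨M, hM.trans_le h, e⟩

theorem degLT_induction {n : ℕ} {P : MvPolynomial I k → Prop} (W : Submodule k (MvPolynomial I k))
    (hW : ∀ p, p ∈ W ↔ P p) (h : ∀ M : I →₀ ℕ, M.degree < n → P (mono k M))
    {p : MvPolynomial I k} (hp : p ∈ degLT k I n) : P p := by
  rw [← hW]
  refine (Submodule.span_le.2 ?_ : degLT k I n ≤ W) hp
  rintro _ ⟨M, hM, rfl⟩
  exact (hW _).2 (h M hM)

theorem coeff_eq_zero_of_mem_degLT {n : ℕ} {p : MvPolynomial I k} (hp : p ∈ degLT k I n)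
    {M : I →₀ ℕ} (hM : n ≤ M.degree) : MvPolynomial.coeff M p = 0 := by
  refine degLT_induction (P := fun p => MvPolynomial.coeff M p = 0)
    (LinearMap.ker (MvPolynomial.lcoeff k M)) (fun p => by simp [MvPolynomial.lcoeff]) ?_ hp
  intro N hN
  classical
  rw [MvPolynomial.coeff_monomial, if_neg]
  rintro rfl
  omega

theorem mem_degLT_totalDegree (p : MvPolynomial I k) : p ∈ degLT k I (p.totalDegree + 1) := by
  rw [p.as_sum]
  refine Submodule.sum_mem _ fun M hM => ?_
  have h := MvPolynomial.le_totalDegree hM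
  rw [← p.as_sum, ← mul_one (MvPolynomial.coeff M p), ← smul_eq_mul,
    ← MvPolynomial.smul_monomial]
  refine Submodule.smul_mem _ _ (mono_mem_degLT ?_)
  exact Nat.lt_succ_of_le h

theorem X_mul_mono (i : I) (M : I →₀ ℕ) :
    MvPolynomial.X i * mono k M = mono k (M + Finsupp.single i 1) := by
  rw [mono, mono, MvPolynomial.monomial_add_single, pow_one, mul_comm]

theorem degree_add_single (M : I →₀ ℕ) (i : I) :
    (M + Finsupp.single i 1).degree = M.degree + 1 := by
  rw [map_add, Finsupp.degree_single]

theorem X_mul_mem_degLT {n : ℕ} {p : MvPolynomial I k} (i : I) (hp : p ∈ degLT k I n) :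
    MvPolynomial.X i * p ∈ degLT k I (n + 1) := by
  refine degLT_induction (P := fun p => MvPolynomial.X i * p ∈ degLT k I (n + 1))
    ((degLT k I (n + 1)).comap (LinearMap.mulLeft k (MvPolynomial.X i))) (fun p => Iff.rfl) ?_ hp
  intro M hM
  rw [X_mul_mono]
  refine mono_mem_degLT ?_
  rw [degree_add_single]
  omega

theorem mem_support_add_single (m : I) (M : I →₀ ℕ) :
    m ∈ (M + Finsupp.single m 1).support := by
  simp

theorem basis_induction (b : Module.Basis I k L) {V : Type*} [AddCommGroup V] [Module k V] {f f' : L →ₗ[k] V}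
    (h : ∀ i, f (b i) = f' (b i)) (x : L) : f x = f' x :=
  DFunLike.congr_fun (b.ext h) x

theorem apply_mem_of_basis (b : Module.Basis I k L) {V : Type*} [AddCommGroup V] [Module k V] (f : L →ₗ[k] V)
    (W : Submodule k V) (h : ∀ i, f (b i) ∈ W) (x : L) : f x ∈ W := by
  have : (⊤ : Submodule k L) ≤ W.comap f := by
    rw [← b.span_eq, Submodule.span_le]
    rintro _ ⟨i, rfl⟩
    exact h i
  exact this trivial

/-! ### Splitting off the least variable of a monomial. -/

variable [LinearOrder I]

/-- `i` is at most every index occurring in `M`. -/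
def LeAll (i : I) (M : I →₀ ℕ) : Prop := ∀ j ∈ M.support, i ≤ j

theorem LeAll.add_single {m i : I} {M : I →₀ ℕ} (h : LeAll m M) (hi : m ≤ i) :
    LeAll m (M + Finsupp.single i 1) := by
  intro j hj
  rcases Finset.mem_union.1 (Finsupp.support_add hj) with hj | hj
  · exact h j hj
  · rw [Finset.mem_singleton.1 (Finsupp.support_single_subset hj)]
    exact hi

theorem min'_add_single {m : I} {M : I →₀ ℕ} (h : LeAll m M)
    (hne : (M + Finsupp.single m 1).support.Nonempty) :
    (M + Finsupp.single m 1).support.min' hne = m :=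
  le_antisymm (Finset.min'_le _ _ (mem_support_add_single m M))
    (Finset.le_min' _ _ _ (h.add_single le_rfl))

/-- A nontrivial monomial is the product of its least variable and a rest. -/
theorem exists_min_of_nonempty {M : I →₀ ℕ} (hne : M.support.Nonempty) :
    ∃ m N, LeAll m N ∧ M = N + Finsupp.single m 1 := by
  have hm := Finset.min'_mem _ hne
  have hle : Finsupp.single (M.support.min' hne) 1 ≤ M := by
    rw [Finsupp.single_le_iff]
    exact Nat.one_le_iff_ne_zero.2 (Finsupp.mem_support_iff.1 hm)
  refine ⟨M.support.min' hne, M - Finsupp.single (M.support.min' hne) 1, ?_,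
    (tsub_add_cancel_of_le hle).symm⟩
  intro j hj
  refine Finset.min'_le _ _ ?_
  rw [Finsupp.mem_support_iff] at hj ⊢
  intro h0
  apply hj
  simp [h0]

theorem exists_min {i : I} {M : I →₀ ℕ} (h : ¬ LeAll i M) :
    ∃ m N, m < i ∧ LeAll m N ∧ M = N + Finsupp.single m 1 := by
  have hne : M.support.Nonempty := by
    by_contra hne
    exact h fun j hj => (hne ⟨j, hj⟩).elim
  obtain ⟨m, N, hN, rfl⟩ := exists_min_of_nonempty hne
  refine ⟨m, N, ?_, hN, rfl⟩
  by_contra hlt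
  exact h fun j hj => (not_lt.1 hlt).trans (hN.add_single le_rfl j hj)

/-! ### Recursive construction of the action of L on polynomials. -/

variable (b : Module.Basis I k L)

open Classical in
/-- One step of the recursion defining the action of `L` on polynomials. -/
def step (R : L →ₗ[k] MvPolynomial I k →ₗ[k] MvPolynomial I k) :
    L →ₗ[k] MvPolynomial I k →ₗ[k] MvPolynomial I k :=
  b.constr k fun i => (MvPolynomial.basisMonomials I k).constr k fun M =>
    -- The second alternative is contained in the first, since `LeAll` is vacuous on an empty
    -- support; it is listed so that the other branch can form the minimum.
    if h : LeAll i M ∨ ¬ M.support.Nonempty then MvPolynomial.X i * mono k M else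
      let m := M.support.min' (not_not.1 (not_or.1 h).2)
      let N := M - Finsupp.single m 1
      -- For M = N + m with m least and m < i, the relation to be enforced is x_i(x_m N) = x_m(x_i
      -- N) + [x_i, x_m]N. Splitting x_i N into X_i N and a lower part, x_m acts on X_i N by plain
      -- multiplication, which gives the leading term; `R` is only needed on degrees below that of
      -- M.
      MvPolynomial.X i * mono k M + R (b m) (R (b i) (mono k N) - MvPolynomial.X i * mono k N) +
        R ⁅b i, b m⁆ (mono k N)

theorem step_of_leAll (R : L →ₗ[k] MvPolynomial I k →ₗ[k] MvPolynomial I k) {i : I}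
    {M : I →₀ ℕ} (h : LeAll i M) : step b R (b i) (mono k M) = MvPolynomial.X i * mono k M := by
  have e : mono k M = MvPolynomial.basisMonomials I k M := by simp
  rw [step, Module.Basis.constr_basis, e, Module.Basis.constr_basis, dif_pos (Or.inl h), e]

theorem step_add_single (R : L →ₗ[k] MvPolynomial I k →ₗ[k] MvPolynomial I k) {i m : I}
    {N : I →₀ ℕ} (hm : LeAll m N) (hi : m < i) :
    step b R (b i) (mono k (N + Finsupp.single m 1)) =
      MvPolynomial.X i * mono k (N + Finsupp.single m 1) +
        R (b m) (R (b i) (mono k N) - MvPolynomial.X i * mono k N) + R ⁅b i, b m⁆ (mono k N) := by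
  have e : ∀ M : I →₀ ℕ, MvPolynomial.basisMonomials I k M = mono k M := by simp
  have hne : (N + Finsupp.single m 1).support.Nonempty := ⟨m, mem_support_add_single m N⟩
  have h : ¬ (LeAll i (N + Finsupp.single m 1) ∨ ¬ (N + Finsupp.single m 1).support.Nonempty) := by
    rintro (h | h)
    · exact absurd (h m (mem_support_add_single m N)) (not_le.2 hi)
    · exact h hne
  rw [step, Module.Basis.constr_basis, ← e (N + Finsupp.single m 1), Module.Basis.constr_basis,
    dif_neg h]
  simp only [min'_add_single hm hne, add_tsub_cancel_right, e]

/-- The iterates of the recursion. -/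
def approx (n : ℕ) : L →ₗ[k] MvPolynomial I k →ₗ[k] MvPolynomial I k := (step b)^[n] 0

theorem approx_succ (n : ℕ) : approx b (n + 1) = step b (approx b n) :=
  Function.iterate_succ_apply' _ _ _

/-- One step of the recursion uses the previous iterate only on lower degrees, provided the
correction to multiplication by X_i does not raise the degree. Stabilisation and this degree bound
depend on each other, so they are proved in one induction. -/
theorem approx_agree (n : ℕ) :
    (∀ (x : L) (M : I →₀ ℕ), M.degree < n →
      approx b n x (mono k M) = approx b (n + 1) x (mono k M)) ∧
    ∀ (i : I) (p : MvPolynomial I k) (m : ℕ), m ≤ n → p ∈ degLT k I m →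
      approx b n (b i) p - MvPolynomial.X i * p ∈ degLT k I m := by
  induction n with
  | zero =>
    refine ⟨fun _ _ h => absurd h (Nat.not_lt_zero _), fun i p m hm hp => ?_⟩
    obtain rfl : m = 0 := by omega
    have h0 : degLT k I 0 = ⊥ := by
      rw [degLT, Submodule.span_eq_bot]
      rintro _ ⟨M, hM, _⟩
      exact absurd hM (Nat.not_lt_zero _)
    rw [h0, Submodule.mem_bot] at hp
    simp [hp]
  | succ n ih =>
    obtain ⟨ih1, ih2⟩ := ih
    have agree : ∀ (x : L) (p : MvPolynomial I k), p ∈ degLT k I n →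
        approx b n x p = approx b (n + 1) x p := by
      intro x p hp
      refine degLT_induction (P := fun p => approx b n x p = approx b (n + 1) x p)
        (LinearMap.eqLocus (approx b n x) (approx b (n + 1) x)) (fun p => Iff.rfl) (ih1 x) hp
    have mem : ∀ (x : L) (m : ℕ) (p : MvPolynomial I k), m ≤ n → p ∈ degLT k I m →
        approx b n x p ∈ degLT k I (m + 1) := by
      intro x m p hm hp
      refine apply_mem_of_basis b ((approx b n).flip p) (degLT k I (m + 1)) (fun i => ?_) x
      have h := (degLT k I (m + 1)).add_mem (degLT_mono (Nat.le_succ m) (ih2 i p m hm hp))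
        (X_mul_mem_degLT i hp)
      rwa [sub_add_cancel] at h
    refine ⟨fun x M hM => ?_, fun i p m hm hp => ?_⟩
    · refine basis_induction b (f := (approx b (n + 1)).flip (mono k M))
        (f' := (approx b (n + 2)).flip (mono k M)) (fun i => ?_) x
      simp only [LinearMap.flip_apply]
      rw [approx_succ b n, approx_succ b (n + 1)]
      by_cases h : LeAll i M
      · rw [step_of_leAll b _ h, step_of_leAll b _ h]
      · obtain ⟨m, N, hi, hN, rfl⟩ := exists_min h
        rw [degree_add_single] at hM
        have hN' : mono k N ∈ degLT k I n := mono_mem_degLT (by omega)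
        rw [step_add_single b _ hN hi, step_add_single b _ hN hi, ← agree _ _ hN',
          ← agree _ _ hN', ← agree _ _ (ih2 i _ n le_rfl hN')]
    · refine degLT_induction
        (P := fun p => approx b (n + 1) (b i) p - MvPolynomial.X i * p ∈ degLT k I m)
        ((degLT k I m).comap (approx b (n + 1) (b i) - LinearMap.mulLeft k (MvPolynomial.X i)))
        (fun p => Iff.rfl) (fun M hM => ?_) hp
      rw [approx_succ b n]
      by_cases h : LeAll i M
      · rw [step_of_leAll b _ h, sub_self]
        exact Submodule.zero_mem _
      · obtain ⟨m', N, hi, hN, rfl⟩ := exists_min h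
        rw [degree_add_single] at hM
        have hN' : mono k N ∈ degLT k I (N.degree + 1) := mono_mem_degLT (by omega)
        rw [step_add_single b _ hN hi, add_assoc, add_sub_cancel_left]
        refine Submodule.add_mem _ ?_ ?_
        · exact degLT_mono (by omega) (mem (b m') (N.degree + 1) _ (by omega)
            (ih2 i _ (N.degree + 1) (by omega) hN'))
        · exact degLT_mono (by omega) (mem _ (N.degree + 1) _ (by omega) hN')

/-- The action of `L` on polynomials in an ordered basis. -/
def act : L →ₗ[k] MvPolynomial I k →ₗ[k] MvPolynomial I k :=
  b.constr k fun i => (MvPolynomial.basisMonomials I k).constr k fun M =>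
    approx b (M.degree + 1) (b i) (mono k M)

theorem act_mono (x : L) (M : I →₀ ℕ) {n : ℕ} (h : M.degree < n) :
    act b x (mono k M) = approx b n x (mono k M) := by
  have h1 : approx b n x (mono k M) = approx b (M.degree + 1) x (mono k M) := by
    induction n, h using Nat.le_induction with
    | base => rfl
    | succ n hn ih => rw [← ih, (approx_agree b n).1 x M hn]
  rw [h1]
  refine basis_induction b (f := (act b).flip (mono k M))
    (f' := (approx b (M.degree + 1)).flip (mono k M)) (fun i => ?_) x
  have e : mono k M = MvPolynomial.basisMonomials I k M := by simp
  rw [LinearMap.flip_apply, act, Module.Basis.constr_basis, e, Module.Basis.constr_basis, ← e]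
  rfl

theorem act_eq_approx (x : L) {n : ℕ} {p : MvPolynomial I k} (hp : p ∈ degLT k I n) :
    act b x p = approx b n x p :=
  degLT_induction (P := fun p => act b x p = approx b n x p)
    (LinearMap.eqLocus (act b x) (approx b n x)) (fun _ => Iff.rfl)
    (fun M hM => act_mono b x M hM) hp

theorem act_sub_mem (i : I) {n : ℕ} {p : MvPolynomial I k} (hp : p ∈ degLT k I n) :
    act b (b i) p - MvPolynomial.X i * p ∈ degLT k I n := by
  rw [act_eq_approx b _ hp]
  exact (approx_agree b n).2 i p n le_rfl hp

theorem act_mem (i : I) {n : ℕ} {p : MvPolynomial I k} (hp : p ∈ degLT k I n) :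
    act b (b i) p ∈ degLT k I (n + 1) := by
  have h := (degLT k I (n + 1)).add_mem (degLT_mono (Nat.le_succ n) (act_sub_mem b i hp))
    (X_mul_mem_degLT i hp)
  rwa [sub_add_cancel] at h

theorem act_of_leAll {i : I} {M : I →₀ ℕ} (h : LeAll i M) :
    act b (b i) (mono k M) = mono k (M + Finsupp.single i 1) := by
  rw [act_mono b _ M (Nat.lt_succ_self _), approx_succ, step_of_leAll b _ h, X_mul_mono]

/-- This is the commutation relation built into `step`, once the iterates have stabilised. It is the
case of the representation property from which all others are deduced. -/
theorem act_act_of_leAll {i m : I} {N : I →₀ ℕ} (hm : LeAll m N) (hi : m < i) :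
    act b (b i) (act b (b m) (mono k N)) =
      act b (b m) (act b (b i) (mono k N)) + act b ⁅b i, b m⁆ (mono k N) := by
  have hN : mono k N ∈ degLT k I (N.degree + 1) := mono_mem_degLT (Nat.lt_succ_self _)
  have h1 := act_of_leAll (k := k) b (hm.add_single hi.le)
  rw [act_of_leAll b hm, act_mono b (b i) (N + Finsupp.single m 1)
    (n := N.degree + 2) (by rw [degree_add_single]; omega), approx_succ,
    step_add_single b _ hm hi, ← act_eq_approx b _ hN, ← act_eq_approx b _ hN,
    ← act_eq_approx b _ (act_sub_mem b i hN), map_sub, X_mul_mono, X_mul_mono, h1,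
    add_right_comm N]
  abel

/-- Induction on the degree, testing on basis elements i > j and a monomial M. If j is at most every
variable of M, the relation holds by construction. Otherwise M = x_m N with m < j < i, both x_i and
x_j are moved past x_m, and the induction hypothesis on N together with the Jacobi identity
finishes. -/
theorem act_lie (n : ℕ) : ∀ p ∈ degLT k I n, ∀ x y : L,
    act b x (act b y p) - act b y (act b x p) = act b ⁅x, y⁆ p := by
  induction n with
  | zero =>
    intro p hp x y
    have h0 : degLT k I 0 = ⊥ := by
      rw [degLT, Submodule.span_eq_bot]
      rintro _ ⟨M, hM, _⟩
      exact absurd hM (Nat.not_lt_zero _)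
    rw [h0, Submodule.mem_bot] at hp
    simp [hp]
  | succ n ih =>
    -- the commutator defect, as a bilinear map
    let def2 (p : MvPolynomial I k) : L →ₗ[k] L →ₗ[k] MvPolynomial I k :=
      LinearMap.mk₂ k (fun x y => act b x (act b y p) - act b y (act b x p) - act b ⁅x, y⁆ p)
        (fun x x' y => by simp only [map_add, LinearMap.add_apply, add_lie]; abel)
        (fun c x y => by simp only [map_smul, LinearMap.smul_apply, smul_lie, smul_sub])
        (fun x y y' => by simp only [map_add, LinearMap.add_apply, lie_add]; abel)
        (fun c x y => by simp only [map_smul, LinearMap.smul_apply, lie_smul, smul_sub])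
    have main : ∀ (M : I →₀ ℕ), M.degree < n + 1 → ∀ i j, def2 (mono k M) (b i) (b j) = 0 := by
      intro M hM
      have anti : ∀ i j, def2 (mono k M) (b i) (b j) = 0 → def2 (mono k M) (b j) (b i) = 0 := by
        intro i j h
        change act b (b j) (act b (b i) (mono k M)) - act b (b i) (act b (b j) (mono k M)) -
          act b ⁅b j, b i⁆ (mono k M) = 0
        change act b (b i) (act b (b j) (mono k M)) - act b (b j) (act b (b i) (mono k M)) -
          act b ⁅b i, b j⁆ (mono k M) = 0 at h
        rw [← lie_skew, map_neg, LinearMap.neg_apply, ← neg_eq_zero, ← h]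
        abel
      have gt : ∀ i j, j < i → def2 (mono k M) (b i) (b j) = 0 := by
        intro i j hij
        change act b (b i) (act b (b j) (mono k M)) - act b (b j) (act b (b i) (mono k M)) -
          act b ⁅b i, b j⁆ (mono k M) = 0
        by_cases h : LeAll j M
        · rw [act_act_of_leAll b h hij]
          abel
        obtain ⟨m, N, hj, hN, rfl⟩ := exists_min h
        rw [degree_add_single] at hM
        have hNn : mono k N ∈ degLT k I n := mono_mem_degLT (by omega)
        -- The vector x_j N is X_j N plus terms of lower degree. On X_j N the relation for (i, m)
        -- holds by construction because m is still least; on the lower terms it is the induction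
        -- hypothesis.
        have key : ∀ i j, m < i → m < j → act b (b i) (act b (b m) (act b (b j) (mono k N))) =
            act b (b m) (act b (b i) (act b (b j) (mono k N))) +
              act b ⁅b i, b m⁆ (act b (b j) (mono k N)) := by
          intro i j hi hj
          have h1 := ih _ (act_sub_mem b j hNn) (b i) (b m)
          have h2 := act_act_of_leAll (k := k) b (hN.add_single hj.le) hi
          rw [← X_mul_mono] at h2
          rw [sub_eq_iff_eq_add] at h1
          have e : act b (b j) (mono k N) = (act b (b j) (mono k N) - MvPolynomial.X j * mono k N) +
            MvPolynomial.X j * mono k N := (sub_add_cancel _ _).symm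
          rw [e]
          simp only [map_add]
          rw [h1, h2]
          abel
        have hi : m < i := hj.trans hij
        have e1 := key i j hi hj
        have e2 := key j i hj hi
        have ihN := ih _ hNn
        have s1 : act b (b i) (act b (b m) (mono k N)) =
            act b (b m) (act b (b i) (mono k N)) + act b ⁅b i, b m⁆ (mono k N) :=
          act_act_of_leAll b hN hi
        have s2 : act b (b j) (act b (b m) (mono k N)) =
            act b (b m) (act b (b j) (mono k N)) + act b ⁅b j, b m⁆ (mono k N) :=
          act_act_of_leAll b hN hj
        have s3 := ihN (b i) ⁅b j, b m⁆
        have s4 := ihN (b j) ⁅b i, b m⁆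
        have s5 := congrArg (act b (b m)) (ihN (b i) (b j))
        have s6 := ihN ⁅b i, b j⁆ (b m)
        -- The Jacobi identity matches the double brackets left over in `s3`, `s4` and `s6`.
        have jac : ⁅⁅b i, b j⁆, b m⁆ = ⁅b i, ⁅b j, b m⁆⁆ - ⁅b j, ⁅b i, b m⁆⁆ := by
          rw [leibniz_lie (b i) (b j) (b m)]
          abel
        rw [jac, map_sub, LinearMap.sub_apply] at s6
        rw [← act_of_leAll b hN, s2, s1, map_add, map_add, e1, e2]
        rw [map_sub] at s5
        rw [sub_eq_iff_eq_add] at s3 s4 s5 s6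
        rw [s3, s4, s5, s6]
        abel
      intro i j
      rcases lt_trichotomy j i with h | rfl | h
      · exact gt i j h
      · change act b (b j) (act b (b j) (mono k M)) - act b (b j) (act b (b j) (mono k M)) -
          act b ⁅b j, b j⁆ (mono k M) = 0
        simp
      · exact anti _ _ (gt j i h)
    intro p hp x y
    refine degLT_induction
      (P := fun p => act b x (act b y p) - act b y (act b x p) = act b ⁅x, y⁆ p)
      (LinearMap.eqLocus (act b x ∘ₗ act b y - act b y ∘ₗ act b x) (act b ⁅x, y⁆))
      (fun _ => Iff.rfl) (fun M hM => ?_) hp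
    have h0 : def2 (mono k M) = 0 := b.ext fun i => b.ext fun j => main M hM i j
    exact sub_eq_zero.1 (DFunLike.congr_fun (DFunLike.congr_fun h0 x) y)

-- The representation of U(L) and the ordered monomials.

attribute [local instance] LieRing.ofAssociativeRing

/-- The representation of `L` on polynomials. -/
def rep : L →ₗ⁅k⁆ Module.End k (MvPolynomial I k) where
  toLinearMap := act b
  map_lie' := fun {x y} => by
    refine LinearMap.ext fun p => ?_
    exact (act_lie b _ p (mem_degLT_totalDegree p) x y).symm

/-- The action of the universal enveloping algebra on polynomials. -/
def repU : U k L →ₐ[k] Module.End k (MvPolynomial I k) := UniversalEnvelopingAlgebra.lift k (rep b)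

theorem repU_ι (x : L) : repU b (UniversalEnvelopingAlgebra.ι k x) = act b x :=
  UniversalEnvelopingAlgebra.lift_ι_apply k (rep b) x

/-- Ordered monomials in the universal enveloping algebra. -/
def ordered : MvPolynomial I k →ₗ[k] U k L :=
  (MvPolynomial.basisMonomials I k).constr k fun M =>
    (((Finsupp.toMultiset M).sort (· ≤ ·)).map fun i => UniversalEnvelopingAlgebra.ι k (b i)).prod

theorem ordered_mono (M : I →₀ ℕ) : ordered b (mono k M) =
    (((Finsupp.toMultiset M).sort (· ≤ ·)).map
      fun i => UniversalEnvelopingAlgebra.ι k (b i)).prod := by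
  have e : mono k M = MvPolynomial.basisMonomials I k M := by simp
  rw [e, ordered, Module.Basis.constr_basis]

theorem ordered_one : ordered b 1 = 1 := by
  rw [← MvPolynomial.C_1]
  refine (ordered_mono (k := k) b 0).trans ?_
  simp

theorem ordered_add_single {m : I} {N : I →₀ ℕ} (h : LeAll m N) :
    ordered b (mono k (N + Finsupp.single m 1)) =
      UniversalEnvelopingAlgebra.ι k (b m) * ordered b (mono k N) := by
  have e : Finsupp.toMultiset (N + Finsupp.single m 1) = m ::ₘ Finsupp.toMultiset N := by
    rw [map_add, Finsupp.toMultiset_single, one_smul, add_comm, Multiset.singleton_add]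
  rw [ordered_mono, ordered_mono, e, Multiset.sort_cons, List.map_cons, List.prod_cons]
  intro j hj
  exact h j (by rwa [Finsupp.mem_toMultiset] at hj)

/-- The polynomial action mimics left multiplication on ordered monomials: both satisfy the same
reordering rule, and they agree when the new variable is least. -/
theorem ι_mul_ordered (n : ℕ) : ∀ p ∈ degLT k I n, ∀ x : L,
    UniversalEnvelopingAlgebra.ι k x * ordered b p = ordered b (act b x p) := by
  induction n with
  | zero =>
    intro p hp x
    have h0 : degLT k I 0 = ⊥ := by
      rw [degLT, Submodule.span_eq_bot]
      rintro _ ⟨M, hM, _⟩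
      exact absurd hM (Nat.not_lt_zero _)
    rw [h0, Submodule.mem_bot] at hp
    simp [hp]
  | succ n ih =>
    have main : ∀ (M : I →₀ ℕ), M.degree < n + 1 → ∀ i,
        UniversalEnvelopingAlgebra.ι k (b i) * ordered b (mono k M) =
          ordered b (act b (b i) (mono k M)) := by
      intro M hM i
      by_cases h : LeAll i M
      · rw [act_of_leAll b h, ordered_add_single b h]
      obtain ⟨m, N, hi, hN, rfl⟩ := exists_min h
      rw [degree_add_single] at hM
      have hNn : mono k N ∈ degLT k I n := mono_mem_degLT (by omega)
      -- The induction hypothesis applies to the difference of x_i N and X_i N, which has low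
      -- degree; on X_i N itself the claim is the product rule for ordered monomials, as m is least.
      have e1 : UniversalEnvelopingAlgebra.ι k (b m) * ordered b (act b (b i) (mono k N)) =
          ordered b (act b (b m) (act b (b i) (mono k N))) := by
        have h1 := ih _ (act_sub_mem b i hNn) (b m)
        rw [map_sub, mul_sub, map_sub, map_sub, X_mul_mono, act_of_leAll b (hN.add_single hi.le),
          ← ordered_add_single b (hN.add_single hi.le)] at h1
        exact sub_left_inj.1 h1
      rw [ordered_add_single b hN, ← act_of_leAll b hN, act_act_of_leAll b hN hi, map_add, ← e1,
        ← ih _ hNn, ← ih _ hNn, LieHom.map_lie, LieRing.of_associative_ring_bracket, sub_mul,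
        mul_assoc, mul_assoc]
      abel
    intro p hp x
    refine degLT_induction
      (P := fun p => UniversalEnvelopingAlgebra.ι k x * ordered b p = ordered b (act b x p))
      (LinearMap.eqLocus (LinearMap.mulLeft k (UniversalEnvelopingAlgebra.ι k x) ∘ₗ ordered b)
        (ordered b ∘ₗ act b x)) (fun _ => Iff.rfl) (fun M hM => ?_) hp
    exact basis_induction b
      (f := (LinearMap.mul k (U k L)).flip (ordered b (mono k M)) ∘ₗ
        (UniversalEnvelopingAlgebra.ι k : L →ₗ⁅k⁆ U k L).toLinearMap)
      (f' := ordered b ∘ₗ (act b).flip (mono k M)) (main M hM) x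

/-- Taken at p = 1 this recovers u from the polynomial u · 1, so that polynomial serves as a symbol
of u. -/
theorem ordered_repU (u : U k L) (p : MvPolynomial I k) :
    ordered b (repU b u p) = u * ordered b p := by
  have h : ∀ u ∈ Algebra.adjoin k (Set.range (UniversalEnvelopingAlgebra.ι k : L → U k L)),
      ∀ p, ordered b (repU b u p) = u * ordered b p := by
    intro u hu
    induction hu using Algebra.adjoin_induction with
    | mem u hu =>
      obtain ⟨x, rfl⟩ := hu
      intro p
      rw [repU_ι, ι_mul_ordered b _ p (mem_degLT_totalDegree p)]
    | algebraMap c =>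
      intro p
      rw [AlgHom.commutes, Module.algebraMap_end_apply, map_smul, Algebra.smul_def]
    | add u v _ _ hu hv => intro p; rw [map_add, LinearMap.add_apply, map_add, hu, hv, add_mul]
    | mul u v _ _ hu hv => intro p; rw [map_mul, Module.End.mul_apply, hu, hv, mul_assoc]
  exact h u (by rw [adjoin_range_ι]; trivial) p

/-- To leading order an ordered monomial acts as multiplication by the corresponding commutative
monomial. The second clause is the degree bound which the induction needs to apply one more
variable. -/
theorem repU_ordered_sub_mem (M : I →₀ ℕ) {n : ℕ} {p : MvPolynomial I k}
    (hp : p ∈ degLT k I (n + 1)) :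
    repU b (ordered b (mono k M)) p - mono k M * p ∈ degLT k I (M.degree + n) ∧
      repU b (ordered b (mono k M)) p ∈ degLT k I (M.degree + n + 1) := by
  obtain ⟨d, hd⟩ : ∃ d, M.degree = d := ⟨_, rfl⟩
  induction d generalizing M with
  | zero =>
    obtain rfl : M = 0 := by rwa [Finsupp.degree_eq_zero_iff] at hd
    have e : ordered b (mono k (0 : I →₀ ℕ)) = 1 := ordered_one b
    have e' : mono k (0 : I →₀ ℕ) = 1 := rfl
    rw [e, e', map_one, one_mul, Module.End.one_apply, sub_self]
    exact ⟨Submodule.zero_mem _, by simpa using hp⟩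
  | succ d ih =>
    have hne : M.support.Nonempty := by
      rw [Finsupp.support_nonempty_iff]
      rintro rfl
      simp at hd
    obtain ⟨m, N, hN, rfl⟩ := exists_min_of_nonempty hne
    rw [degree_add_single] at hd ⊢
    obtain ⟨h1, h2⟩ := ih N (by omega)
    rw [ordered_add_single b hN, map_mul, Module.End.mul_apply, repU_ι]
    refine ⟨?_, ?_⟩
    · have h3 := act_sub_mem b m h2
      have h4 := X_mul_mem_degLT m h1
      have h5 := Submodule.add_mem _ h3 h4
      rw [mul_sub, sub_add_sub_cancel, ← mul_assoc, X_mul_mono] at h5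
      rwa [add_right_comm]
    · rw [add_right_comm N.degree 1 n]
      exact act_mem b m h2

/-- Leading symbols multiply in a domain. With p and q the symbols of u and v, the polynomial pq
agrees with u · q = 1 up to degree less than deg p + deg q. If deg p > 0, the constant 1 is itself
of lower degree, contradicting deg(pq) = deg p + deg q. -/
theorem totalDegree_eq_zero_of_mul_eq_one {u v : U k L} (h : u * v = 1) :
    (repU b u 1).totalDegree = 0 := by
  set p := repU b u 1 with hp
  set q := repU b v 1 with hq
  have hu : ordered b p = u := by rw [hp, ordered_repU, ordered_one, mul_one]
  have h1 : repU b u q = 1 := by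
    rw [hq, ← Module.End.mul_apply, ← map_mul, h, map_one (repU b), Module.End.one_apply]
  have hp0 : p ≠ 0 := by
    rintro h0
    rw [h0, map_zero] at hu
    rw [← hu, map_zero] at h1
    exact zero_ne_one h1
  have hq0 : q ≠ 0 := by
    rintro h0
    rw [h0, map_zero] at h1
    exact zero_ne_one h1
  by_contra hpos
  have hmem : repU b (ordered b p) q - p * q ∈ degLT k I (p.totalDegree + q.totalDegree) := by
    refine degLT_induction
      (P := fun r => repU b (ordered b r) q - r * q ∈ degLT k I (p.totalDegree + q.totalDegree))
      ((degLT k I (p.totalDegree + q.totalDegree)).comap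
        ((LinearMap.applyₗ q ∘ₗ (repU b).toLinearMap ∘ₗ ordered b) - LinearMap.mulRight k q))
      (fun _ => Iff.rfl) (fun M hM => ?_) (mem_degLT_totalDegree p)
    exact degLT_mono (by omega) (repU_ordered_sub_mem b M (mem_degLT_totalDegree q)).1
  have hone : (1 : MvPolynomial I k) ∈ degLT k I (p.totalDegree + q.totalDegree) :=
    mono_mem_degLT (M := 0) (by rw [map_zero]; omega)
  rw [hu, h1] at hmem
  have hpq := Submodule.sub_mem _ hone hmem
  rw [sub_sub_cancel] at hpq
  have hdeg := MvPolynomial.totalDegree_mul_of_isDomain hp0 hq0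
  obtain ⟨M, hM, hM'⟩ := Finset.exists_mem_eq_sup (p * q).support
    (MvPolynomial.support_nonempty.2 (mul_ne_zero hp0 hq0)) fun s => s.sum fun _ e => e
  refine MvPolynomial.mem_support_iff.1 hM (coeff_eq_zero_of_mem_degLT hpq ?_)
  rw [← hdeg]
  exact hM'.le

end Module

end PBW

/-! ### Injectivity of g → U(g), and the units of U(g). -/

section Consequences

variable {k L : Type*} [Field k] [LieRing L] [LieAlgebra k L]

/-- A Lie algebra over a field embeds into its universal enveloping algebra. -/
theorem ι_injective : Function.Injective (UniversalEnvelopingAlgebra.ι k : L → U k L) := by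
  let b := Module.Basis.ofVectorSpace k L
  classical
  let _ : LinearOrder (Module.Basis.ofVectorSpaceIndex k L) := linearOrderOfSTO WellOrderingRel
  intro x y h
  -- Acting on the constant polynomial 1 sends x to the linear form with the coordinates of x, from
  -- which x can be read off.
  have h1 : ∀ x : L, PBW.repU b (UniversalEnvelopingAlgebra.ι k x) 1 =
      b.constr k (fun i => (MvPolynomial.X i : MvPolynomial _ k)) x := by
    intro x
    rw [PBW.repU_ι]
    refine PBW.basis_induction b (f := (PBW.act b).flip 1) (fun i => ?_) x
    rw [Module.Basis.constr_basis]
    refine (PBW.act_of_leAll (M := 0) b (fun j hj => by simp at hj)).trans ?_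
    rw [zero_add]
    rfl
  have h2 : b.constr k (fun i => (MvPolynomial.X i : MvPolynomial _ k)) x =
      b.constr k (fun i => (MvPolynomial.X i : MvPolynomial _ k)) y := by
    rw [← h1, ← h1, h]
  refine b.repr.injective (Finsupp.ext fun i => ?_)
  have h3 : ∀ x : L, MvPolynomial.coeff (Finsupp.single i 1)
      (b.constr k (fun i => (MvPolynomial.X i : MvPolynomial _ k)) x) = b.repr x i := by
    intro x
    refine PBW.basis_induction b
      (f := MvPolynomial.lcoeff k (Finsupp.single i 1) ∘ₗ
        b.constr k (fun i => (MvPolynomial.X i : MvPolynomial _ k)))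
      (f' := Finsupp.lapply i ∘ₗ b.repr.toLinearMap) (fun j => ?_) x
    simp only [LinearMap.comp_apply, Module.Basis.constr_basis, MvPolynomial.lcoeff,
      LinearEquiv.coe_coe, Module.Basis.repr_self, Finsupp.lapply_apply, LinearMap.coe_mk,
      AddHom.coe_mk, Finsupp.single_apply]
    rw [MvPolynomial.coeff_X]
    simp only [Finsupp.single_left_inj (one_ne_zero (α := ℕ))]
  rw [← h3, ← h3, h2]

/-- A one-sided unit of the universal enveloping algebra is a scalar. -/
theorem eq_algebraMap_of_mul_eq_one {u v : U k L} (h : u * v = 1) :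
    ∃ c : k, u = algebraMap k _ c := by
  let b := Module.Basis.ofVectorSpace k L
  classical
  let _ : LinearOrder (Module.Basis.ofVectorSpaceIndex k L) := linearOrderOfSTO WellOrderingRel
  have h0 := PBW.totalDegree_eq_zero_of_mul_eq_one b h
  rw [MvPolynomial.totalDegree_eq_zero_iff_eq_C] at h0
  refine ⟨MvPolynomial.coeff 0 (PBW.repU b u 1), ?_⟩
  have h1 := PBW.ordered_repU b u 1
  rw [PBW.ordered_one, mul_one, h0, ← mul_one (MvPolynomial.C _), ← MvPolynomial.smul_eq_C_mul,
    map_smul, PBW.ordered_one] at h1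
  rw [Algebra.algebraMap_eq_smul_one]
  exact h1.symm

end Consequences

/-! ### The coalgebra structure of the universal enveloping algebra -/

section Coalgebra

variable {k g : Type*} [Field k] [LieRing g] [LieAlgebra k g]

attribute [local instance] LieRing.ofAssociativeRing

local notation "ιU" => (UniversalEnvelopingAlgebra.ι k : g →ₗ⁅k⁆ U k g)

theorem algHom_ext_ι {A : Type*} [Ring A] [Algebra k A] {φ ψ : U k g →ₐ[k] A}
    (h : ∀ x : g, φ (ιU x) = ψ (ιU x)) : φ = ψ := by
  exact UniversalEnvelopingAlgebra.hom_ext k (LieHom.ext h)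

/-- Elements commuting with `g` after an algebra map commute with the image of `U(g)`. -/
theorem commute_of_commute_ι {A : Type*} [Ring A] [Algebra k A] (φ : U k g →ₐ[k] A) {a : A}
    (h : ∀ x : g, Commute a (φ (ιU x))) (u : U k g) : Commute a (φ u) := by
  have hu : u ∈ Algebra.adjoin k (Set.range (ιU : g → U k g)) := by
    rw [adjoin_range_ι]; trivial
  induction hu using Algebra.adjoin_induction with
  | mem u hu => obtain ⟨x, rfl⟩ := hu; exact h x
  | algebraMap c => rw [AlgHom.commutes]; exact (Algebra.commutes c a).symm
  | add u v _ _ hu hv => rw [map_add]; exact hu.add_right hv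
  | mul u v _ _ hu hv => rw [map_mul]; exact hu.mul_right hv

/-- A one-sided unit of `U(g) ⊗ U(g) = U(g × g)` is a scalar. -/
theorem tensor_eq_algebraMap_of_mul_eq_one {w w' : U k g ⊗[k] U k g} (h : w * w' = 1) :
    ∃ c : k, w = algebraMap k _ c := by
  let ι' : g × g →ₗ⁅k⁆ U k (g × g) := UniversalEnvelopingAlgebra.ι k
  let i₁ : U k g →ₐ[k] U k (g × g) :=
    UniversalEnvelopingAlgebra.lift k (ι'.comp (LieHom.inl k g g))
  let i₂ : U k g →ₐ[k] U k (g × g) :=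
    UniversalEnvelopingAlgebra.lift k (ι'.comp (LieHom.inr k g g))
  have h₁ : ∀ x : g, i₁ (ιU x) = ι' (x, 0) := UniversalEnvelopingAlgebra.lift_ι_apply k _
  have h₂ : ∀ x : g, i₂ (ιU x) = ι' (0, x) := UniversalEnvelopingAlgebra.lift_ι_apply k _
  have comm : ∀ u v, Commute (i₁ u) (i₂ v) := by
    intro u v
    refine commute_of_commute_ι i₂ (fun y => ?_) v
    refine (commute_of_commute_ι i₁ (fun x => ?_) u).symm
    rw [h₁, h₂]
    have e : ⁅ι' (0, y), ι' (x, 0)⁆ = 0 := by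
      rw [← LieHom.map_lie, LieAlgebra.Prod.bracket_apply]
      simp only [lie_zero, zero_lie]
      exact map_zero ι'
    rwa [LieRing.of_associative_ring_bracket, sub_eq_zero] at e
  let Φ : U k g ⊗[k] U k g →ₐ[k] U k (g × g) := Algebra.TensorProduct.lift i₁ i₂ comm
  let j : g × g →ₗ⁅k⁆ U k g ⊗[k] U k g :=
    { toFun := fun p => ιU p.1 ⊗ₜ[k] (1 : U k g) + (1 : U k g) ⊗ₜ[k] ιU p.2
      map_add' := fun p q => by
        simp only [Prod.fst_add, Prod.snd_add, map_add, TensorProduct.add_tmul,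
          TensorProduct.tmul_add]
        abel
      map_smul' := fun c p => by
        simp only [Prod.smul_fst, Prod.smul_snd, map_smul, TensorProduct.smul_tmul',
          TensorProduct.tmul_smul, smul_add, RingHom.id_apply]
      map_lie' := fun {p q} => by
        simp only [LieAlgebra.Prod.bracket_apply, LieHom.map_lie,
          LieRing.of_associative_ring_bracket, mul_add, add_mul,
          Algebra.TensorProduct.tmul_mul_tmul, one_mul, mul_one, TensorProduct.sub_tmul,
          TensorProduct.tmul_sub]
        abel }
  let Ψ : U k (g × g) →ₐ[k] U k g ⊗[k] U k g := UniversalEnvelopingAlgebra.lift k j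
  have hΨ : ∀ p, Ψ (ι' p) = ιU p.1 ⊗ₜ[k] (1 : U k g) + (1 : U k g) ⊗ₜ[k] ιU p.2 :=
    UniversalEnvelopingAlgebra.lift_ι_apply k j
  -- A left inverse of Φ is enough: it brings the scalar found in U(g × g) back to U(g) ⊗ U(g).
  have hΨΦ : Ψ.comp Φ = AlgHom.id k _ := by
    refine Algebra.TensorProduct.ext (algHom_ext_ι fun x => ?_) (algHom_ext_ι fun x => ?_)
    · change Ψ (Φ (ιU x ⊗ₜ 1)) = ιU x ⊗ₜ 1
      rw [Algebra.TensorProduct.lift_tmul, map_one, mul_one, h₁, hΨ]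
      simp
    · change Ψ (Φ (1 ⊗ₜ ιU x)) = 1 ⊗ₜ ιU x
      rw [Algebra.TensorProduct.lift_tmul, map_one, one_mul, h₂, hΨ]
      simp
  have hw : Φ w * Φ w' = 1 := by rw [← map_mul, h, map_one]
  obtain ⟨c, hc⟩ := eq_algebraMap_of_mul_eq_one hw
  refine ⟨c, ?_⟩
  have h3 : Ψ (Φ w) = w := DFunLike.congr_fun hΨΦ w
  rw [← h3, hc, AlgHom.commutes]

theorem comul₀_ι (x : g) : comul₀ k g (ιU x) = ιU x ⊗ₜ 1 + 1 ⊗ₜ ιU x :=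
  UniversalEnvelopingAlgebra.lift_ι_apply k _ x

theorem counit₀_ι (x : g) : counit₀ k g (ιU x) = 0 :=
  UniversalEnvelopingAlgebra.lift_ι_apply k _ x

theorem comul₀_pow (x : g) (n : ℕ) : comul₀ k g (ιU x ^ n) =
    ∑ m ∈ Finset.range (n + 1), (n.choose m : k) • ((ιU x ^ m) ⊗ₜ[k] (ιU x ^ (n - m))) := by
  have hc : Commute (ιU x ⊗ₜ[k] (1 : U k g)) ((1 : U k g) ⊗ₜ[k] ιU x) :=
    (Commute.one_right _).tmul (Commute.one_left _)
  rw [map_pow, comul₀_ι, hc.add_pow]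
  refine Finset.sum_congr rfl fun m _ => ?_
  rw [Algebra.TensorProduct.tmul_pow, Algebra.TensorProduct.tmul_pow, one_pow, one_pow,
    Algebra.TensorProduct.tmul_mul_tmul, one_mul, mul_one, ← nsmul_eq_mul', Nat.cast_smul_eq_nsmul]

/-- The coproduct of `U(g)` is cocommutative. -/
theorem comm_comul₀ (u : U k g) : TensorProduct.comm k _ _ (comul₀ k g u) = comul₀ k g u := by
  have h : (Algebra.TensorProduct.comm k (U k g) (U k g)).toAlgHom.comp (comul₀ k g) =
      comul₀ k g := algHom_ext_ι fun x => by
    change Algebra.TensorProduct.comm k (U k g) (U k g) (comul₀ k g (ιU x)) = comul₀ k g (ιU x)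
    rw [comul₀_ι, map_add, Algebra.TensorProduct.comm_tmul, Algebra.TensorProduct.comm_tmul,
      add_comm]
  exact DFunLike.congr_fun h u

variable (k g) in
/-- The doubling map `u ↦ u₁ u₂` of `U(g)`. -/
def dbl : U k g →ₗ[k] U k g := LinearMap.mul' k (U k g) ∘ₗ (comul₀ k g).toLinearMap

theorem dbl_apply (u : U k g) : dbl k g u = LinearMap.mul' k _ (comul₀ k g u) := rfl

/-- The eigenvalue is the sum of the binomial coefficients in Δ(xⁿ). In characteristic zero these
eigenvalues are distinct, so D separates the symmetric powers of g inside U(g). -/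
theorem dbl_pow (x : g) (n : ℕ) : dbl k g (ιU x ^ n) = (2 ^ n : k) • ιU x ^ n := by
  rw [dbl_apply, comul₀_pow, map_sum]
  have h : ∀ m ∈ Finset.range (n + 1), LinearMap.mul' k (U k g)
      ((n.choose m : k) • ((ιU x ^ m) ⊗ₜ[k] (ιU x ^ (n - m)))) = (n.choose m : k) • ιU x ^ n := by
    intro m hm
    rw [map_smul, LinearMap.mul'_apply, ← pow_add,
      Nat.add_sub_cancel' (Nat.lt_succ_iff.1 (Finset.mem_range.1 hm))]
  rw [Finset.sum_congr rfl h, ← Finset.sum_smul, ← Nat.cast_sum, Nat.sum_range_choose]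
  simp

theorem dbl_one : dbl k g 1 = 1 := by
  rw [dbl_apply, map_one, Algebra.TensorProduct.one_def, LinearMap.mul'_apply, one_mul]

/-- The coefficients of `t ↦ (x + t y) ^ n`. -/
def polar {A : Type*} [Ring A] (x y : A) : ℕ → ℕ → A
  | 0, 0 => 1
  | 0, _ + 1 => 0
  | n + 1, 0 => x * polar x y n 0
  | n + 1, i + 1 => x * polar x y n (i + 1) + y * polar x y n i

theorem polar_zero {A : Type*} [Ring A] (x y : A) (n : ℕ) : polar x y n 0 = x ^ n := by
  induction n with
  | zero => simp [polar]
  | succ n ih => rw [polar, ih, pow_succ']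

theorem polar_eq_zero {A : Type*} [Ring A] (x y : A) {n i : ℕ} (h : n < i) :
    polar x y n i = 0 := by
  induction n generalizing i with
  | zero =>
    obtain ⟨j, rfl⟩ : ∃ j, i = j + 1 := ⟨i - 1, by omega⟩
    simp [polar]
  | succ n ih =>
    obtain ⟨j, rfl⟩ : ∃ j, i = j + 1 := ⟨i - 1, by omega⟩
    rw [polar, ih (by omega), ih (by omega), mul_zero, mul_zero, add_zero]

theorem add_smul_pow {A : Type*} [Ring A] [Algebra k A] (x y : A) (t : k) (n : ℕ) :
    (x + t • y) ^ n = ∑ i ∈ Finset.range (n + 1), t ^ i • polar x y n i := by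
  induction n with
  | zero => simp [polar]
  | succ n ih =>
    rw [pow_succ', ih, add_mul, Finset.sum_range_succ' _ (n + 1), Finset.mul_sum, Finset.mul_sum,
      Finset.sum_range_succ']
    simp only [polar, smul_add, Finset.sum_add_distrib, mul_smul_comm, smul_mul_assoc, smul_smul]
    rw [Finset.sum_range_succ (fun i => t ^ (i + 1) • (x * polar x y n (i + 1))),
      polar_eq_zero x y (Nat.lt_succ_self n), mul_zero, smul_zero, add_zero]
    simp only [pow_succ', mul_comm _ t]
    rw [add_right_comm]

theorem polar_one {A : Type*} [Ring A] (x y : A) (n : ℕ) :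
    polar x y n 1 = ∑ i ∈ Finset.range n, x ^ i * y * x ^ (n - 1 - i) := by
  induction n with
  | zero => simp [polar]
  | succ n ih =>
    rw [polar, ih, polar_zero, Finset.sum_range_succ', Finset.mul_sum]
    simp only [pow_zero, one_mul, Nat.add_sub_cancel, Nat.sub_zero]
    congr 1
    refine Finset.sum_congr rfl fun i _ => ?_
    rw [pow_succ', show n - (i + 1) = n - 1 - i by omega]
    simp only [mul_assoc]

variable (k g) in
/-- The span of all powers of elements of `g`. -/
def powerSpan : Submodule k (U k g) := Submodule.span k {u | ∃ (x : g) (n : ℕ), u = ιU x ^ n}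

variable (k g) in
/-- The eigenspace of the doubling map for the eigenvalue `2 ^ n`. -/
def homog (n : ℕ) : Submodule k (U k g) := Module.End.eigenspace (dbl k g) (2 ^ n)

theorem mem_homog {n : ℕ} {u : U k g} : u ∈ homog k g n ↔ dbl k g u = (2 ^ n : k) • u :=
  Module.End.mem_eigenspace_iff

theorem pow_mem_homog (x : g) (n : ℕ) : ιU x ^ n ∈ homog k g n := mem_homog.2 (dbl_pow x n)

theorem counit₀_pow (x : g) (n : ℕ) : counit₀ k g (ιU x ^ n) = if n = 0 then 1 else 0 := by
  rw [map_pow, counit₀_ι, zero_pow_eq]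

/-! ### Spanning of U(g) by powers of elements of g. -/

variable [CharZero k]

/-- All values of t ↦ (x + ty)ⁿ lie in the span. A functional vanishing on the span but not on one
coefficient would give a nonzero polynomial over an infinite field that vanishes everywhere. -/
theorem polar_mem_powerSpan (x y : g) (n i : ℕ) : polar (ιU x) (ιU y) n i ∈ powerSpan k g := by
  by_contra h
  obtain ⟨f, hf, hmap⟩ := Submodule.exists_le_ker_of_notMem h
  have hz : ∀ t : k, f ((ιU x + t • ιU y) ^ n) = 0 := by
    intro t
    rw [← map_smul, ← map_add]
    exact hmap (Submodule.subset_span ⟨_, _, rfl⟩)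
  let p : Polynomial k := ∑ j ∈ Finset.range (n + 1),
    Polynomial.monomial j (f (polar (ιU x) (ιU y) n j))
  have hp : p = 0 := Polynomial.funext fun t => by
    have h1 := hz t
    rw [add_smul_pow, map_sum] at h1
    rw [Polynomial.eval_zero, ← h1, Polynomial.eval_finsetSum]
    refine Finset.sum_congr rfl fun j _ => ?_
    rw [Polynomial.eval_monomial, map_smul, smul_eq_mul, mul_comm]
  have hlt : i < n + 1 := by
    by_contra hlt
    rw [polar_eq_zero _ _ (by omega), map_zero] at hf
    exact hf rfl
  have hc : p.coeff i = f (polar (ιU x) (ιU y) n i) := by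
    simp only [p, Polynomial.finsetSum_coeff, Polynomial.coeff_monomial]
    rw [Finset.sum_ite_eq' (Finset.range (n + 1)) i, if_pos (Finset.mem_range.2 hlt)]
  rw [hp, Polynomial.coeff_zero] at hc
  exact hf hc.symm

/-- Moving y past one x changes the product by a term of the same shape of lower degree with [y, x]
in place of y. Hence all placements of y among the x agree modulo the span. Their sum is a
polarisation coefficient and lies in the span, and their number is invertible. -/
theorem pow_mul_ι_mul_pow_mem (n : ℕ) : ∀ (x y : g) (i j : ℕ), i + j = n →
    ιU x ^ i * ιU y * ιU x ^ j ∈ powerSpan k g := by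
  induction n with
  | zero =>
    intro x y i j h
    obtain ⟨rfl, rfl⟩ : i = 0 ∧ j = 0 := by omega
    rw [pow_zero, one_mul, mul_one, ← pow_one (ιU y)]
    exact Submodule.subset_span ⟨_, _, rfl⟩
  | succ n ih =>
    intro x y
    have hstep : ∀ i j, i + j = n → ιU x ^ i * ιU y * ιU x ^ (j + 1) -
        ιU x ^ (i + 1) * ιU y * ιU x ^ j ∈ powerSpan k g := by
      intro i j hij
      have h := ih x ⁅y, x⁆ i j hij
      rw [LieHom.map_lie, LieRing.of_associative_ring_bracket] at h
      convert h using 1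
      rw [pow_succ' _ j, pow_succ _ i]
      simp only [mul_sub, sub_mul, mul_assoc]
    have hfirst : ∀ i j, i + j = n + 1 →
        ιU y * ιU x ^ (n + 1) - ιU x ^ i * ιU y * ιU x ^ j ∈ powerSpan k g := by
      intro i
      induction i with
      | zero =>
        intro j hj
        obtain rfl : j = n + 1 := by omega
        rw [pow_zero, one_mul, sub_self]
        exact Submodule.zero_mem _
      | succ i ihi =>
        intro j hj
        have h := Submodule.add_mem _ (ihi (j + 1) (by omega)) (hstep i j (by omega))
        rwa [sub_add_sub_cancel] at h
    have hy : ιU y * ιU x ^ (n + 1) ∈ powerSpan k g := by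
      have h1 := polar_mem_powerSpan (k := k) x y (n + 2) 1
      rw [polar_one] at h1
      have h2 : ∑ i ∈ Finset.range (n + 2), (ιU y * ιU x ^ (n + 1) -
          ιU x ^ i * ιU y * ιU x ^ (n + 2 - 1 - i)) ∈ powerSpan k g :=
        Submodule.sum_mem _ fun i hi => hfirst i _ (by rw [Finset.mem_range] at hi; omega)
      have h3 := Submodule.add_mem _ h2 h1
      rw [← Finset.sum_add_distrib] at h3
      simp only [sub_add_cancel, Finset.sum_const, Finset.card_range] at h3
      rw [← Nat.cast_smul_eq_nsmul k] at h3
      exact (Submodule.smul_mem_iff _ (Nat.cast_ne_zero.2 (by omega))).1 h3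
    intro i j hij
    have h := Submodule.sub_mem _ hy (hfirst i j hij)
    rwa [sub_sub_cancel] at h

/-- In characteristic zero, `U(g)` is spanned by the powers of elements of `g`. -/
theorem powerSpan_eq_top : powerSpan k g = ⊤ := by
  have hmul : ∀ (y : g) (v : U k g), v ∈ powerSpan k g → ιU y * v ∈ powerSpan k g := by
    intro y v hv
    have h : powerSpan k g ≤ (powerSpan k g).comap (LinearMap.mulLeft k (ιU y)) := by
      rw [powerSpan, Submodule.span_le]
      rintro _ ⟨x, n, rfl⟩
      have h := pow_mul_ι_mul_pow_mem (k := k) n x y 0 n (zero_add n)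
      rwa [pow_zero, one_mul] at h
    exact h hv
  have h : ∀ u ∈ Algebra.adjoin k (Set.range (ιU : g → U k g)), ∀ v ∈ powerSpan k g,
      u * v ∈ powerSpan k g := by
    intro u hu
    induction hu using Algebra.adjoin_induction with
    | mem u hu => obtain ⟨x, rfl⟩ := hu; exact hmul x
    | algebraMap c => intro v hv; rw [← Algebra.smul_def]; exact Submodule.smul_mem _ _ hv
    | add u u' _ _ hu hu' =>
      intro v hv; rw [add_mul]; exact Submodule.add_mem _ (hu v hv) (hu' v hv)
    | mul u u' _ _ hu hu' => intro v hv; rw [mul_assoc]; exact hu _ (hu' v hv)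
  rw [eq_top_iff]
  intro u _
  have h1 := h u (by rw [adjoin_range_ι]; trivial) 1
    (Submodule.subset_span ⟨0, 0, (pow_zero _).symm⟩)
  rwa [mul_one] at h1

/-- Reduces linear identities on U(g) to powers xⁿ, where coproduct, counit and doubling map are
explicit. -/
theorem ext_powers {V : Type*} [AddCommGroup V] [Module k V] {φ ψ : U k g →ₗ[k] V}
    (h : ∀ (x : g) (n : ℕ), φ (ιU x ^ n) = ψ (ιU x ^ n)) : φ = ψ := by
  refine LinearMap.ext_on (powerSpan_eq_top (k := k) (g := g)) ?_
  rintro _ ⟨x, n, rfl⟩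
  exact h x n

/-- By cocommutativity D is a coalgebra map; on powers, 2ᵐ · 2ⁿ⁻ᵐ = 2ⁿ. -/
theorem comul₀_dbl (u : U k g) :
    comul₀ k g (dbl k g u) = TensorProduct.map (dbl k g) (dbl k g) (comul₀ k g u) := by
  refine DFunLike.congr_fun (ext_powers (φ := (comul₀ k g).toLinearMap ∘ₗ dbl k g)
    (ψ := TensorProduct.map (dbl k g) (dbl k g) ∘ₗ (comul₀ k g).toLinearMap) fun x n => ?_) u
  simp only [LinearMap.comp_apply, AlgHom.toLinearMap_apply]
  rw [dbl_pow, map_smul, comul₀_pow, map_sum, Finset.smul_sum]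
  refine Finset.sum_congr rfl fun m hm => ?_
  rw [map_smul, TensorProduct.map_tmul, dbl_pow, dbl_pow, TensorProduct.smul_tmul_smul, ← pow_add,
    Nat.add_sub_cancel' (Nat.lt_succ_iff.1 (Finset.mem_range.1 hm)), smul_comm]

/-! ### The grading of `U(g)` by the eigenspaces of the doubling map -/

theorem two_pow_injective : Function.Injective fun n : ℕ => (2 ^ n : k) := by
  intro m n h
  have h' : ((2 ^ m : ℕ) : k) = ((2 ^ n : ℕ) : k) := by push_cast; exact h
  exact Nat.pow_right_injective le_rfl (Nat.cast_injective h')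

/-- Eigenspaces for distinct eigenvalues are independent, and the powers xⁿ, which are eigenvectors,
span. -/
theorem homog_isInternal : DirectSum.IsInternal (homog k g) := by
  refine DirectSum.isInternal_submodule_of_iSupIndep_of_iSup_eq_top ?_ ?_
  · exact (Module.End.eigenspaces_iSupIndep (dbl k g)).comp two_pow_injective
  · rw [eq_top_iff, ← powerSpan_eq_top, powerSpan, Submodule.span_le]
    rintro _ ⟨x, n, rfl⟩
    exact Submodule.mem_iSup_of_mem n (pow_mem_homog x n)

variable (g) in
/-- The linear map acting by `c n` on the homogeneous part of degree `n`. -/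
def scal (c : ℕ → k) : U k g →ₗ[k] U k g :=
  DirectSum.toModule k ℕ (U k g) (fun n => c n • (homog k g n).subtype) ∘ₗ
    (LinearEquiv.ofBijective (DirectSum.coeLinearMap (homog k g))
      homog_isInternal).symm.toLinearMap

theorem scal_of_mem (c : ℕ → k) {n : ℕ} {u : U k g} (h : u ∈ homog k g n) :
    scal g c u = c n • u := by
  have e : (LinearEquiv.ofBijective (DirectSum.coeLinearMap (homog k g)) homog_isInternal).symm u =
      DirectSum.lof k ℕ (fun n => homog k g n) n ⟨u, h⟩ := by
    rw [LinearEquiv.symm_apply_eq]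
    exact (DirectSum.coeLinearMap_lof (homog k g) n ⟨u, h⟩).symm
  rw [scal, LinearMap.comp_apply, LinearEquiv.coe_coe, e, DirectSum.toModule_lof]
  rfl

theorem scal_pow (c : ℕ → k) (x : g) (n : ℕ) : scal g c (ιU x ^ n) = c n • ιU x ^ n :=
  scal_of_mem c (pow_mem_homog x n)

/-- An operator commuting with D preserves its eigenspaces. It is used for commutators with elements
of g, to make the cobounding element of an invariant cocycle central. -/
theorem scal_comm_of_comm_dbl (c : ℕ → k) (T : U k g →ₗ[k] U k g)
    (h : ∀ u, T (dbl k g u) = dbl k g (T u)) (u : U k g) : T (scal g c u) = scal g c (T u) := by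
  refine DFunLike.congr_fun (ext_powers (φ := T ∘ₗ scal g c) (ψ := scal g c ∘ₗ T)
    fun x n => ?_) u
  simp only [LinearMap.comp_apply]
  have hT : T (ιU x ^ n) ∈ homog k g n := by
    rw [mem_homog, ← h, dbl_pow, map_smul]
  rw [scal_pow, scal_of_mem c hT, map_smul]

theorem counit₀_scal (c : ℕ → k) (u : U k g) :
    counit₀ k g (scal g c u) = c 0 * counit₀ k g u := by
  refine DFunLike.congr_fun (ext_powers (φ := (counit₀ k g).toLinearMap ∘ₗ scal g c)
    (ψ := c 0 • (counit₀ k g).toLinearMap) fun x n => ?_) u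
  simp only [LinearMap.comp_apply, LinearMap.smul_apply, AlgHom.toLinearMap_apply]
  rw [scal_pow, map_smul, counit₀_pow]
  split_ifs with h
  · rw [h]
  · simp

variable (k g) in
/-- The projection onto the homogeneous part of degree `n`. -/
def pr (n : ℕ) : U k g →ₗ[k] U k g := scal g (Pi.single n 1)

theorem pr_pow (m : ℕ) (x : g) (n : ℕ) : pr k g m (ιU x ^ n) = if n = m then ιU x ^ n else 0 := by
  rw [pr, scal_pow, Pi.single_apply]
  split_ifs <;> simp

theorem pr_dbl (n : ℕ) (u : U k g) : pr k g n (dbl k g u) = (2 ^ n : k) • pr k g n u := by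
  refine DFunLike.congr_fun (ext_powers (φ := pr k g n ∘ₗ dbl k g)
    (ψ := (2 ^ n : k) • pr k g n) fun x m => ?_) u
  simp only [LinearMap.comp_apply, LinearMap.smul_apply]
  rw [dbl_pow, map_smul, pr_pow]
  split_ifs with h
  · rw [h]
  · simp

theorem pr_zero (u : U k g) : pr k g 0 u = counit₀ k g u • 1 := by
  refine DFunLike.congr_fun (ext_powers (φ := pr k g 0)
    (ψ := (counit₀ k g).toLinearMap.smulRight 1) fun x m => ?_) u
  rw [LinearMap.smulRight_apply, AlgHom.toLinearMap_apply, pr_pow, counit₀_pow]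
  split_ifs with h
  · rw [h, pow_zero, one_smul]
  · rw [zero_smul]

theorem pr_of_mem {n : ℕ} {u : U k g} (h : u ∈ homog k g n) : pr k g n u = u := by
  rw [pr, scal_of_mem _ h, Pi.single_eq_same, one_smul]

theorem pr_one_mem_range (u : U k g) :
    pr k g 1 u ∈ LinearMap.range (ιU : g →ₗ[k] U k g) := by
  have h : powerSpan k g ≤ (LinearMap.range (ιU : g →ₗ[k] U k g)).comap (pr k g 1) := by
    rw [powerSpan, Submodule.span_le]
    rintro _ ⟨x, n, rfl⟩
    change pr k g 1 (ιU x ^ n) ∈ LinearMap.range (ιU : g →ₗ[k] U k g)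
    rw [pr_pow]
    split_ifs with hn
    · rw [hn, pow_one]; exact ⟨x, rfl⟩
    · exact Submodule.zero_mem _
  exact h (by rw [powerSpan_eq_top]; trivial)

variable (k g) in
/-- The projection of `U(g)` onto `g`. -/
def toLie : U k g →ₗ[k] g :=
  (LinearEquiv.ofInjective (ιU : g →ₗ[k] U k g) ι_injective).symm.toLinearMap ∘ₗ
    (pr k g 1).codRestrict _ pr_one_mem_range

theorem ι_toLie (u : U k g) : ιU (toLie k g u) = pr k g 1 u := by
  have h := LinearEquiv.apply_symm_apply (LinearEquiv.ofInjective (ιU : g →ₗ[k] U k g) ι_injective)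
    ((pr k g 1).codRestrict _ pr_one_mem_range u)
  exact congrArg Subtype.val h

theorem toLie_ι (x : g) : toLie k g (ιU x) = x := by
  refine ι_injective (k := k) ?_
  rw [ι_toLie]
  refine pr_of_mem ?_
  have h := pow_mem_homog (k := k) x 1
  rwa [pow_one] at h

/-- Primitive elements of `U(g)` belong to `g`. -/
theorem ι_toLie_of_primitive {u : U k g} (h : comul₀ k g u = u ⊗ₜ 1 + 1 ⊗ₜ u) :
    ιU (toLie k g u) = u := by
  rw [ι_toLie]
  refine pr_of_mem (mem_homog.2 ?_)
  rw [dbl_apply, h, map_add, LinearMap.mul'_apply, LinearMap.mul'_apply, mul_one, one_mul, pow_one,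
    two_smul]

theorem exists_sum_pr (u : U k g) : ∃ N, ∀ M ≥ N, ∑ i ∈ Finset.range M, pr k g i u = u := by
  have hu : u ∈ powerSpan k g := by rw [powerSpan_eq_top]; trivial
  rw [powerSpan] at hu
  induction hu using Submodule.span_induction with
  | mem u hu =>
    obtain ⟨x, n, rfl⟩ := hu
    refine ⟨n + 1, fun M hM => ?_⟩
    simp only [pr_pow]
    rw [Finset.sum_ite_eq (Finset.range M) n, if_pos (Finset.mem_range.2 hM)]
  | zero => exact ⟨0, fun M _ => by simp⟩
  | add u v _ _ hu hv =>
    obtain ⟨N, hN⟩ := hu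
    obtain ⟨N', hN'⟩ := hv
    refine ⟨max N N', fun M hM => ?_⟩
    simp only [map_add, Finset.sum_add_distrib]
    rw [hN M (le_trans (le_max_left _ _) hM), hN' M (le_trans (le_max_right _ _) hM)]
  | smul c u _ hu =>
    obtain ⟨N, hN⟩ := hu
    refine ⟨N, fun M hM => ?_⟩
    simp only [map_smul, ← Finset.smul_sum]
    rw [hN M hM]

/-- Every tensor involves only finitely many degrees, so it is the sum of its bihomogeneous
components. -/
theorem eq_zero_of_map_pr {W : U k g ⊗[k] U k g}
    (h : ∀ i j, TensorProduct.map (pr k g i) (pr k g j) W = 0) : W = 0 := by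
  have hN : ∀ W : U k g ⊗[k] U k g, ∃ N, ∀ M ≥ N, TensorProduct.map
      (∑ i ∈ Finset.range M, pr k g i) (∑ j ∈ Finset.range M, pr k g j) W = W := by
    intro W
    induction W with
    | zero => exact ⟨0, fun M _ => map_zero _⟩
    | tmul u v =>
      obtain ⟨N, hN⟩ := exists_sum_pr u
      obtain ⟨N', hN'⟩ := exists_sum_pr v
      refine ⟨max N N', fun M hM => ?_⟩
      rw [TensorProduct.map_tmul, LinearMap.sum_apply, LinearMap.sum_apply,
        hN M (le_trans (le_max_left _ _) hM), hN' M (le_trans (le_max_right _ _) hM)]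
    | add u v hu hv =>
      obtain ⟨N, hN⟩ := hu
      obtain ⟨N', hN'⟩ := hv
      refine ⟨max N N', fun M hM => ?_⟩
      rw [map_add, hN M (le_trans (le_max_left _ _) hM), hN' M (le_trans (le_max_right _ _) hM)]
  obtain ⟨N, hN⟩ := hN W
  have e : TensorProduct.map (∑ i ∈ Finset.range N, pr k g i) (∑ j ∈ Finset.range N, pr k g j) =
      ∑ i ∈ Finset.range N, ∑ j ∈ Finset.range N,
        TensorProduct.map (pr k g i) (pr k g j) := by
    refine TensorProduct.ext' fun u v => ?_
    simp only [TensorProduct.map_tmul, LinearMap.sum_apply, TensorProduct.sum_tmul,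
      TensorProduct.tmul_sum]
    exact Finset.sum_comm
  rw [← hN N le_rfl, e]
  simp only [LinearMap.sum_apply, h, Finset.sum_const_zero]

end Coalgebra

/-! ### Two-cocycles of the coalgebra `U(g)` -/

section Cocycle

variable {k g : Type*} [Field k] [LieRing g] [LieAlgebra k g]

attribute [local instance] LieRing.ofAssociativeRing

local notation "ιU" => (UniversalEnvelopingAlgebra.ι k : g →ₗ⁅k⁆ U k g)

local notation "μU" => LinearMap.mul' k (U k g)

local notation "τU" => TensorProduct.comm k (U k g) (U k g)

variable (k g) in
/-- `F ↦ F ⊗ 1`. -/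
def tmulOne₀ : U k g ⊗[k] U k g →ₐ[k] U k g ⊗[k] (U k g ⊗[k] U k g) :=
  (Algebra.TensorProduct.assoc k k k (U k g) (U k g) (U k g)).toAlgHom.comp
    Algebra.TensorProduct.includeLeft

variable (k g) in
/-- `F ↦ 1 ⊗ F`. -/
def oneTmul₀ : U k g ⊗[k] U k g →ₐ[k] U k g ⊗[k] (U k g ⊗[k] U k g) :=
  Algebra.TensorProduct.includeRight

variable (k g) in
/-- `Δ ⊗ I`. -/
def comulLeft₀ : U k g ⊗[k] U k g →ₐ[k] U k g ⊗[k] (U k g ⊗[k] U k g) :=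
  (Algebra.TensorProduct.assoc k k k (U k g) (U k g) (U k g)).toAlgHom.comp
    (Algebra.TensorProduct.map (comul₀ k g) (AlgHom.id k _))

variable (k g) in
/-- `I ⊗ Δ`. -/
def comulRight₀ : U k g ⊗[k] U k g →ₐ[k] U k g ⊗[k] (U k g ⊗[k] U k g) :=
  Algebra.TensorProduct.map (AlgHom.id k _) (comul₀ k g)

variable (k g) in
/-- `ε ⊗ I`. -/
def counitLeft₀ : U k g ⊗[k] U k g →ₐ[k] U k g :=
  (Algebra.TensorProduct.lid k (U k g)).toAlgHom.comp
    (Algebra.TensorProduct.map (counit₀ k g) (AlgHom.id k _))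

variable (k g) in
/-- `I ⊗ ε`. -/
def counitRight₀ : U k g ⊗[k] U k g →ₐ[k] U k g :=
  (Algebra.TensorProduct.rid k k (U k g)).toAlgHom.comp
    (Algebra.TensorProduct.map (AlgHom.id k _) (counit₀ k g))

/-- The linearised 2-cocycle condition. -/
def IsCocycle (F : U k g ⊗[k] U k g) : Prop :=
  tmulOne₀ k g F + comulLeft₀ k g F = oneTmul₀ k g F + comulRight₀ k g F

/-- The coboundary `a ↦ Δ(a) - a ⊗ 1 - 1 ⊗ a`. -/
def cobound (a : U k g) : U k g ⊗[k] U k g := comul₀ k g a - a ⊗ₜ 1 - 1 ⊗ₜ a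

theorem tmulOne₀_tmul (a b : U k g) : tmulOne₀ k g (a ⊗ₜ b) = a ⊗ₜ (b ⊗ₜ 1) := rfl

theorem oneTmul₀_apply (F : U k g ⊗[k] U k g) : oneTmul₀ k g F = 1 ⊗ₜ F := rfl

theorem comulLeft₀_tmul (a b : U k g) : comulLeft₀ k g (a ⊗ₜ b) =
    TensorProduct.assoc k _ _ _ (comul₀ k g a ⊗ₜ b) := rfl

theorem comulRight₀_tmul (a b : U k g) : comulRight₀ k g (a ⊗ₜ b) = a ⊗ₜ comul₀ k g b := rfl

theorem counitLeft₀_tmul (a b : U k g) : counitLeft₀ k g (a ⊗ₜ b) = counit₀ k g a • b := rfl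

theorem counitRight₀_tmul (a b : U k g) : counitRight₀ k g (a ⊗ₜ b) = counit₀ k g b • a := rfl

/-- A linear map on the tensor cube, evaluated on the cocycle condition, in terms of its values on
the four kinds of elements occurring there. -/
theorem IsCocycle.apply {F : U k g ⊗[k] U k g} (hF : IsCocycle F) {V : Type*} [AddCommGroup V]
    [Module k V] (s : U k g ⊗[k] (U k g ⊗[k] U k g) →ₗ[k] V)
    (s₁ s₂ s₃ s₄ : U k g ⊗[k] U k g →ₗ[k] V)
    (h₁ : ∀ a b, s (a ⊗ₜ (b ⊗ₜ 1)) = s₁ (a ⊗ₜ b))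
    (h₂ : ∀ a b, s (TensorProduct.assoc k _ _ _ (comul₀ k g a ⊗ₜ b)) = s₂ (a ⊗ₜ b))
    (h₃ : ∀ a b, s (1 ⊗ₜ (a ⊗ₜ b)) = s₃ (a ⊗ₜ b))
    (h₄ : ∀ a b, s (a ⊗ₜ comul₀ k g b) = s₄ (a ⊗ₜ b)) :
    s₁ F + s₂ F = s₃ F + s₄ F := by
  have e₁ : s ∘ₗ (tmulOne₀ k g).toLinearMap = s₁ := TensorProduct.ext' h₁
  have e₂ : s ∘ₗ (comulLeft₀ k g).toLinearMap = s₂ := TensorProduct.ext' h₂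
  have e₃ : s ∘ₗ (oneTmul₀ k g).toLinearMap = s₃ := TensorProduct.ext' h₃
  have e₄ : s ∘ₗ (comulRight₀ k g).toLinearMap = s₄ := TensorProduct.ext' h₄
  have h := congrArg s hF
  rw [map_add, map_add] at h
  rw [← e₁, ← e₂, ← e₃, ← e₄]
  exact h

variable (k g) in
/-- `a ⊗ b ↦ Δ(a) (b ⊗ 1)`. -/
def comulMulLeft : U k g ⊗[k] U k g →ₗ[k] U k g ⊗[k] U k g :=
  LinearMap.mul' k _ ∘ₗ TensorProduct.map (comul₀ k g).toLinearMap
    (Algebra.TensorProduct.includeLeft : U k g →ₐ[k] U k g ⊗[k] U k g).toLinearMap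

variable (k g) in
/-- `a ⊗ b ↦ (a ⊗ 1) Δ(b)`. -/
def leftMulComul : U k g ⊗[k] U k g →ₗ[k] U k g ⊗[k] U k g :=
  LinearMap.mul' k _ ∘ₗ TensorProduct.map
    (Algebra.TensorProduct.includeLeft : U k g →ₐ[k] U k g ⊗[k] U k g).toLinearMap
    (comul₀ k g).toLinearMap

variable (k g) in
/-- `a ⊗ b ↦ Δ(a) (1 ⊗ b)`. -/
def comulMulRight : U k g ⊗[k] U k g →ₗ[k] U k g ⊗[k] U k g :=
  LinearMap.mul' k _ ∘ₗ TensorProduct.map (comul₀ k g).toLinearMap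
    (Algebra.TensorProduct.includeRight : U k g →ₐ[k] U k g ⊗[k] U k g).toLinearMap

variable (k g) in
/-- `a ⊗ b ↦ (1 ⊗ a) Δ(b)`. -/
def rightMulComul : U k g ⊗[k] U k g →ₗ[k] U k g ⊗[k] U k g :=
  LinearMap.mul' k _ ∘ₗ TensorProduct.map
    (Algebra.TensorProduct.includeRight : U k g →ₐ[k] U k g ⊗[k] U k g).toLinearMap
    (comul₀ k g).toLinearMap

variable (k g) in
/-- `a ⊗ b ↦ (a ⊗ 1) (I ⊗ D) Δ(b)`, where `D` is the doubling map. -/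
def leftMulDbl : U k g ⊗[k] U k g →ₗ[k] U k g ⊗[k] U k g :=
  LinearMap.mul' k _ ∘ₗ TensorProduct.map
    (Algebra.TensorProduct.includeLeft : U k g →ₐ[k] U k g ⊗[k] U k g).toLinearMap
    (TensorProduct.map LinearMap.id (dbl k g) ∘ₗ (comul₀ k g).toLinearMap)

theorem comulMulLeft_tmul (a b : U k g) :
    comulMulLeft k g (a ⊗ₜ b) = comul₀ k g a * (b ⊗ₜ 1) := rfl

theorem comulMulRight_tmul (a b : U k g) :
    comulMulRight k g (a ⊗ₜ b) = comul₀ k g a * (1 ⊗ₜ b) := rfl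

theorem rightMulComul_tmul (a b : U k g) :
    rightMulComul k g (a ⊗ₜ b) = (1 ⊗ₜ a) * comul₀ k g b := rfl

theorem leftMulDbl_tmul (a b : U k g) : leftMulDbl k g (a ⊗ₜ b) =
    (a ⊗ₜ 1) * TensorProduct.map LinearMap.id (dbl k g) (comul₀ k g b) := rfl

variable (k g) in
/-- `a ⊗ b ⊗ c ↦ a b ⊗ c`. -/
def merge₁₂ : U k g ⊗[k] (U k g ⊗[k] U k g) →ₗ[k] U k g ⊗[k] U k g :=
  TensorProduct.map μU LinearMap.id ∘ₗ (TensorProduct.assoc k _ _ _).symm.toLinearMap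

variable (k g) in
/-- `a ⊗ b ⊗ c ↦ a c ⊗ b`. -/
def merge₁₃ : U k g ⊗[k] (U k g ⊗[k] U k g) →ₗ[k] U k g ⊗[k] U k g :=
  merge₁₂ k g ∘ₗ TensorProduct.map LinearMap.id (τU).toLinearMap

theorem merge₁₂_tmul (a b c : U k g) : merge₁₂ k g (a ⊗ₜ (b ⊗ₜ c)) = (a * b) ⊗ₜ c := rfl

theorem merge₁₃_tmul (a b c : U k g) : merge₁₃ k g (a ⊗ₜ (b ⊗ₜ c)) = (a * c) ⊗ₜ b := rfl

theorem merge₁₂_assoc (t : U k g ⊗[k] U k g) (b : U k g) :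
    merge₁₂ k g (TensorProduct.assoc k _ _ _ (t ⊗ₜ b)) = μU t ⊗ₜ b := by
  rw [merge₁₂, LinearMap.comp_apply, LinearEquiv.coe_coe, LinearEquiv.symm_apply_apply,
    TensorProduct.map_tmul, LinearMap.id_apply]

theorem merge₁₂_right (a : U k g) (t : U k g ⊗[k] U k g) :
    merge₁₂ k g (a ⊗ₜ t) = (a ⊗ₜ 1) * t := by
  induction t with
  | zero => simp
  | tmul b c => rw [merge₁₂_tmul, Algebra.TensorProduct.tmul_mul_tmul, one_mul]
  | add s t hs ht => rw [TensorProduct.tmul_add, map_add, hs, ht, mul_add]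

theorem merge₁₃_assoc (t : U k g ⊗[k] U k g) (b : U k g) :
    merge₁₃ k g (TensorProduct.assoc k _ _ _ (t ⊗ₜ b)) = t * (b ⊗ₜ 1) := by
  induction t with
  | zero => simp
  | tmul a c =>
    rw [TensorProduct.assoc_tmul, merge₁₃_tmul, Algebra.TensorProduct.tmul_mul_tmul, mul_one]
  | add s t hs ht => rw [TensorProduct.add_tmul, map_add, map_add, hs, ht, add_mul]

theorem merge₁₃_right (a : U k g) (t : U k g ⊗[k] U k g) :
    merge₁₃ k g (a ⊗ₜ t) = (a ⊗ₜ 1) * τU t := by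
  rw [merge₁₃, LinearMap.comp_apply, TensorProduct.map_tmul, merge₁₂_right]
  rfl

theorem comm_mul (s t : U k g ⊗[k] U k g) : τU (s * t) = τU s * τU t :=
  map_mul (Algebra.TensorProduct.comm k (U k g) (U k g)) s t

theorem comm_comm (t : U k g ⊗[k] U k g) : τU (τU t) = t := by
  induction t with
  | zero => simp
  | tmul a b => rfl
  | add s t hs ht => rw [map_add, map_add, hs, ht]

/-! ### Contractions of the cocycle identity along multiplications. -/

section Identities

variable {F : U k g ⊗[k] U k g}

/-- Obtained by contracting with a ⊗ b ⊗ c ↦ ab ⊗ c. The variants below use bc ⊗ a and ac ⊗ b;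
cocommutativity brings them to comparable form. -/
theorem IsCocycle.dbl_left (hF : IsCocycle F) :
    μU F ⊗ₜ 1 + TensorProduct.map (dbl k g) LinearMap.id F = F + leftMulComul k g F :=
  hF.apply (merge₁₂ k g) ((TensorProduct.mk k _ _).flip 1 ∘ₗ μU)
    (TensorProduct.map (dbl k g) LinearMap.id) LinearMap.id (leftMulComul k g)
    (fun a b => rfl) (fun a b => merge₁₂_assoc _ _)
    (fun a b => by rw [merge₁₂_tmul, one_mul]; rfl) (fun a b => merge₁₂_right _ _)

theorem IsCocycle.dbl_left_comm (hF : IsCocycle F) :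
    τU F + comulMulLeft k g F =
      μU F ⊗ₜ 1 + TensorProduct.map (dbl k g) LinearMap.id (τU F) := by
  refine hF.apply ((τU).toLinearMap ∘ₗ TensorProduct.map LinearMap.id μU) (τU).toLinearMap
    (comulMulLeft k g) ((TensorProduct.mk k _ _).flip 1 ∘ₗ μU)
    (TensorProduct.map (dbl k g) LinearMap.id ∘ₗ (τU).toLinearMap)
    (fun a b => ?_) (fun a b => ?_) (fun a b => rfl) (fun a b => rfl)
  · change (b * 1) ⊗ₜ a = b ⊗ₜ a
    rw [mul_one]
  · rw [comulMulLeft_tmul, ← comm_comul₀ a, comm_comul₀ a]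
    conv_rhs => rw [← comm_comul₀ a]
    induction comul₀ k g a with
    | zero => simp
    | tmul c d =>
      change (d * b) ⊗ₜ c = (d ⊗ₜ c) * (b ⊗ₜ 1)
      rw [Algebra.TensorProduct.tmul_mul_tmul, mul_one]
    | add s t hs ht => rw [TensorProduct.add_tmul, map_add, map_add, hs, ht, map_add, add_mul]

theorem IsCocycle.comm_left (hF : IsCocycle F) :
    F + comulMulLeft k g F = τU F + leftMulComul k g F :=
  hF.apply (merge₁₃ k g) LinearMap.id (comulMulLeft k g) (τU).toLinearMap (leftMulComul k g)
    (fun a b => by rw [merge₁₃_tmul, mul_one]; rfl) (fun a b => merge₁₃_assoc _ _)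
    (fun a b => by rw [merge₁₃_tmul, one_mul]; rfl)
    (fun a b => by rw [merge₁₃_right, comm_comul₀]; rfl)

/-- The skew-symmetric part of a cocycle is primitive in its first leg. -/
theorem IsCocycle.dbl_left_skew (hF : IsCocycle F) :
    TensorProduct.map (dbl k g) LinearMap.id (F - τU F) = (2 : k) • (F - τU F) := by
  have h1 := hF.dbl_left
  have h2 := hF.dbl_left_comm
  have h3 := hF.comm_left
  rw [map_sub, eq_sub_of_add_eq' h1, eq_sub_of_add_eq' h2.symm, two_smul]
  -- After subtracting the two doubling identities, only the difference of `leftMulComul` and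
  -- `comulMulLeft` is left, and `comm_left` evaluates it to F - τF.
  have h4 : leftMulComul k g F = F + comulMulLeft k g F - τU F := eq_sub_of_add_eq' h3.symm
  rw [h4]
  abel

/-- The contraction ab ⊗ c followed by doubling the second leg. -/
theorem IsCocycle.dbl_dbl (hF : IsCocycle F) :
    μU F ⊗ₜ 1 + TensorProduct.map (dbl k g) (dbl k g) F =
      TensorProduct.map LinearMap.id (dbl k g) F + leftMulDbl k g F := by
  refine hF.apply (TensorProduct.map LinearMap.id (dbl k g) ∘ₗ merge₁₂ k g)
    ((TensorProduct.mk k _ _).flip 1 ∘ₗ μU) (TensorProduct.map (dbl k g) (dbl k g))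
    (TensorProduct.map LinearMap.id (dbl k g)) (leftMulDbl k g)
    (fun a b => ?_) (fun a b => ?_) (fun a b => ?_) (fun a b => ?_)
  · rw [LinearMap.comp_apply, merge₁₂_tmul, TensorProduct.map_tmul, dbl_one]
    rfl
  · rw [LinearMap.comp_apply, merge₁₂_assoc, TensorProduct.map_tmul]
    rfl
  · rw [LinearMap.comp_apply, merge₁₂_tmul, one_mul]
  · rw [LinearMap.comp_apply, merge₁₂_right, leftMulDbl_tmul]
    induction comul₀ k g b with
    | zero => simp
    | tmul c d =>
      simp only [Algebra.TensorProduct.tmul_mul_tmul, TensorProduct.map_tmul, one_mul,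
        LinearMap.id_apply]
    | add s t hs ht => simp only [mul_add, map_add, hs, ht]

/-- The contraction a ⊗ b ⊗ c ↦ a ⊗ bc. -/
theorem IsCocycle.dbl_right (hF : IsCocycle F) :
    F + comulMulRight k g F = 1 ⊗ₜ μU F + TensorProduct.map LinearMap.id (dbl k g) F := by
  refine hF.apply (TensorProduct.map LinearMap.id μU) LinearMap.id (comulMulRight k g)
    (TensorProduct.mk k _ _ 1 ∘ₗ μU) (TensorProduct.map LinearMap.id (dbl k g))
    (fun a b => ?_) (fun a b => ?_) (fun a b => rfl) (fun a b => rfl)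
  · change a ⊗ₜ (b * 1) = a ⊗ₜ b
    rw [mul_one]
  · rw [comulMulRight_tmul]
    induction comul₀ k g a with
    | zero => simp
    | tmul c d =>
      change c ⊗ₜ (d * b) = (c ⊗ₜ d) * (1 ⊗ₜ b)
      rw [Algebra.TensorProduct.tmul_mul_tmul, mul_one]
    | add s t hs ht => rw [TensorProduct.add_tmul, map_add, map_add, hs, ht, add_mul]

/-- The contraction a ⊗ b ⊗ c ↦ b ⊗ ac. -/
theorem IsCocycle.comm_right (hF : IsCocycle F) :
    τU F + comulMulRight k g F = F + rightMulComul k g F := by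
  refine hF.apply ((τU).toLinearMap ∘ₗ merge₁₃ k g) (τU).toLinearMap (comulMulRight k g)
    LinearMap.id (rightMulComul k g)
    (fun a b => ?_) (fun a b => ?_) (fun a b => ?_) (fun a b => ?_)
  · rw [LinearMap.comp_apply, merge₁₃_tmul, mul_one]
  · rw [LinearMap.comp_apply, merge₁₃_assoc, LinearEquiv.coe_coe, comm_mul, comm_comul₀]
    rfl
  · rw [LinearMap.comp_apply, merge₁₃_tmul, one_mul]
    rfl
  · rw [LinearMap.comp_apply, merge₁₃_right, LinearEquiv.coe_coe, comm_mul, comm_comm]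
    rfl

variable [CharZero k]

/-- In Sweedler notation, b₂ ⊗ b₁b₃ = b₁ ⊗ b₂b₃ by cocommutativity. On a power xⁿ both sides are
binomial expansions of (x ⊗ 1 + 2 · 1 ⊗ x)ⁿ. -/
theorem rightMulComul_comul₀ (b : U k g) : rightMulComul k g (comul₀ k g b) =
    TensorProduct.map LinearMap.id (dbl k g) (comul₀ k g b) := by
  refine DFunLike.congr_fun (ext_powers (φ := rightMulComul k g ∘ₗ (comul₀ k g).toLinearMap)
    (ψ := TensorProduct.map LinearMap.id (dbl k g) ∘ₗ (comul₀ k g).toLinearMap)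
    fun x n => ?_) b
  simp only [LinearMap.comp_apply, AlgHom.toLinearMap_apply]
  rw [comul₀_pow, map_sum, map_sum]
  let A : U k g ⊗[k] U k g := ιU x ⊗ₜ 1
  let B : U k g ⊗[k] U k g := 1 ⊗ₜ ιU x
  have hc : Commute A B := (Commute.one_right _).tmul (Commute.one_left _)
  have h1 : ∀ m ∈ Finset.range (n + 1), rightMulComul k g
      ((n.choose m : k) • ((ιU x ^ m) ⊗ₜ[k] (ιU x ^ (n - m)))) =
      B ^ m * (A + B) ^ (n - m) * (n.choose m : ℕ) := by
    intro m _
    rw [map_smul, rightMulComul_tmul, map_pow, comul₀_ι, Nat.cast_smul_eq_nsmul, nsmul_eq_mul',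
      Algebra.TensorProduct.tmul_pow, one_pow]
  have h2 : ∀ m ∈ Finset.range (n + 1), TensorProduct.map LinearMap.id (dbl k g)
      ((n.choose m : k) • ((ιU x ^ m) ⊗ₜ[k] (ιU x ^ (n - m)))) =
      A ^ m * (B + B) ^ (n - m) * (n.choose m : ℕ) := by
    intro m _
    rw [map_smul, TensorProduct.map_tmul, dbl_pow, LinearMap.id_apply, Nat.cast_smul_eq_nsmul,
      nsmul_eq_mul', ← two_smul k B, smul_pow, Algebra.TensorProduct.tmul_pow,
      Algebra.TensorProduct.tmul_pow, one_pow, one_pow, TensorProduct.tmul_smul, mul_smul_comm,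
      Algebra.TensorProduct.tmul_mul_tmul, one_mul, mul_one]
  rw [Finset.sum_congr rfl h1, Finset.sum_congr rfl h2,
    ← (hc.symm.add_right (Commute.refl B)).add_pow, ← (hc.add_right hc).add_pow]
  congr 1
  abel

/-- The contraction a ⊗ b ⊗ c ↦ (a ⊗ b)Δ(c), which is what brings Δ(μF), and hence a coboundary,
into play. -/
theorem IsCocycle.comul_mul (hF : IsCocycle F) :
    F + comul₀ k g (μU F) = rightMulComul k g F + leftMulDbl k g F := by
  refine hF.apply (LinearMap.mul' k _ ∘ₗ TensorProduct.map LinearMap.id (comul₀ k g).toLinearMap ∘ₗ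
      (TensorProduct.assoc k (U k g) (U k g) (U k g)).symm.toLinearMap) LinearMap.id
    ((comul₀ k g).toLinearMap ∘ₗ μU) (rightMulComul k g) (leftMulDbl k g)
    (fun a b => ?_) (fun a b => ?_) (fun a b => rfl) (fun a b => ?_)
  · change (a ⊗ₜ b) * comul₀ k g 1 = a ⊗ₜ b
    rw [map_one, mul_one]
  · simp only [LinearMap.comp_apply, LinearEquiv.coe_coe, LinearEquiv.symm_apply_apply,
      TensorProduct.map_tmul, LinearMap.mul'_apply, LinearMap.id_apply, AlgHom.toLinearMap_apply,
      map_mul]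
  · rw [leftMulDbl_tmul, ← rightMulComul_comul₀]
    induction comul₀ k g b with
    | zero => simp
    | tmul c d =>
      change (a ⊗ₜ c) * comul₀ k g d = (a ⊗ₜ 1) * ((1 ⊗ₜ c) * comul₀ k g d)
      rw [← mul_assoc, Algebra.TensorProduct.tmul_mul_tmul, mul_one, one_mul]
    | add s t hs ht => rw [TensorProduct.tmul_add, map_add, hs, ht, map_add, mul_add]

/-- Eliminating the mixed terms from four contractions leaves an eigenvalue equation with eigenvalue
2, up to the skew part of F and a coboundary. -/
theorem IsCocycle.dbl_eq (hF : IsCocycle F) : TensorProduct.map (dbl k g) (dbl k g) F =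
    (2 : k) • F + cobound (μU F) + (F - τU F) := by
  have h1 := eq_sub_of_add_eq' hF.dbl_dbl
  have h2 := eq_sub_of_add_eq' hF.dbl_right.symm
  have h3 := eq_sub_of_add_eq' hF.comul_mul.symm
  have h4 : comulMulRight k g F = F + rightMulComul k g F - τU F := by
    rw [← hF.comm_right]; abel
  rw [h1, h2, h3, h4, cobound, two_smul]
  abel

end Identities

end Cocycle

/-! ### Decomposition of two-cocycles -/

section Decomposition

variable {k g : Type*} [Field k] [LieRing g] [LieAlgebra k g]

attribute [local instance] LieRing.ofAssociativeRing

local notation "ιU" => (UniversalEnvelopingAlgebra.ι k : g →ₗ⁅k⁆ U k g)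

local notation "μU" => LinearMap.mul' k (U k g)

local notation "τU" => TensorProduct.comm k (U k g) (U k g)

theorem counitLeft₀_comm (F : U k g ⊗[k] U k g) : counitLeft₀ k g (τU F) = counitRight₀ k g F := by
  induction F with
  | zero => simp
  | tmul a b => rfl
  | add s t hs ht => rw [map_add, map_add, hs, ht, map_add]

theorem counitRight₀_comm (F : U k g ⊗[k] U k g) :
    counitRight₀ k g (τU F) = counitLeft₀ k g F := by
  rw [← counitLeft₀_comm, comm_comm]

theorem counitLeft₀_comul₀ (u : U k g) : counitLeft₀ k g (comul₀ k g u) = u := by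
  have h : (counitLeft₀ k g).comp (comul₀ k g) = AlgHom.id k _ := algHom_ext_ι fun x => by
    rw [AlgHom.comp_apply, comul₀_ι, map_add, counitLeft₀_tmul, counitLeft₀_tmul, counit₀_ι,
      map_one, zero_smul, one_smul, zero_add, AlgHom.id_apply]
  exact DFunLike.congr_fun h u

theorem counitLeft₀_cobound {a : U k g} (h : counit₀ k g a = 0) :
    counitLeft₀ k g (cobound a) = 0 := by
  rw [cobound, map_sub, map_sub, counitLeft₀_comul₀, counitLeft₀_tmul, counitLeft₀_tmul, h,
    map_one, zero_smul, one_smul, sub_zero, sub_self]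

theorem comm_cobound (a : U k g) : τU (cobound a) = cobound a := by
  rw [cobound, map_sub, map_sub, comm_comul₀, TensorProduct.comm_tmul, TensorProduct.comm_tmul,
    sub_right_comm]

theorem counitRight₀_cobound {a : U k g} (h : counit₀ k g a = 0) :
    counitRight₀ k g (cobound a) = 0 := by
  rw [← counitLeft₀_comm, comm_cobound, counitLeft₀_cobound h]

theorem cobound_ι (x : g) : cobound (ιU x) = 0 := by
  rw [cobound, comul₀_ι]
  abel

theorem counit₀_mul' (F : U k g ⊗[k] U k g) :
    counit₀ k g (μU F) = counit₀ k g (counitLeft₀ k g F) := by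
  induction F with
  | zero => simp
  | tmul a b => rw [LinearMap.mul'_apply, map_mul, counitLeft₀_tmul, map_smul, smul_eq_mul]
  | add s t hs ht => simp only [map_add, hs, ht]

/-- Commutators with `x ∈ g` pass through the multiplication. -/
theorem ι_mul_mul' (x : g) (F : U k g ⊗[k] U k g) : ιU x * μU F - μU F * ιU x =
    μU (comul₀ k g (ιU x) * F - F * comul₀ k g (ιU x)) := by
  rw [comul₀_ι]
  induction F with
  | zero => simp
  | tmul a b =>
    simp only [add_mul, mul_add, Algebra.TensorProduct.tmul_mul_tmul, map_sub, map_add,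
      LinearMap.mul'_apply, one_mul, mul_one, mul_assoc]
    abel
  | add s t hs ht =>
    have e : ∀ p s t : U k g ⊗[k] U k g, p * (s + t) - (s + t) * p =
        (p * s - s * p) + (p * t - t * p) := fun p s t => by rw [mul_add, add_mul]; abel
    rw [e, map_add (μU) (_ - _), ← hs, ← ht, map_add, mul_add, add_mul]
    abel

variable (k g) in
/-- The embedding `g ⊗ g → U(g) ⊗ U(g)`. -/
def ιι : g ⊗[k] g →ₗ[k] U k g ⊗[k] U k g :=
  TensorProduct.map (ιU : g →ₗ[k] U k g) (ιU : g →ₗ[k] U k g)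

theorem ιι_tmul (x y : g) : ιι k g (x ⊗ₜ y) = ιU x ⊗ₜ ιU y := rfl

theorem ιι_comm (t : g ⊗[k] g) : ιι k g (TensorProduct.comm k g g t) = τU (ιι k g t) := by
  induction t with
  | zero => simp
  | tmul a b => rfl
  | add s t hs ht => simp only [map_add, hs, ht]

theorem ιι_lie (x : g) (t : g ⊗[k] g) : ιι k g ⁅x, t⁆ =
    comul₀ k g (ιU x) * ιι k g t - ιι k g t * comul₀ k g (ιU x) := by
  rw [comul₀_ι]
  induction t with
  | zero => simp
  | tmul a b =>
    rw [TensorProduct.LieModule.lie_tmul_right, map_add, ιι_tmul, ιι_tmul, ιι_tmul,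
      LieHom.map_lie, LieHom.map_lie]
    simp only [LieRing.of_associative_ring_bracket, add_mul, mul_add,
      Algebra.TensorProduct.tmul_mul_tmul, one_mul, mul_one, TensorProduct.sub_tmul,
      TensorProduct.tmul_sub]
    abel
  | add s t hs ht =>
    rw [lie_add, map_add, hs, ht, map_add, mul_add _ (ιι k g s), add_mul (ιι k g s)]
    abel

theorem counitLeft₀_ιι (t : g ⊗[k] g) : counitLeft₀ k g (ιι k g t) = 0 := by
  induction t with
  | zero => simp
  | tmul a b => rw [ιι_tmul, counitLeft₀_tmul, counit₀_ι, zero_smul]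
  | add s t hs ht => rw [map_add, map_add, hs, ht, add_zero]

theorem counitRight₀_ιι (t : g ⊗[k] g) : counitRight₀ k g (ιι k g t) = 0 := by
  rw [← counitLeft₀_comm, ← ιι_comm, counitLeft₀_ιι]

variable [CharZero k]

variable (k g) in
/-- The projection `U(g) ⊗ U(g) → g ⊗ g`. -/
def toLie₂ : U k g ⊗[k] U k g →ₗ[k] g ⊗[k] g := TensorProduct.map (toLie k g) (toLie k g)

theorem toLie₂_ιι (t : g ⊗[k] g) : toLie₂ k g (ιι k g t) = t := by
  induction t with
  | zero => simp
  | tmul a b => rw [ιι_tmul, toLie₂, TensorProduct.map_tmul, toLie_ι, toLie_ι]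
  | add s t hs ht => rw [map_add, map_add, hs, ht]

theorem ιι_injective : Function.Injective (ιι k g) :=
  Function.LeftInverse.injective toLie₂_ιι

theorem ιι_toLie₂ (W : U k g ⊗[k] U k g) :
    ιι k g (toLie₂ k g W) = TensorProduct.map (pr k g 1) (pr k g 1) W := by
  induction W with
  | zero => simp
  | tmul a b => rw [toLie₂, TensorProduct.map_tmul, ιι_tmul, ι_toLie, ι_toLie,
      TensorProduct.map_tmul]
  | add s t hs ht => rw [map_add, map_add, hs, ht, map_add]

/-- Inside U(g) ⊗ U(g) the adjoint action of x is the commutator with Δ(x), and g ⊗ g embeds. -/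
theorem mem_invSkew_iff (t : g ⊗[k] g) : t ∈ invSkew k g ↔
    τU (ιι k g t) = -ιι k g t ∧ ∀ x : g, Commute (ιι k g t) (comul₀ k g (ιU x)) := by
  refine and_congr ?_ (forall_congr' fun x => ?_)
  · rw [← ιι_comm, ← map_neg]
    exact ιι_injective.eq_iff.symm
  · rw [← ιι_injective.eq_iff, ιι_lie, map_zero, sub_eq_zero]
    exact eq_comm

/-- On the component of bidegree (i, j) the operator D ⊗ D is 2^(i+j). The counit conditions kill
the components with i = 0 or j = 0, and otherwise i + j ≥ 2, so the eigenvalue 2 does not occur. -/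
theorem eq_zero_of_dbl {W : U k g ⊗[k] U k g}
    (h : TensorProduct.map (dbl k g) (dbl k g) W = (2 : k) • W) (hl : counitLeft₀ k g W = 0)
    (hr : counitRight₀ k g W = 0) : W = 0 := by
  have hl' : TensorProduct.map (pr k g 0) LinearMap.id W = 1 ⊗ₜ counitLeft₀ k g W := by
    clear h hl hr
    induction W with
    | zero => simp
    | tmul a b => rw [TensorProduct.map_tmul, pr_zero, counitLeft₀_tmul, LinearMap.id_apply,
        TensorProduct.smul_tmul]
    | add s t hs ht => rw [map_add, hs, ht, map_add, TensorProduct.tmul_add]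
  have hr' : TensorProduct.map LinearMap.id (pr k g 0) W = counitRight₀ k g W ⊗ₜ 1 := by
    clear h hl hr hl'
    induction W with
    | zero => simp
    | tmul a b => rw [TensorProduct.map_tmul, pr_zero, counitRight₀_tmul, LinearMap.id_apply,
        TensorProduct.smul_tmul]
    | add s t hs ht => rw [map_add, hs, ht, map_add, TensorProduct.add_tmul]
  refine eq_zero_of_map_pr fun i j => ?_
  by_cases hi : i = 0
  · have e : TensorProduct.map (pr k g i) (pr k g j) =
        TensorProduct.map LinearMap.id (pr k g j) ∘ₗ TensorProduct.map (pr k g 0) LinearMap.id := by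
      rw [← TensorProduct.map_comp, LinearMap.id_comp, LinearMap.comp_id, hi]
    rw [e, LinearMap.comp_apply, hl', hl, TensorProduct.tmul_zero, map_zero]
  by_cases hj : j = 0
  · have e : TensorProduct.map (pr k g i) (pr k g j) =
        TensorProduct.map (pr k g i) LinearMap.id ∘ₗ TensorProduct.map LinearMap.id (pr k g 0) := by
      rw [← TensorProduct.map_comp, LinearMap.id_comp, LinearMap.comp_id, hj]
    rw [e, LinearMap.comp_apply, hr', hr, TensorProduct.zero_tmul, map_zero]
  have e : TensorProduct.map (pr k g i) (pr k g j) ∘ₗ TensorProduct.map (dbl k g) (dbl k g) =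
      (2 ^ (i + j) : k) • TensorProduct.map (pr k g i) (pr k g j) := by
    refine TensorProduct.ext' fun u v => ?_
    rw [LinearMap.comp_apply, TensorProduct.map_tmul, TensorProduct.map_tmul, pr_dbl, pr_dbl,
      TensorProduct.smul_tmul_smul, ← pow_add]
    rfl
  have h1 := DFunLike.congr_fun e W
  rw [LinearMap.comp_apply, h, map_smul, LinearMap.smul_apply, ← sub_eq_zero, ← sub_smul,
    smul_eq_zero] at h1
  refine h1.resolve_left fun h2 => ?_
  have h3 := two_pow_injective (k := k) (a₁ := 1) (a₂ := i + j) (by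
    simpa using sub_eq_zero.1 h2)
  omega

theorem pr_pr (i j : ℕ) (u : U k g) : pr k g i (pr k g j u) = if i = j then pr k g j u else 0 := by
  refine DFunLike.congr_fun (ext_powers (φ := pr k g i ∘ₗ pr k g j)
    (ψ := if i = j then pr k g j else 0) fun x n => ?_) u |>.trans ?_
  · rw [LinearMap.comp_apply, pr_pow]
    split_ifs with h1 h2 h2
    · rw [pr_pow, pr_pow, h1, h2]
    · rw [pr_pow, if_neg (by omega), LinearMap.zero_apply]
    · rw [pr_pow, map_zero, if_neg h1]
    · rw [map_zero, LinearMap.zero_apply]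
  · split_ifs <;> rfl

/-- Eigenvalue 2 = 2¹ in each leg means degree one in each leg. -/
theorem map_pr_one_of_dbl {A : U k g ⊗[k] U k g}
    (h : TensorProduct.map (dbl k g) LinearMap.id A = (2 : k) • A)
    (h' : TensorProduct.map LinearMap.id (dbl k g) A = (2 : k) • A) :
    TensorProduct.map (pr k g 1) (pr k g 1) A = A := by
  have e1 : ∀ i j, i ≠ 1 → TensorProduct.map (pr k g i) (pr k g j) A = 0 := by
    intro i j hi
    have e : TensorProduct.map (pr k g i) (pr k g j) ∘ₗ TensorProduct.map (dbl k g) LinearMap.id =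
        (2 ^ i : k) • TensorProduct.map (pr k g i) (pr k g j) := by
      refine TensorProduct.ext' fun u v => ?_
      rw [LinearMap.comp_apply, TensorProduct.map_tmul, TensorProduct.map_tmul, pr_dbl,
        ← TensorProduct.smul_tmul']
      rfl
    have h1 := DFunLike.congr_fun e A
    rw [LinearMap.comp_apply, h, map_smul, LinearMap.smul_apply, ← sub_eq_zero, ← sub_smul,
      smul_eq_zero] at h1
    refine h1.resolve_left fun h2 => hi ?_
    exact (two_pow_injective (k := k) (a₁ := 1) (a₂ := i) (by simpa using sub_eq_zero.1 h2)).symm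
  have e2 : ∀ i j, j ≠ 1 → TensorProduct.map (pr k g i) (pr k g j) A = 0 := by
    intro i j hj
    have e : TensorProduct.map (pr k g i) (pr k g j) ∘ₗ TensorProduct.map LinearMap.id (dbl k g) =
        (2 ^ j : k) • TensorProduct.map (pr k g i) (pr k g j) := by
      refine TensorProduct.ext' fun u v => ?_
      rw [LinearMap.comp_apply, TensorProduct.map_tmul, TensorProduct.map_tmul, pr_dbl,
        TensorProduct.tmul_smul]
      rfl
    have h1 := DFunLike.congr_fun e A
    rw [LinearMap.comp_apply, h', map_smul, LinearMap.smul_apply, ← sub_eq_zero, ← sub_smul,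
      smul_eq_zero] at h1
    refine h1.resolve_left fun h2 => hj ?_
    exact (two_pow_injective (k := k) (a₁ := 1) (a₂ := j) (by simpa using sub_eq_zero.1 h2)).symm
  rw [← sub_eq_zero]
  refine eq_zero_of_map_pr fun i j => ?_
  have e3 : TensorProduct.map (pr k g i) (pr k g j) (TensorProduct.map (pr k g 1) (pr k g 1) A) =
      if i = 1 ∧ j = 1 then TensorProduct.map (pr k g 1) (pr k g 1) A else 0 := by
    refine DFunLike.congr_fun (f := TensorProduct.map (pr k g i) (pr k g j) ∘ₗ
      TensorProduct.map (pr k g 1) (pr k g 1))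
      (g := if i = 1 ∧ j = 1 then TensorProduct.map (pr k g 1) (pr k g 1) else 0)
      (TensorProduct.ext' fun u v => ?_) A |>.trans ?_
    · rw [LinearMap.comp_apply, TensorProduct.map_tmul, TensorProduct.map_tmul, pr_pr, pr_pr]
      by_cases hi : i = 1 <;> by_cases hj : j = 1 <;> simp [hi, hj]
    · split_ifs <;> rfl
  rw [map_sub, e3]
  by_cases hi : i = 1
  · by_cases hj : j = 1
    · rw [if_pos ⟨hi, hj⟩, hi, hj, sub_self]
    · rw [if_neg (fun h => hj h.2), e2 i j hj, sub_self]
  · rw [if_neg (fun h => hi h.1), e1 i j hi, sub_self]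

/-- The scalars invert D - 2 outside degree one. -/
theorem dbl_scal (u : U k g) : dbl k g (scal g (fun n => (2 ^ n - 2 : k)⁻¹) u) =
    (2 : k) • scal g (fun n => (2 ^ n - 2 : k)⁻¹) u + (u - pr k g 1 u) := by
  refine DFunLike.congr_fun (ext_powers (φ := dbl k g ∘ₗ scal g (fun n => (2 ^ n - 2 : k)⁻¹))
    (ψ := (2 : k) • scal g (fun n => (2 ^ n - 2 : k)⁻¹) + (LinearMap.id - pr k g 1))
    fun x n => ?_) u
  simp only [LinearMap.comp_apply, LinearMap.add_apply, LinearMap.sub_apply, LinearMap.smul_apply,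
    LinearMap.id_apply]
  rw [scal_pow, map_smul, dbl_pow, pr_pow]
  split_ifs with hn
  -- In degree one the scalar is 0⁻¹ = 0, and the correction u - `pr k g 1 u` vanishes as well.
  · simp [hn]
  · have h2 : (2 ^ n - 2 : k) ≠ 0 := fun h => hn
      (two_pow_injective (k := k) (a₁ := n) (a₂ := 1) (by simpa using sub_eq_zero.1 h))
    rw [sub_zero, smul_smul, smul_smul]
    have e : (2 ^ n - 2 : k)⁻¹ * 2 ^ n = 2 * (2 ^ n - 2 : k)⁻¹ + 1 := by
      field_simp
      ring
    rw [e, add_smul, one_smul]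

/-- A normalised 2-cocycle of `U(g)` is the sum of a skew-symmetric tensor and a coboundary. -/
theorem IsCocycle.exists_decomposition {F : U k g ⊗[k] U k g} (hF : IsCocycle F)
    (hl : counitLeft₀ k g F = 0) (hr : counitRight₀ k g F = 0) :
    ∃ (y : g ⊗[k] g) (a : U k g), F = ιι k g y + cobound a ∧ τU (ιι k g y) = -ιι k g y ∧
      counit₀ k g a = 0 ∧
      ((∀ x : g, Commute F (comul₀ k g (ιU x))) → ∀ u : U k g, Commute a u) := by
  set A := F - τU F with hA
  -- The cobounding element a must solve (D - 2)a = μF up to degree one, where the coboundary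
  -- vanishes; these scalars give the solution.
  set c : ℕ → k := fun n => (2 ^ n - 2 : k)⁻¹ with hc
  have hτA : τU A = -A := by rw [hA, map_sub, comm_comm]; abel
  have h1 : TensorProduct.map (dbl k g) LinearMap.id A = (2 : k) • A := hF.dbl_left_skew
  have h2 : TensorProduct.map LinearMap.id (dbl k g) A = (2 : k) • A := by
    have e : ∀ W : U k g ⊗[k] U k g, TensorProduct.map LinearMap.id (dbl k g) (τU W) =
        τU (TensorProduct.map (dbl k g) LinearMap.id W) := by
      intro W
      induction W with
      | zero => simp
      | tmul a b => rfl
      | add s t hs ht => simp only [map_add, hs, ht]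
    have h := e A
    rw [hτA, map_neg, h1, map_smul, hτA, smul_neg, neg_inj] at h
    exact h
  have h4 : TensorProduct.map (dbl k g) (dbl k g) A = (4 : k) • A := by
    have e : TensorProduct.map (dbl k g) (dbl k g) = TensorProduct.map (dbl k g) LinearMap.id ∘ₗ
        TensorProduct.map LinearMap.id (dbl k g) := by
      rw [← TensorProduct.map_comp, LinearMap.id_comp, LinearMap.comp_id]
    rw [e, LinearMap.comp_apply, h2, map_smul, h1, smul_smul]
    norm_num
  have hy : ιι k g (toLie₂ k g ((2 : k)⁻¹ • A)) = (2 : k)⁻¹ • A := by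
    rw [ιι_toLie₂, map_smul, map_pr_one_of_dbl h1 h2]
  have hε : counit₀ k g (scal g c (μU F)) = 0 := by
    rw [counit₀_scal, counit₀_mul', hl, map_zero, mul_zero]
  have hAl : counitLeft₀ k g A = 0 := by rw [hA, map_sub, counitLeft₀_comm, hl, hr, sub_self]
  have hAr : counitRight₀ k g A = 0 := by rw [hA, map_sub, counitRight₀_comm, hl, hr, sub_self]
  refine ⟨toLie₂ k g ((2 : k)⁻¹ • A), scal g c (μU F), ?_, ?_, hε, ?_⟩
  · rw [hy, ← sub_eq_zero]
    -- The difference of F and its proposed decomposition satisfies (D ⊗ D)W = 2W: the term F - τF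
    -- is offset because D ⊗ D multiplies its half by 4, and the coboundary terms cancel by the
    -- choice of a.
    refine eq_zero_of_dbl ?_ ?_ ?_
    · have hcob : ∀ a, TensorProduct.map (dbl k g) (dbl k g) (cobound a) =
          cobound (dbl k g a) := by
        intro a
        rw [cobound, map_sub, map_sub, ← comul₀_dbl, TensorProduct.map_tmul,
          TensorProduct.map_tmul, dbl_one, cobound]
      have hlin : cobound (dbl k g (scal g c (μU F))) =
          (2 : k) • cobound (scal g c (μU F)) + cobound (μU F) := by
        have h0 : cobound (pr k g 1 (μU F)) = 0 := by rw [← ι_toLie, cobound_ι]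
        rw [← sub_zero (cobound (μU F)), ← h0, dbl_scal]
        simp only [cobound, map_add, map_sub, map_smul, TensorProduct.add_tmul,
          TensorProduct.tmul_add, TensorProduct.sub_tmul, TensorProduct.tmul_sub,
          ← TensorProduct.smul_tmul', TensorProduct.tmul_smul, smul_sub]
        abel
      rw [map_sub, map_add, map_smul, hcob, hlin, h4, hF.dbl_eq, ← hA, smul_sub (2 : k) F,
        smul_add, smul_smul, smul_smul]
      have e4 : (2⁻¹ * 4 : k) = 1 + 1 := by norm_num
      have e2 : (2 * 2⁻¹ : k) = 1 := by norm_num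
      rw [e4, e2, add_smul, one_smul]
      abel
    · rw [map_sub, map_add, map_smul, hl, hAl, counitLeft₀_cobound hε]
      simp
    · rw [map_sub, map_add, map_smul, hr, hAr, counitRight₀_cobound hε]
      simp
  · rw [hy, map_smul, hτA, smul_neg]
  · intro hcomm u
    refine commute_of_commute_ι (AlgHom.id k _) (fun x => ?_) u
    rw [AlgHom.id_apply]
    -- The commutator with x commutes with D, hence with the operator defining a from μF; and it
    -- kills μF because F commutes with Δ(x).
    let T : U k g →ₗ[k] U k g := LinearMap.mulLeft k (ιU x) - LinearMap.mulRight k (ιU x)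
    have hT : ∀ u, T (dbl k g u) = dbl k g (T u) := by
      intro u
      change ιU x * μU (comul₀ k g u) - μU (comul₀ k g u) * ιU x =
        μU (comul₀ k g (ιU x * u - u * ιU x))
      rw [ι_mul_mul', map_sub (comul₀ k g), map_mul (comul₀ k g), map_mul (comul₀ k g)]
    have h5 := scal_comm_of_comm_dbl c T hT (μU F)
    have h6 : T (μU F) = 0 := by
      change ιU x * μU F - μU F * ιU x = 0
      rw [ι_mul_mul', (hcomm x).eq, sub_self, map_zero]
    rw [h6, map_zero] at h5
    exact (sub_eq_zero.1 h5).symm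

end Decomposition

/-! ### Congruence modulo powers of `h` -/

section EqMod

variable {k : Type*} [Field k] {A B : Type*} [Ring A] [Algebra k A] [Ring B] [Algebra k B]

/-- Congruence of power series modulo `hⁿ`. -/
def EqMod {A : Type*} [Ring A] (n : ℕ) (S T : A⟦X⟧) : Prop :=
  ∀ i < n, PowerSeries.coeff i S = PowerSeries.coeff i T

theorem EqMod.refl {n : ℕ} (S : A⟦X⟧) : EqMod n S S := fun _ _ => rfl

theorem EqMod.symm {n : ℕ} {S T : A⟦X⟧} (h : EqMod n S T) : EqMod n T S :=
  fun i hi => (h i hi).symm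

theorem EqMod.trans {n : ℕ} {R S T : A⟦X⟧} (h : EqMod n R S) (h' : EqMod n S T) : EqMod n R T :=
  fun i hi => (h i hi).trans (h' i hi)

theorem EqMod.mono {m n : ℕ} {S T : A⟦X⟧} (hmn : m ≤ n) (h : EqMod n S T) : EqMod m S T :=
  fun i hi => h i (hi.trans_le hmn)

theorem EqMod.add {n : ℕ} {S S' T T' : A⟦X⟧} (h : EqMod n S S') (h' : EqMod n T T') :
    EqMod n (S + T) (S' + T') :=
  fun i hi => by rw [map_add, map_add, h i hi, h' i hi]

theorem EqMod.mul {n : ℕ} {S S' T T' : A⟦X⟧} (h : EqMod n S S') (h' : EqMod n T T') :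
    EqMod n (S * T) (S' * T') := fun i hi => by
  rw [PowerSeries.coeff_mul, PowerSeries.coeff_mul]
  refine Finset.sum_congr rfl fun p hp => ?_
  have h2 := Finset.HasAntidiagonal.mem_antidiagonal.1 hp
  rw [h _ (by omega), h' _ (by omega)]

theorem EqMod.X_mul {n : ℕ} {S T : A⟦X⟧} (h : EqMod n S T) :
    EqMod (n + 1) (PowerSeries.X * S) (PowerSeries.X * T) := fun i hi => by
  cases i with
  | zero => simp
  | succ i => rw [PowerSeries.coeff_succ_X_mul, PowerSeries.coeff_succ_X_mul, h i (by omega)]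

theorem eq_of_forall_eqMod {S T : A⟦X⟧} (h : ∀ n, EqMod n S T) : S = T :=
  PowerSeries.ext fun n => h (n + 1) n (Nat.lt_succ_self n)

theorem EqMod.exists_eq {n : ℕ} {S T : A⟦X⟧} (h : EqMod n S T) :
    ∃ R, S = T + PowerSeries.X ^ n * R := by
  have h1 : PowerSeries.X ^ n ∣ S - T := PowerSeries.X_pow_dvd_iff.2 fun i hi => by
    rw [map_sub, h i hi, sub_self]
  obtain ⟨R, hR⟩ := h1
  exact ⟨R, by rw [← hR]; abel⟩

theorem eqMod_add_X_pow_mul (n : ℕ) (T R : A⟦X⟧) : EqMod n (T + PowerSeries.X ^ n * R) T := by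
  intro i hi
  rw [map_add, PowerSeries.coeff_X_pow_mul', if_neg (by omega), add_zero]

theorem algHom_X_pow_mul (f : A⟦X⟧ →ₐ[k⟦X⟧] B⟦X⟧) (n : ℕ) (T : A⟦X⟧) :
    f (PowerSeries.X ^ n * T) = PowerSeries.X ^ n * f T := by
  induction n with
  | zero => simp
  | succ n ih => rw [pow_succ', mul_assoc, algHom_X_mul, ih, pow_succ', mul_assoc]

theorem EqMod.map {n : ℕ} {S T : A⟦X⟧} (h : EqMod n S T) (f : A⟦X⟧ →ₐ[k⟦X⟧] B⟦X⟧) :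
    EqMod n (f S) (f T) := by
  obtain ⟨R, rfl⟩ := h.exists_eq
  rw [map_add, algHom_X_pow_mul]
  exact eqMod_add_X_pow_mul _ _ _

theorem const_smul_eq (c : k) (T : A⟦X⟧) :
    c • T = algebraMap k⟦X⟧ A⟦X⟧ (PowerSeries.C c) * T := by
  rw [seriesAlgebraMap, PowerSeries.map_C]
  ext n
  rw [PowerSeries.coeff_smul, PowerSeries.coeff_C_mul, Algebra.smul_def]

theorem algHom_smul_const (f : A⟦X⟧ →ₐ[k⟦X⟧] B⟦X⟧) (c : k) (T : A⟦X⟧) : f (c • T) = c • f T := by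
  rw [const_smul_eq, map_mul, f.commutes, const_smul_eq]

theorem coeff_zero_mul' (S T : A⟦X⟧) : PowerSeries.coeff 0 (S * T) =
    PowerSeries.coeff 0 S * PowerSeries.coeff 0 T := by
  simp only [PowerSeries.coeff_zero_eq_constantCoeff_apply, map_mul]

end EqMod

/-! ### Exponentials in a power series ring over a noncommutative ring -/

section FormalExp

variable (k : Type*) [Field k] {R : Type*} [Ring R] [Algebra k R]

/-- The formal derivative of a power series with noncommutative coefficients. -/
def dd (P : R⟦X⟧) : R⟦X⟧ :=
  PowerSeries.mk fun n => ((n + 1 : ℕ) : k) • PowerSeries.coeff (n + 1) P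

theorem coeff_dd (P : R⟦X⟧) (n : ℕ) : PowerSeries.coeff n (dd k P) =
    ((n + 1 : ℕ) : k) • PowerSeries.coeff (n + 1) P := PowerSeries.coeff_mk _ _

theorem dd_mul (P Q : R⟦X⟧) : dd k (P * Q) = dd k P * Q + P * dd k Q := by
  ext n
  rw [coeff_dd, map_add, PowerSeries.coeff_mul, PowerSeries.coeff_mul, PowerSeries.coeff_mul]
  simp only [coeff_dd]
  have h1 : ((n + 1 : ℕ) : k) • ∑ p ∈ Finset.HasAntidiagonal.antidiagonal (n + 1),
      PowerSeries.coeff p.1 P * PowerSeries.coeff p.2 Q =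
      ∑ p ∈ Finset.HasAntidiagonal.antidiagonal (n + 1),
        (p.1 : k) • (PowerSeries.coeff p.1 P * PowerSeries.coeff p.2 Q) +
      ∑ p ∈ Finset.HasAntidiagonal.antidiagonal (n + 1),
        (p.2 : k) • (PowerSeries.coeff p.1 P * PowerSeries.coeff p.2 Q) := by
    rw [Finset.smul_sum, ← Finset.sum_add_distrib]
    refine Finset.sum_congr rfl fun p hp => ?_
    rw [← add_smul, ← Nat.cast_add, Finset.HasAntidiagonal.mem_antidiagonal.1 hp]
  rw [h1, Finset.Nat.sum_antidiagonal_succ, Finset.Nat.sum_antidiagonal_succ' (n := n)]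
  simp only [Nat.cast_zero, zero_smul, zero_add, smul_mul_assoc, mul_smul_comm]

/-- The equation P' = MP determines the coefficients recursively after division by n + 1. This lets
identities of exponentials be checked as differential equations in the formal parameter. -/
theorem eq_of_dd_eq [CharZero k] {M P Q : R⟦X⟧} (hP : dd k P = M * P) (hQ : dd k Q = M * Q)
    (h0 : PowerSeries.coeff 0 P = PowerSeries.coeff 0 Q) : P = Q := by
  ext n
  induction n using Nat.strong_induction_on with
  | _ n ih =>
    cases n with
    | zero => exact h0
    | succ n =>
      have h1 := congrArg (PowerSeries.coeff n) hP
      have h2 := congrArg (PowerSeries.coeff n) hQ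
      rw [coeff_dd, PowerSeries.coeff_mul] at h1 h2
      have h3 : ((n + 1 : ℕ) : k) • PowerSeries.coeff (n + 1) P =
          ((n + 1 : ℕ) : k) • PowerSeries.coeff (n + 1) Q := by
        rw [h1, h2]
        refine Finset.sum_congr rfl fun p hp => ?_
        have := Finset.HasAntidiagonal.mem_antidiagonal.1 hp
        rw [ih p.2 (by omega)]
      have hn : ((n + 1 : ℕ) : k) ≠ 0 := Nat.cast_ne_zero.2 (Nat.succ_ne_zero n)
      have h4 := congrArg (((n + 1 : ℕ) : k)⁻¹ • ·) h3
      simpa only [smul_smul, inv_mul_cancel₀ hn, one_smul] using h4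

/-- The formal exponential `exp(t Y)`. -/
def fexp (Y : R) : R⟦X⟧ := PowerSeries.mk fun m => ((m.factorial : k)⁻¹) • Y ^ m

theorem coeff_fexp (Y : R) (m : ℕ) :
    PowerSeries.coeff m (fexp k Y) = ((m.factorial : k)⁻¹) • Y ^ m := PowerSeries.coeff_mk _ _

theorem coeff_zero_fexp (Y : R) : PowerSeries.coeff 0 (fexp k Y) = 1 := by
  rw [coeff_fexp]; simp

theorem succ_smul_factorial_inv [CharZero k] (n : ℕ) :
    ((n + 1 : ℕ) : k) * (((n + 1).factorial : k)⁻¹) = ((n.factorial : k)⁻¹) := by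
  have hn : ((n + 1 : ℕ) : k) ≠ 0 := Nat.cast_ne_zero.2 (Nat.succ_ne_zero n)
  rw [Nat.factorial_succ, Nat.cast_mul, mul_inv, ← mul_assoc, mul_inv_cancel₀ hn, one_mul]

theorem dd_fexp [CharZero k] (Y : R) : dd k (fexp k Y) = PowerSeries.C Y * fexp k Y := by
  ext n
  rw [coeff_dd, coeff_fexp, PowerSeries.coeff_C_mul, coeff_fexp, smul_smul,
    succ_smul_factorial_inv, mul_smul_comm, pow_succ']

/-- The formal series `exp(t² C)`. -/
def fexpSq (C : R) : R⟦X⟧ := PowerSeries.mk fun m =>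
  if Even m then (((m / 2).factorial : k)⁻¹) • C ^ (m / 2) else 0

theorem dd_fexpSq [CharZero k] (C : R) :
    dd k (fexpSq k C) = PowerSeries.X * (PowerSeries.C ((2 : k) • C) * fexpSq k C) := by
  ext n
  rw [coeff_dd, fexpSq, PowerSeries.coeff_mk]
  cases n with
  | zero => simp
  | succ n =>
    rw [PowerSeries.coeff_succ_X_mul, PowerSeries.coeff_C_mul, PowerSeries.coeff_mk]
    have he : Even (n + 1 + 1) ↔ Even n := by
      rw [Nat.even_add_one, Nat.even_add_one, not_not]
    by_cases h : Even n
    · rw [if_pos (he.2 h), if_pos h]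
      obtain ⟨m, rfl⟩ := h
      have e1 : (m + m + 1 + 1) / 2 = m + 1 := by omega
      have e2 : (m + m) / 2 = m := by omega
      have e3 : ((m + m + 1 + 1 : ℕ) : k) = 2 * ((m + 1 : ℕ) : k) := by push_cast; ring
      rw [e1, e2, e3, smul_smul, mul_assoc, succ_smul_factorial_inv, mul_smul_comm,
        smul_mul_assoc, ← pow_succ', smul_smul, mul_comm]
    · rw [if_neg (fun h' => h (he.1 h')), if_neg h]
      simp

/-- Moving Y to the left of a power of X costs one factor C for each X, so that exp(tX) Y = (Y + tC)
exp(tX). -/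
theorem fexp_mul_C {X Y C : R} (hC : X * Y = Y * X + C) (hX : Commute X C) [CharZero k] :
    fexp k X * PowerSeries.C Y =
      (PowerSeries.C Y + PowerSeries.X * PowerSeries.C C) * fexp k X := by
  have hpow : ∀ n : ℕ, X ^ (n + 1) * Y = Y * X ^ (n + 1) + ((n + 1 : ℕ) : k) • (C * X ^ n) := by
    intro n
    induction n with
    | zero => simp [hC]
    | succ n ih =>
      rw [pow_succ' X (n + 1), mul_assoc, ih, mul_add, ← mul_assoc, hC, add_mul, mul_assoc,
        mul_smul_comm, ← mul_assoc X C, hX.eq, mul_assoc C X, ← pow_succ', ← pow_succ', add_assoc]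
      congr 1
      nth_rewrite 1 [← one_smul k (C * X ^ (n + 1))]
      rw [← add_smul]
      push_cast
      congr 1
      ring
  ext n
  rw [add_mul, map_add, PowerSeries.coeff_mul_C, PowerSeries.coeff_C_mul, mul_assoc]
  cases n with
  | zero => simp [coeff_fexp]
  | succ n =>
    rw [PowerSeries.coeff_succ_X_mul, PowerSeries.coeff_C_mul, coeff_fexp, coeff_fexp,
      smul_mul_assoc, hpow, smul_add, mul_smul_comm, mul_smul_comm, smul_smul, mul_comm,
      succ_smul_factorial_inv]

theorem fexp_commute_C {X C : R} (h : Commute X C) : Commute (fexp k X) (PowerSeries.C C) := by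
  change _ * _ = _ * _
  ext n
  rw [PowerSeries.coeff_mul_C, PowerSeries.coeff_C_mul, coeff_fexp, smul_mul_assoc, mul_smul_comm,
    (h.pow_left n).eq]

/-- The Baker–Campbell–Hausdorff formula in the case of a central commutator. -/
theorem fexp_mul_fexp [CharZero k] {X Y C : R} (hC : X * Y = Y * X + C) (hX : Commute X C)
    (hY : Commute Y C) :
    fexp k X * fexp k Y = fexp k (X + Y) * fexpSq k ((2 : k)⁻¹ • C) := by
  -- Both sides solve P' = (X + Y + tC)P with constant term 1, where t is the formal variable.
  refine eq_of_dd_eq k (M := PowerSeries.C (X + Y) + PowerSeries.X * PowerSeries.C C) ?_ ?_ ?_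
  · rw [dd_mul, dd_fexp, dd_fexp, ← mul_assoc (fexp k X), fexp_mul_C k hC hX]
    simp only [map_add, add_mul, mul_assoc, add_assoc]
  · have h2 : (2 : k) • (2 : k)⁻¹ • C = C := by
      rw [smul_smul, mul_inv_cancel₀ two_ne_zero, one_smul]
    rw [dd_mul, dd_fexp, dd_fexpSq, h2, X_mul_left_comm', ← mul_assoc (fexp k (X + Y)),
      (fexp_commute_C k (hX.add_left hY)).eq]
    simp only [add_mul, mul_assoc]
  · rw [coeff_zero_mul', coeff_zero_mul', coeff_zero_fexp, coeff_zero_fexp,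
      coeff_zero_fexp, fexpSq, PowerSeries.coeff_mk]
    simp

end FormalExp

/-! ### Exponentials of `h Y` -/

section Exp

variable (k : Type*) [Field k] {A B : Type*} [Ring A] [Algebra k A] [Ring B] [Algebra k B]

/-- `exp(h Y)` in `A[[h]]`. -/
def hexp (Y : A⟦X⟧) : A⟦X⟧ := PowerSeries.mk fun n =>
  ∑ m ∈ Finset.range (n + 1),
    ((m.factorial : k)⁻¹) • PowerSeries.coeff n ((PowerSeries.X * Y) ^ m)

theorem X_mul_pow (Y : A⟦X⟧) (m : ℕ) :
    (PowerSeries.X * Y) ^ m = PowerSeries.X ^ m * Y ^ m :=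
  (PowerSeries.commute_X Y).symm.mul_pow m

/-- The substitution `t = h`. -/
def evH : (A⟦X⟧)⟦X⟧ →+* A⟦X⟧ := RingHomClass.toRingHom (extend (AlgHom.id k A⟦X⟧))

theorem coeff_evH (T : (A⟦X⟧)⟦X⟧) (n : ℕ) : PowerSeries.coeff n (evH k T) =
    ∑ m ∈ Finset.range (n + 1), PowerSeries.coeff n (PowerSeries.X ^ m * PowerSeries.coeff m T) := by
  refine (coeff_extendFun (AlgHom.id k A⟦X⟧) T n).trans ?_
  rw [← Finset.Nat.sum_antidiagonal_swap, Finset.Nat.sum_antidiagonal_eq_sum_range_succ_mk]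
  refine Finset.sum_congr rfl fun m hm => ?_
  rw [PowerSeries.coeff_X_pow_mul', if_pos (Nat.lt_succ_iff.1 (Finset.mem_range.1 hm))]
  rfl

theorem hexp_eq_evH (Y : A⟦X⟧) : hexp k Y = evH k (fexp k Y) := by
  ext n
  rw [coeff_evH, hexp, PowerSeries.coeff_mk]
  refine Finset.sum_congr rfl fun m _ => ?_
  rw [coeff_fexp, mul_smul_comm, PowerSeries.coeff_smul, X_mul_pow]

/-- Only even powers t²ᵐ occur, and at t = h the term h²ᵐ Cᵐ is (h · hC)ᵐ. -/
theorem evH_fexpSq (C : A⟦X⟧) : evH k (fexpSq k C) = hexp k (PowerSeries.X * C) := by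
  ext n
  rw [coeff_evH, hexp, PowerSeries.coeff_mk, fexpSq]
  have h1 : ∀ m ∈ Finset.range (n + 1), PowerSeries.coeff n (PowerSeries.X ^ m *
      PowerSeries.coeff m (PowerSeries.mk fun m => if Even m then
        (((m / 2).factorial : k)⁻¹) • C ^ (m / 2) else 0)) = if Even m then
      PowerSeries.coeff n ((((m / 2).factorial : k)⁻¹) • (PowerSeries.X ^ m * C ^ (m / 2)))
        else 0 := by
    intro m _
    rw [PowerSeries.coeff_mk]
    split_ifs
    · rw [mul_smul_comm]
    · rw [mul_zero, map_zero]
  have h2 : ∀ m ∈ Finset.range (n + 1), ((m.factorial : k)⁻¹) •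
      PowerSeries.coeff n ((PowerSeries.X * (PowerSeries.X * C)) ^ m) = if 2 * m ≤ n then
      PowerSeries.coeff n (((m.factorial : k)⁻¹) • (PowerSeries.X ^ (2 * m) * C ^ m)) else 0 := by
    intro m _
    rw [X_mul_pow, X_mul_pow, ← mul_assoc, ← pow_add, ← two_mul, PowerSeries.coeff_smul]
    split_ifs with h
    · rfl
    · rw [PowerSeries.coeff_X_pow_mul', if_neg h, smul_zero]
  rw [Finset.sum_congr rfl h1, Finset.sum_congr rfl h2, ← Finset.sum_filter, ← Finset.sum_filter]
  refine Finset.sum_nbij' (fun m => m / 2) (fun m => 2 * m) ?_ ?_ ?_ ?_ ?_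
  · intro m hm
    simp only [Finset.mem_filter, Finset.mem_range] at hm ⊢
    omega
  · intro m hm
    simp only [Finset.mem_filter, Finset.mem_range] at hm ⊢
    exact ⟨by omega, even_two_mul m⟩
  · intro m hm
    exact Nat.two_mul_div_two_of_even (Finset.mem_filter.1 hm).2
  · intro m _
    omega
  · intro m hm
    rw [Nat.two_mul_div_two_of_even (Finset.mem_filter.1 hm).2]

theorem hexp_zero : hexp k (0 : A⟦X⟧) = 1 := by
  ext n
  rw [hexp, PowerSeries.coeff_mk, Finset.sum_eq_single 0]
  · simp
  · intro m _ hm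
    rw [mul_zero, zero_pow hm, map_zero, smul_zero]
  · simp

/-- Since hᵐ divides (hY)ᵐ, the exponential is a polynomial in Y modulo hⁿ, which reduces its formal
properties to finite sums. -/
theorem eqMod_hexp (Y : A⟦X⟧) (n : ℕ) : EqMod n (hexp k Y)
    (∑ m ∈ Finset.range n, ((m.factorial : k)⁻¹) • (PowerSeries.X * Y) ^ m) := by
  intro i hi
  rw [hexp, PowerSeries.coeff_mk, map_sum]
  simp only [PowerSeries.coeff_smul]
  refine Finset.sum_subset (Finset.range_subset_range.2 hi) fun m _ hm => ?_
  rw [X_mul_pow, PowerSeries.coeff_X_pow_mul', if_neg (by rw [Finset.mem_range] at hm; omega),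
    smul_zero]

/-- No continuity assumption is needed: a k[[h]]-linear map preserves congruences modulo hⁿ. -/
theorem map_hexp (f : A⟦X⟧ →ₐ[k⟦X⟧] B⟦X⟧) (Y : A⟦X⟧) : f (hexp k Y) = hexp k (f Y) := by
  refine eq_of_forall_eqMod fun n => ((eqMod_hexp k Y n).map f).trans ?_
  refine EqMod.trans ?_ (eqMod_hexp k (f Y) n).symm
  rw [map_sum]
  simp only [algHom_smul_const, map_pow, algHom_X_mul]
  exact EqMod.refl _

theorem hexp_commute {Y Z : A⟦X⟧} (h : Commute Y Z) : Commute (hexp k Y) Z := by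
  refine eq_of_forall_eqMod fun n => ((eqMod_hexp k Y n).mul (EqMod.refl Z)).trans ?_
  refine EqMod.trans ?_ ((EqMod.refl Z).mul (eqMod_hexp k Y n)).symm
  have hc : Commute (∑ m ∈ Finset.range n, ((m.factorial : k)⁻¹) • (PowerSeries.X * Y) ^ m) Z :=
    Commute.sum_left _ _ _ fun m _ =>
      ((((PowerSeries.commute_X Z).symm.mul_left h).pow_left m).smul_left _)
  rw [hc.eq]
  exact EqMod.refl _

theorem hexp_eqMod_one (Y : A⟦X⟧) : EqMod 1 (hexp k Y) 1 := by
  refine (eqMod_hexp k Y 1).trans ?_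
  simpa using EqMod.refl (1 : A⟦X⟧)

/-- Changing `Y` in degree `n` changes `exp(h Y)` in degree `n + 1` additively. -/
theorem hexp_add_X_pow_mul (Y Z : A⟦X⟧) (n : ℕ) : EqMod (n + 2)
    (hexp k (Y + PowerSeries.X ^ n * Z)) (hexp k Y + PowerSeries.X ^ (n + 1) * Z) := by
  set Y' := Y + PowerSeries.X ^ n * Z with hY'
  have h0 : EqMod n Y' Y := eqMod_add_X_pow_mul n Y Z
  have hpow : ∀ m : ℕ, EqMod n (Y' ^ m) (Y ^ m) := by
    intro m
    induction m with
    | zero => exact EqMod.refl _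
    | succ m ih => rw [pow_succ, pow_succ]; exact ih.mul h0
  have hXm : ∀ (m : ℕ) {S T : A⟦X⟧}, EqMod n S T →
      EqMod (n + m) (PowerSeries.X ^ m * S) (PowerSeries.X ^ m * T) := by
    intro m S T h
    induction m with
    | zero => simpa using h
    | succ m ih => rw [pow_succ', mul_assoc, mul_assoc]; exact ih.X_mul
  -- Terms with m ≥ 2 carry a factor h² besides the congruence modulo hⁿ, so only the linear term
  -- sees the change.
  have hbig : ∀ m, 2 ≤ m → EqMod (n + 2) ((PowerSeries.X * Y') ^ m) ((PowerSeries.X * Y) ^ m) := by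
    intro m hm
    rw [X_mul_pow, X_mul_pow]
    exact (hXm m (hpow m)).mono (by omega)
  refine (eqMod_hexp k Y' (n + 2)).trans ?_
  refine EqMod.trans ?_ ((eqMod_hexp k Y (n + 2)).add (EqMod.refl _)).symm
  intro i hi
  rw [map_add, map_sum, map_sum, Finset.sum_range_succ', Finset.sum_range_succ',
    Finset.sum_range_succ', Finset.sum_range_succ']
  have hs : ∑ m ∈ Finset.range n, PowerSeries.coeff i
        ((((m + 1 + 1).factorial : k)⁻¹) • (PowerSeries.X * Y') ^ (m + 1 + 1)) =
      ∑ m ∈ Finset.range n, PowerSeries.coeff i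
        ((((m + 1 + 1).factorial : k)⁻¹) • (PowerSeries.X * Y) ^ (m + 1 + 1)) :=
    Finset.sum_congr rfl fun m _ => by
      rw [PowerSeries.coeff_smul, PowerSeries.coeff_smul, hbig (m + 1 + 1) (by omega) i hi]
  rw [hs, hY', mul_add, ← mul_assoc, ← pow_succ']
  simp only [zero_add, Nat.factorial_one, Nat.cast_one, inv_one, one_smul, pow_one, map_add,
    pow_zero]
  abel

variable [CharZero k]

theorem hexp_mul_hexp {X Y C : A⟦X⟧} (hC : X * Y = Y * X + C) (hX : Commute X C)
    (hY : Commute Y C) :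
    hexp k X * hexp k Y = hexp k (X + Y) * hexp k (PowerSeries.X * ((2 : k)⁻¹ • C)) := by
  rw [hexp_eq_evH, hexp_eq_evH, hexp_eq_evH, ← evH_fexpSq, ← map_mul, ← map_mul,
    fexp_mul_fexp k hC hX hY]

theorem hexp_add {X Y : A⟦X⟧} (h : Commute X Y) : hexp k (X + Y) = hexp k X * hexp k Y := by
  rw [hexp_mul_hexp k (C := 0) (by rw [h.eq, add_zero]) (Commute.zero_right _)
    (Commute.zero_right _), smul_zero, mul_zero, hexp_zero, mul_one]

theorem hexp_mul_hexp_neg (Y : A⟦X⟧) : hexp k Y * hexp k (-Y) = 1 := by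
  rw [← hexp_add k (Commute.refl Y).neg_right, add_neg_cancel, hexp_zero]

theorem hexp_neg_mul_hexp (Y : A⟦X⟧) : hexp k (-Y) * hexp k Y = 1 := by
  rw [← hexp_add k (Commute.refl Y).neg_left, neg_add_cancel, hexp_zero]

end Exp

/-! ### Centrality and the flip -/

section Central

variable {k : Type*} [Field k] {A B : Type*} [Ring A] [Algebra k A] [Ring B] [Algebra k B]

theorem commute_of_coeff {S T : A⟦X⟧}
    (h : ∀ i j, Commute (PowerSeries.coeff i S) (PowerSeries.coeff j T)) : Commute S T := by
  change S * T = T * S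
  ext n
  rw [PowerSeries.coeff_mul, PowerSeries.coeff_mul, ← Finset.Nat.sum_antidiagonal_swap]
  exact Finset.sum_congr rfl fun p _ => h _ _

theorem commute_coeff_of_commute_C {S : A⟦X⟧} {a : A} (h : Commute S (PowerSeries.C a)) (n : ℕ) :
    Commute (PowerSeries.coeff n S) a := by
  have h1 := congrArg (PowerSeries.coeff n) h.eq
  rwa [PowerSeries.coeff_mul_C, PowerSeries.coeff_C_mul] at h1

theorem coeff_inl (T : A⟦X⟧) (n : ℕ) : PowerSeries.coeff n (inl T : (A ⊗[k] B)⟦X⟧) =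
    PowerSeries.coeff n T ⊗ₜ 1 := rfl

theorem coeff_inr (T : B⟦X⟧) (n : ℕ) : PowerSeries.coeff n (inr T : (A ⊗[k] B)⟦X⟧) =
    1 ⊗ₜ PowerSeries.coeff n T := rfl

theorem tmul_one_central {w : A} (hw : ∀ a, Commute w a) (t : A ⊗[k] B) :
    Commute (w ⊗ₜ[k] (1 : B)) t := by
  induction t with
  | zero => exact Commute.zero_right _
  | tmul a b =>
    change _ * _ = _ * _
    rw [Algebra.TensorProduct.tmul_mul_tmul, Algebra.TensorProduct.tmul_mul_tmul, (hw a).eq,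
      one_mul, mul_one]
  | add s t hs ht => exact hs.add_right ht

theorem one_tmul_central {w : B} (hw : ∀ b, Commute w b) (t : A ⊗[k] B) :
    Commute ((1 : A) ⊗ₜ[k] w) t := by
  induction t with
  | zero => exact Commute.zero_right _
  | tmul a b =>
    change _ * _ = _ * _
    rw [Algebra.TensorProduct.tmul_mul_tmul, Algebra.TensorProduct.tmul_mul_tmul, (hw b).eq,
      one_mul, mul_one]
  | add s t hs ht => exact hs.add_right ht

theorem inl_central {w : A⟦X⟧} (hw : ∀ x, Commute w x) (T : (A ⊗[k] B)⟦X⟧) :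
    Commute (inl w) T :=
  commute_of_coeff fun i _ =>
    tmul_one_central (fun _ => commute_coeff_of_commute_C (hw _) i) _

theorem inr_central {w : B⟦X⟧} (hw : ∀ x, Commute w x) (T : (A ⊗[k] B)⟦X⟧) :
    Commute (inr w) T :=
  commute_of_coeff fun i _ =>
    one_tmul_central (fun _ => commute_coeff_of_commute_C (hw _) i) _

end Central

/-! ### The flip of the tensor factors. -/

section Flip

variable {k g : Type*} [Field k] [LieRing g] [LieAlgebra k g]

attribute [local instance] LieRing.ofAssociativeRing

local notation "ιU" => (UniversalEnvelopingAlgebra.ι k : g →ₗ⁅k⁆ U k g)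

local notation "τU" => TensorProduct.comm k (U k g) (U k g)

theorem tmulSelf_central {w : H k g} (hw : ∀ x, Commute w x) (T : H2 k g) :
    Commute (tmulSelf w) T :=
  (inl_central hw T).mul_left (inr_central hw T)

variable (k g) in
/-- The flip of the two tensor factors of `H ⊗ H`. -/
def flip : H2 k g →ₐ[k⟦X⟧] H2 k g :=
  coeffwise (Algebra.TensorProduct.comm k (U k g) (U k g)).toAlgHom

theorem coeff_flip (T : H2 k g) (n : ℕ) :
    PowerSeries.coeff n (flip k g T) = τU (PowerSeries.coeff n T) := rfl

theorem coeff_comul (x : H k g) (n : ℕ) :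
    PowerSeries.coeff n (comul x) = comul₀ k g (PowerSeries.coeff n x) := rfl

theorem flip_inl (x : H k g) : flip k g (inl x) = inr x := by
  ext n; rw [coeff_flip, coeff_inl, coeff_inr, TensorProduct.comm_tmul]

theorem flip_inr (x : H k g) : flip k g (inr x) = inl x := by
  ext n; rw [coeff_flip, coeff_inl, coeff_inr, TensorProduct.comm_tmul]

theorem flip_comul (x : H k g) : flip k g (comul x) = comul x := by
  ext n; rw [coeff_flip, coeff_comul, comm_comul₀]

theorem flip_tmulSelf (x : H k g) : flip k g (tmulSelf x) = tmulSelf x := by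
  rw [tmulSelf, map_mul, flip_inl, flip_inr, (inl_inr_commute x x).eq]

theorem flip_tensorMap (f : H k g →ₐ[k⟦X⟧] H k g) (T : H2 k g) :
    flip k g (tensorMap f f T) = tensorMap f f (flip k g T) := by
  have h : (flip k g).comp (tensorMap f f) = (tensorMap f f).comp (flip k g) := by
    refine tensor_ext ?_ ?_
    · ext1 x; simp [tensorMap_inl, tensorMap_inr, flip_inl]
    · ext1 x; simp [tensorMap_inl, tensorMap_inr, flip_inr]
  exact DFunLike.congr_fun h T

end Flip

/-! ### The invariant twists `exp(h X)` -/

section ExpTwist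

variable {k g : Type*} [Field k] [LieRing g] [LieAlgebra k g]

attribute [local instance] LieRing.ofAssociativeRing

local notation "ιU" => (UniversalEnvelopingAlgebra.ι k : g →ₗ⁅k⁆ U k g)

local notation "τU" => TensorProduct.comm k (U k g) (U k g)

variable (k g) in
/-- `a ⊗ b ↦ a ⊗ 1 ⊗ b`. -/
def oneThree₀ : U k g ⊗[k] U k g →ₐ[k] U k g ⊗[k] (U k g ⊗[k] U k g) :=
  Algebra.TensorProduct.map (AlgHom.id k _) Algebra.TensorProduct.includeRight

theorem oneThree₀_tmul (a b : U k g) : oneThree₀ k g (a ⊗ₜ b) = a ⊗ₜ (1 ⊗ₜ b) := rfl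

/-- As elements of g are primitive, (Δ ⊗ I)X = X₁₃ + X₂₃. With the mirror formula this makes both
sides of the cocycle condition for exp(hX) exponentials of X₁₂ + X₁₃ + X₂₃. -/
theorem comulLeft₀_ιι (t : g ⊗[k] g) : comulLeft₀ k g (ιι k g t) =
    oneThree₀ k g (ιι k g t) + oneTmul₀ k g (ιι k g t) := by
  induction t with
  | zero => simp
  | tmul x y =>
    rw [ιι_tmul, comulLeft₀_tmul, comul₀_ι, TensorProduct.add_tmul, map_add, oneThree₀_tmul,
      oneTmul₀_apply]
    rfl
  | add s t hs ht => simp only [map_add, hs, ht]; abel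

theorem comulRight₀_ιι (t : g ⊗[k] g) : comulRight₀ k g (ιι k g t) =
    tmulOne₀ k g (ιι k g t) + oneThree₀ k g (ιι k g t) := by
  induction t with
  | zero => simp
  | tmul x y =>
    rw [ιι_tmul, comulRight₀_tmul, comul₀_ι, TensorProduct.tmul_add, oneThree₀_tmul,
      tmulOne₀_tmul]
  | add s t hs ht => simp only [map_add, hs, ht]; abel

/-- The image of Δ ⊗ I is spanned by products of Δ(a) ⊗ 1 and 1 ⊗ 1 ⊗ b, and F ⊗ 1 commutes with
each of them. -/
theorem tmulOne₀_commute_comulLeft₀ {F : U k g ⊗[k] U k g} (h : ∀ u, Commute F (comul₀ k g u))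
    (G : U k g ⊗[k] U k g) : Commute (tmulOne₀ k g F) (comulLeft₀ k g G) := by
  induction G with
  | zero => rw [map_zero]; exact Commute.zero_right _
  | tmul a b =>
    have h1 : ∀ t : U k g ⊗[k] U k g, TensorProduct.assoc k _ _ _ (t ⊗ₜ b) =
        tmulOne₀ k g t * (1 ⊗ₜ (1 ⊗ₜ b)) := by
      intro t
      induction t with
      | zero => simp
      | tmul c d =>
        rw [tmulOne₀_tmul, TensorProduct.assoc_tmul, Algebra.TensorProduct.tmul_mul_tmul,
          Algebra.TensorProduct.tmul_mul_tmul, mul_one, mul_one, one_mul]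
      | add s t hs ht => rw [TensorProduct.add_tmul, map_add, map_add, hs, ht, add_mul]
    have h2 : ∀ t : U k g ⊗[k] U k g, Commute (tmulOne₀ k g t)
        ((1 : U k g) ⊗ₜ[k] ((1 : U k g) ⊗ₜ[k] b)) := by
      intro t
      induction t with
      | zero => rw [map_zero]; exact Commute.zero_left _
      | tmul c d =>
        change _ * _ = _ * _
        rw [tmulOne₀_tmul, Algebra.TensorProduct.tmul_mul_tmul,
          Algebra.TensorProduct.tmul_mul_tmul, Algebra.TensorProduct.tmul_mul_tmul,
          Algebra.TensorProduct.tmul_mul_tmul, mul_one, mul_one, one_mul, one_mul, one_mul, mul_one]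
      | add s t hs ht => rw [map_add]; exact hs.add_left ht
    rw [comulLeft₀_tmul, h1]
    exact ((h a).map (tmulOne₀ k g)).mul_right (h2 F)
  | add s t hs ht => rw [map_add]; exact hs.add_right ht

theorem oneTmul₀_commute_comulRight₀ {F : U k g ⊗[k] U k g} (h : ∀ u, Commute F (comul₀ k g u))
    (G : U k g ⊗[k] U k g) : Commute (oneTmul₀ k g F) (comulRight₀ k g G) := by
  induction G with
  | zero => rw [map_zero]; exact Commute.zero_right _
  | tmul a b =>
    change _ * _ = _ * _
    rw [oneTmul₀_apply, comulRight₀_tmul, Algebra.TensorProduct.tmul_mul_tmul,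
      Algebra.TensorProduct.tmul_mul_tmul, (h b).eq, one_mul, mul_one]
  | add s t hs ht => rw [map_add]; exact hs.add_right ht

theorem InvSkewSeries.coeff_toH2 (x : InvSkewSeries k g) (n : ℕ) :
    PowerSeries.coeff n x.toH2 = ιι k g (x n) := PowerSeries.coeff_mk _ _

theorem InvSkewSeries.toH2_add (x y : InvSkewSeries k g) :
    InvSkewSeries.toH2 (x + y) = x.toH2 + y.toH2 := by
  ext n
  rw [map_add, coeff_toH2, coeff_toH2, coeff_toH2, ← map_add]
  rfl

theorem InvSkewSeries.toH2_neg (x : InvSkewSeries k g) :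
    InvSkewSeries.toH2 (-x) = -x.toH2 := by
  ext n
  rw [map_neg, coeff_toH2, coeff_toH2, ← map_neg]
  rfl

theorem InvSkewSeries.toH2_zero : InvSkewSeries.toH2 (0 : InvSkewSeries k g) = 0 := by
  ext n
  rw [map_zero, coeff_toH2]
  exact map_zero _

theorem counitLeft_toH2 (x : InvSkewSeries k g) : counitLeft x.toH2 = 0 := by
  ext n
  rw [map_zero]
  refine Eq.trans ?_ (counitLeft₀_ιι (x n : g ⊗[k] g))
  rw [← InvSkewSeries.coeff_toH2]
  rfl

theorem counitRight_toH2 (x : InvSkewSeries k g) : counitRight x.toH2 = 0 := by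
  ext n
  rw [map_zero]
  refine Eq.trans ?_ (counitRight₀_ιι (x n : g ⊗[k] g))
  rw [← InvSkewSeries.coeff_toH2]
  rfl

variable (k g) in
/-- `a ⊗ b ↦ a ⊗ 1 ⊗ b` on `H ⊗ H`. -/
def oneThree : H2 k g →ₐ[k⟦X⟧] H3 k g := coeffwise (oneThree₀ k g)

theorem comulLeft_toH2 (x : InvSkewSeries k g) :
    comulLeft x.toH2 = oneThree k g x.toH2 + oneTmul x.toH2 := by
  ext n
  rw [map_add]
  have h := comulLeft₀_ιι (x n : g ⊗[k] g)
  rw [← InvSkewSeries.coeff_toH2] at h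
  exact h

theorem comulRight_toH2 (x : InvSkewSeries k g) :
    comulRight x.toH2 = tmulOne x.toH2 + oneThree k g x.toH2 := by
  ext n
  rw [map_add]
  have h := comulRight₀_ιι (x n : g ⊗[k] g)
  rw [← InvSkewSeries.coeff_toH2] at h
  exact h

theorem commute_comul₀_of_ι {F : U k g ⊗[k] U k g} (h : ∀ x, Commute F (comul₀ k g (ιU x)))
    (u : U k g) : Commute F (comul₀ k g u) := commute_of_commute_ι (comul₀ k g) h u

theorem cobound_add (a b : U k g) : cobound (a + b) = cobound a + cobound b := by
  rw [cobound, cobound, cobound, map_add, TensorProduct.add_tmul, TensorProduct.tmul_add]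
  abel

theorem cobound_sum {ι : Type*} (s : Finset ι) (z : ι → U k g) :
    cobound (∑ i ∈ s, z i) = ∑ i ∈ s, cobound (z i) :=
  map_sum (AddMonoidHom.mk' (cobound (k := k) (g := g)) cobound_add) z s

theorem gaugeClass_eq_iff {T S : TwistedAut k g} : gaugeClass T = gaugeClass S ↔
    TwistedEnd.GaugeIso (T : TwistedEnd k g) (S : TwistedEnd k g) := Con.eq (gaugeCon k g)

theorem gaugeClass_mul (T S : TwistedAut k g) :
    gaugeClass (T * S) = gaugeClass T * gaugeClass S := rfl

variable [CharZero k]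

theorem ιι_commute_comul₀ (t : invSkew k g) (u : U k g) :
    Commute (ιι k g (t : g ⊗[k] g)) (comul₀ k g u) :=
  commute_comul₀_of_ι ((mem_invSkew_iff _).1 t.2).2 u

theorem comm_ιι_invSkew (t : invSkew k g) :
    τU (ιι k g (t : g ⊗[k] g)) = -ιι k g (t : g ⊗[k] g) := ((mem_invSkew_iff _).1 t.2).1

theorem InvSkewSeries.toH2_injective :
    Function.Injective (InvSkewSeries.toH2 : InvSkewSeries k g → H2 k g) := by
  intro x y h
  funext n
  have h1 := congrArg (PowerSeries.coeff n) h
  rw [coeff_toH2, coeff_toH2] at h1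
  exact Subtype.ext (ιι_injective h1)

theorem toH2_commute_comul (x : InvSkewSeries k g) (y : H k g) : Commute x.toH2 (comul y) :=
  commute_of_coeff fun i j => by
    rw [InvSkewSeries.coeff_toH2, coeff_comul]
    exact ιι_commute_comul₀ _ _

theorem flip_toH2 (x : InvSkewSeries k g) : flip k g x.toH2 = -x.toH2 := by
  ext n
  rw [map_neg, coeff_flip, InvSkewSeries.coeff_toH2, comm_ιι_invSkew]

/-- A characterisation of the series in the image of `toH2`. -/
theorem exists_toH2 {T : H2 k g} (h1 : ∀ n, ∃ t, PowerSeries.coeff n T = ιι k g t)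
    (h2 : flip k g T = -T) (h3 : ∀ y : H k g, Commute T (comul y)) :
    ∃ x : InvSkewSeries k g, x.toH2 = T := by
  choose t ht using h1
  have hmem : ∀ n, t n ∈ invSkew k g := fun n => by
    refine (mem_invSkew_iff _).2 ⟨?_, fun x => ?_⟩
    · have h := congrArg (PowerSeries.coeff n) h2
      rwa [map_neg, coeff_flip, ht] at h
    · have h := h3 (PowerSeries.C (ιU x))
      rw [comul, coeffwise_C] at h
      rw [← ht]
      exact commute_coeff_of_commute_C h n
  refine ⟨fun n => ⟨t n, hmem n⟩, ?_⟩
  ext n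
  rw [InvSkewSeries.coeff_toH2, ht]

theorem tmulOne_toH2_commute (x : InvSkewSeries k g) (T : H2 k g) :
    Commute (tmulOne x.toH2) (comulLeft T) :=
  commute_of_coeff fun i j => tmulOne₀_commute_comulLeft₀ (F := PowerSeries.coeff i x.toH2)
    (fun u => by rw [InvSkewSeries.coeff_toH2]; exact ιι_commute_comul₀ _ u) (PowerSeries.coeff j T)

theorem oneTmul_toH2_commute (x : InvSkewSeries k g) (T : H2 k g) :
    Commute (oneTmul x.toH2) (comulRight T) :=
  commute_of_coeff fun i j => oneTmul₀_commute_comulRight₀ (F := PowerSeries.coeff i x.toH2)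
    (fun u => by rw [InvSkewSeries.coeff_toH2]; exact ιι_commute_comul₀ _ u) (PowerSeries.coeff j T)

/-- The invariant twist `(1, exp(h X))`, as a twisted endomorphism. -/
def expTwistEnd (x : InvSkewSeries k g) : TwistedEnd k g where
  hom := AlgHom.id _ _
  twist := ⟨hexp k x.toH2, hexp k (-x.toH2), hexp_mul_hexp_neg k _, hexp_neg_mul_hexp k _⟩
  conj y := by
    rw [tensorMap_id, AlgHom.id_apply, AlgHom.id_apply]
    exact hexp_commute k (toH2_commute_comul x y)
  cocycle := by
    change tmulOne (hexp k x.toH2) * comulLeft (hexp k x.toH2) =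
      oneTmul (hexp k x.toH2) * comulRight (hexp k x.toH2)
    -- Invariance makes X₁₂ commute with X₁₃ + X₂₃, and X₂₃ with X₁₂ + X₁₃, so each product of
    -- exponentials is the exponential of a sum.
    rw [map_hexp, map_hexp, map_hexp, map_hexp, ← hexp_add k (tmulOne_toH2_commute x _),
      ← hexp_add k (oneTmul_toH2_commute x _), comulLeft_toH2, comulRight_toH2]
    congr 1
    abel
  norm_left := by
    change counitLeft (hexp k x.toH2) = 1
    rw [map_hexp, counitLeft_toH2, hexp_zero]
  norm_right := by
    change counitRight (hexp k x.toH2) = 1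
    rw [map_hexp, counitRight_toH2, hexp_zero]

theorem expTwistEnd_twist (x : InvSkewSeries k g) :
    ((expTwistEnd x).twist : H2 k g) = hexp k x.toH2 := rfl

theorem expTwistEnd_mul_twist (x y : InvSkewSeries k g) :
    ((expTwistEnd x * expTwistEnd y).twist : H2 k g) = hexp k y.toH2 * hexp k x.toH2 := by
  rw [TwistedEnd.mul_twist]
  change tensorMap (AlgHom.id _ _) (AlgHom.id _ _) _ * _ = _
  rw [tensorMap_id]
  rfl

theorem expTwistEnd_mul_neg (x : InvSkewSeries k g) : expTwistEnd x * expTwistEnd (-x) = 1 := by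
  refine TwistedEnd.ext rfl (Units.ext ?_)
  rw [expTwistEnd_mul_twist, InvSkewSeries.toH2_neg, hexp_neg_mul_hexp]
  rfl

/-- The invariant twist `(1, exp(h X))`. -/
def expTwist (x : InvSkewSeries k g) : TwistedAut k g where
  val := expTwistEnd x
  inv := expTwistEnd (-x)
  val_inv := expTwistEnd_mul_neg x
  inv_val := by
    have h := expTwistEnd_mul_neg (-x)
    rwa [neg_neg] at h

theorem expTwist_mem (x : InvSkewSeries k g) : expTwist x ∈ invariantTwists k g :=
  MonoidHom.mem_ker.2 (Units.ext rfl)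

/-! ### Commutators of invariant skew-symmetric tensors -/

/-- The letters a, b, c stand for s₁₂, s₁₃, s₂₃ and the primed ones for the same components of t;
the hypotheses are the four commutation relations that invariance provides. -/
theorem commutator_aux {R : Type*} [Ring R] {a b c a' b' c' : R}
    (e1 : a * (b' + c') = (b' + c') * a) (e2 : a' * (b + c) = (b + c) * a')
    (e3 : c * (a' + b') = (a' + b') * c) (e4 : c' * (a + b) = (a + b) * c') :
    a * a' - a' * a + ((b + c) * (b' + c') - (b' + c') * (b + c)) =
      c * c' - c' * c + ((a + b) * (a' + b') - (a' + b') * (a + b)) := by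
  rw [← sub_eq_zero] at e1 e2 e3 e4 ⊢
  have h : a * a' - a' * a + ((b + c) * (b' + c') - (b' + c') * (b + c)) -
      (c * c' - c' * c + ((a + b) * (a' + b') - (a' + b') * (a + b))) =
      (c * (a' + b') - (a' + b') * c) + (a' * (b + c) - (b + c) * a') -
      (c' * (a + b) - (a + b) * c') - (a * (b' + c') - (b' + c') * a) := by
    simp only [mul_add, add_mul]
    abel
  rw [h, e1, e2, e3, e4]
  simp

theorem isCocycle_commutator (s t : invSkew k g) :
    IsCocycle (ιι k g s * ιι k g t - ιι k g t * ιι k g (s : g ⊗[k] g)) := by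
  have r1 := tmulOne₀_commute_comulLeft₀ (ιι_commute_comul₀ s) (ιι k g t)
  have r2 := tmulOne₀_commute_comulLeft₀ (ιι_commute_comul₀ t) (ιι k g s)
  have r3 := oneTmul₀_commute_comulRight₀ (ιι_commute_comul₀ s) (ιι k g t)
  have r4 := oneTmul₀_commute_comulRight₀ (ιι_commute_comul₀ t) (ιι k g s)
  rw [comulLeft₀_ιι] at r1 r2
  rw [comulRight₀_ιι] at r3 r4
  rw [IsCocycle]
  simp only [map_sub, map_mul, comulLeft₀_ιι, comulRight₀_ιι]
  exact commutator_aux r1.eq r2.eq r3.eq r4.eq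

/-- Commutators of invariant skew-symmetric tensors are coboundaries of central elements. -/
theorem exists_cobound_eq_commutator (s t : invSkew k g) : ∃ z : U k g, (∀ u, Commute z u) ∧
    cobound z = ιι k g s * ιι k g t - ιι k g t * ιι k g (s : g ⊗[k] g) := by
  set F := ιι k g s * ιι k g t - ιι k g t * ιι k g (s : g ⊗[k] g) with hF
  -- The flip negates both tensors and so fixes their commutator; a symmetric cocycle has no skew
  -- part and is a pure coboundary.
  have hτ : τU F = F := by
    rw [hF, map_sub, comm_mul, comm_mul, comm_ιι_invSkew, comm_ιι_invSkew, neg_mul_neg,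
      neg_mul_neg]
  obtain ⟨y, a, h1, h2, -, h4⟩ := (isCocycle_commutator s t).exists_decomposition
    (by rw [map_sub, map_mul, map_mul, counitLeft₀_ιι, counitLeft₀_ιι, zero_mul, sub_zero])
    (by rw [map_sub, map_mul, map_mul, counitRight₀_ιι, counitRight₀_ιι, zero_mul, sub_zero])
  rw [← hF] at h1 h4
  have hy : ιι k g y = 0 := by
    rw [h1, map_add, comm_cobound, h2] at hτ
    have h5 : (2 : k) • ιι k g y = 0 := by
      rw [two_smul]
      have := add_right_cancel hτ
      nth_rewrite 1 [← this]
      exact neg_add_cancel _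
    exact (smul_eq_zero.1 h5).resolve_left two_ne_zero
  refine ⟨a, h4 fun x => ?_, ?_⟩
  · have c1 := ιι_commute_comul₀ s (ιU x)
    have c2 := ιι_commute_comul₀ t (ιU x)
    exact (c1.mul_left c2).sub_left (c2.mul_left c1)
  · rw [h1, hy, zero_add]

theorem exists_comul_eq_commutator (x y : InvSkewSeries k g) : ∃ z : H k g, (∀ u, Commute z u) ∧
    comul z - inl z - inr z = x.toH2 * y.toH2 - y.toH2 * x.toH2 := by
  choose z hz hz' using fun i j => exists_cobound_eq_commutator (x i) (y j)
  refine ⟨PowerSeries.mk fun n => ∑ p ∈ Finset.HasAntidiagonal.antidiagonal n, z p.1 p.2,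
    fun u => commute_of_coeff fun i j => ?_, ?_⟩
  · rw [PowerSeries.coeff_mk]
    exact Commute.sum_left _ _ _ fun p _ => hz _ _ _
  · ext n
    rw [map_sub, map_sub, coeff_comul, coeff_inl, coeff_inr, PowerSeries.coeff_mk, map_sub,
      PowerSeries.coeff_mul, PowerSeries.coeff_mul, ← Finset.Nat.sum_antidiagonal_swap (n := n)
        (f := fun p => PowerSeries.coeff p.1 y.toH2 * PowerSeries.coeff p.2 x.toH2),
      ← Finset.sum_sub_distrib]
    refine (cobound_sum _ _).trans (Finset.sum_congr rfl fun p _ => ?_)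
    rw [hz', InvSkewSeries.coeff_toH2, InvSkewSeries.coeff_toH2]
    simp only [Prod.fst_swap, Prod.snd_swap, InvSkewSeries.coeff_toH2]

/-- The commutator C = Δ(z) - z ⊗ 1 - 1 ⊗ z with z central commutes with both tensors, so
exp(hY)exp(hX) = exp(h(X + Y))exp(h²C/2). The last factor is Δ(a)(a ⊗ a)⁻¹ for the central element a
= exp(h²z/2), which is the required gauge transformation. -/
theorem expTwist_mul_gaugeIso (x y : InvSkewSeries k g) :
    TwistedEnd.GaugeIso (expTwistEnd x * expTwistEnd y) (expTwistEnd (x + y)) := by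
  -- Composition puts the twist of the left factor on the right, so the relevant commutator is [Y,
  -- X].
  obtain ⟨z, hz, hC⟩ := exists_comul_eq_commutator y x
  set C := comul z - inl z - inr z with hCdef
  have hcomm : ∀ v : InvSkewSeries k g, Commute v.toH2 C := fun v =>
    ((toH2_commute_comul v z).sub_right (inl_central hz _).symm).sub_right (inr_central hz _).symm
  have hprod := hexp_mul_hexp k (X := y.toH2) (Y := x.toH2) (C := C) (by rw [hC]; abel)
    (hcomm y) (hcomm x)
  set w : H k g := PowerSeries.X * ((2 : k)⁻¹ • z) with hw
  have hwc : ∀ u, Commute w u := fun u =>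
    (PowerSeries.commute_X u).symm.mul_left ((hz u).smul_left _)
  set D : H2 k g := PowerSeries.X * ((2 : k)⁻¹ • C) with hD
  have hDw : comul w = D + (inl w + inr w) := by
    rw [hw, algHom_X_mul, algHom_X_mul, algHom_X_mul, algHom_smul_const, algHom_smul_const,
      algHom_smul_const, hD, ← mul_add, ← mul_add, ← smul_add, ← smul_add, hCdef]
    congr 2
    abel
  have hca : ∀ u, Commute (hexp k w) u := fun u => hexp_commute k (hwc u)
  have ht : tmulSelf (hexp k w) = hexp k (inl w + inr w : H2 k g) := by
    rw [tmulSelf, map_hexp, map_hexp, hexp_add k (inl_inr_commute w w)]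
  have hΔ : comul (hexp k w) = hexp k D * tmulSelf (hexp k w) := by
    rw [ht, map_hexp, hDw, hexp_add k
      ((inl_central hwc D).symm.add_right (inr_central hwc D).symm)]
  refine ⟨⟨hexp k w, hexp k (-w), hexp_mul_hexp_neg k _, hexp_neg_mul_hexp k _⟩,
    fun u => hca u, ?_⟩
  change ((expTwistEnd (x + y)).twist : H2 k g) * comul (hexp k w) = tmulSelf (hexp k w) * _
  rw [hΔ, expTwistEnd_mul_twist, hprod, expTwistEnd_twist, InvSkewSeries.toH2_add, add_comm y.toH2,
    (tmulSelf_central hca _).eq, mul_assoc]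

theorem gaugeClass_expTwist_add (x y : InvSkewSeries k g) :
    gaugeClass (expTwist (x + y)) = gaugeClass (expTwist x) * gaugeClass (expTwist y) := by
  rw [← gaugeClass_mul, gaugeClass_eq_iff]
  exact TwistedEnd.GaugeIso.symm (expTwist_mul_gaugeIso x y)

end ExpTwist

/-! ### Lowest order terms -/

section LowestOrder

variable {k : Type*} [Field k] {A : Type*} [Ring A] [Algebra k A]

theorem coeff_mul_of_eqMod_one {n : ℕ} (hn : 0 < n) {S : A⟦X⟧} (hS : EqMod n S 1) (T : A⟦X⟧) :
    PowerSeries.coeff n (S * T) =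
      PowerSeries.coeff n T + PowerSeries.coeff n S * PowerSeries.coeff 0 T := by
  obtain ⟨R, rfl⟩ := hS.exists_eq
  rw [add_mul, one_mul, map_add, map_add, mul_assoc, PowerSeries.coeff_X_pow_mul', if_pos le_rfl,
    PowerSeries.coeff_X_pow_mul', if_pos le_rfl, Nat.sub_self, coeff_zero_mul',
    PowerSeries.coeff_one, if_neg hn.ne', zero_add]

theorem coeff_mul_of_eqMod_one_right {n : ℕ} (hn : 0 < n) {S : A⟦X⟧} (hS : EqMod n S 1)
    (T : A⟦X⟧) : PowerSeries.coeff n (T * S) =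
      PowerSeries.coeff n T + PowerSeries.coeff 0 T * PowerSeries.coeff n S := by
  obtain ⟨R, rfl⟩ := hS.exists_eq
  rw [mul_add, mul_one, map_add, map_add, ← mul_assoc, ((PowerSeries.commute_X T).pow_right n).eq,
    mul_assoc, PowerSeries.coeff_X_pow_mul', if_pos le_rfl,
    PowerSeries.coeff_X_pow_mul', if_pos le_rfl, Nat.sub_self, coeff_zero_mul',
    PowerSeries.coeff_one, if_neg hn.ne', zero_add]

theorem EqMod.coeff_zero {n : ℕ} (hn : 0 < n) {S : A⟦X⟧} (hS : EqMod n S 1) :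
    PowerSeries.coeff 0 S = 1 := by
  rw [hS 0 hn, PowerSeries.coeff_zero_one]

theorem EqMod.succ {n : ℕ} {S T : A⟦X⟧} (h : EqMod n S T)
    (h' : PowerSeries.coeff n S = PowerSeries.coeff n T) : EqMod (n + 1) S T := fun i hi => by
  rcases Nat.lt_succ_iff_lt_or_eq.1 hi with h1 | rfl
  · exact h i h1
  · exact h'

theorem EqMod.hexp {n : ℕ} {S T : A⟦X⟧} (h : EqMod n S T) :
    EqMod (n + 1) (hexp k S) (hexp k T) := by
  obtain ⟨R, rfl⟩ := h.exists_eq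
  exact ((hexp_add_X_pow_mul k T R n).mono (by omega)).trans (eqMod_add_X_pow_mul _ _ _)

theorem isUnit_of_coeff_zero_eq_one {S : A⟦X⟧} (h : PowerSeries.coeff 0 S = 1) : IsUnit S := by
  rw [PowerSeries.isUnit_iff_constantCoeff, ← PowerSeries.coeff_zero_eq_constantCoeff_apply, h]
  exact isUnit_one

end LowestOrder

/-! ### Gauge transforms -/

section GaugeTransform

variable {k g : Type*} [Field k] [LieRing g] [LieAlgebra k g]

attribute [local instance] LieRing.ofAssociativeRing

local notation "ιU" => (UniversalEnvelopingAlgebra.ι k : g →ₗ⁅k⁆ U k g)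

local notation "τU" => TensorProduct.comm k (U k g) (U k g)

theorem comulLeft_comul (x : H k g) : comulLeft (comul x) = comulRight (comul x) := by
  have h : (comulLeft₀ k g).comp (comul₀ k g) = (comulRight₀ k g).comp (comul₀ k g) :=
    algHom_ext_ι fun y => by
      rw [AlgHom.comp_apply, AlgHom.comp_apply, comul₀_ι, map_add, map_add, comulLeft₀_tmul,
        comulLeft₀_tmul, comulRight₀_tmul, comulRight₀_tmul, comul₀_ι, map_one,
        Algebra.TensorProduct.one_def, TensorProduct.add_tmul, map_add, TensorProduct.tmul_add,
        TensorProduct.assoc_tmul, TensorProduct.assoc_tmul, TensorProduct.assoc_tmul, add_assoc]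
  ext n
  exact DFunLike.congr_fun h (PowerSeries.coeff n x)

theorem counitRight_flip (T : H2 k g) : counitRight (flip k g T) = counitLeft T := by
  ext n
  exact counitRight₀_comm (PowerSeries.coeff n T)

theorem counitRight_comul (x : H k g) : counitRight (comul x) = x := by
  rw [← flip_comul, counitRight_flip, counitLeft_comul]

theorem tmulSelf_mul_inv (a : (H k g)ˣ) :
    tmulSelf (a : H k g) * tmulSelf ((a⁻¹ : (H k g)ˣ) : H k g) = 1 := by
  rw [← tmulSelf_mul, Units.mul_inv, tmulSelf_one]

theorem tmulSelf_inv_mul (a : (H k g)ˣ) :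
    tmulSelf ((a⁻¹ : (H k g)ˣ) : H k g) * tmulSelf (a : H k g) = 1 := by
  rw [← tmulSelf_mul, Units.inv_mul, tmulSelf_one]

theorem comul_mul_inv (a : (H k g)ˣ) :
    comul (a : H k g) * comul ((a⁻¹ : (H k g)ˣ) : H k g) = 1 := by
  rw [← map_mul, Units.mul_inv, map_one]

theorem comul_inv_mul (a : (H k g)ˣ) :
    comul ((a⁻¹ : (H k g)ˣ) : H k g) * comul (a : H k g) = 1 := by
  rw [← map_mul, Units.inv_mul, map_one]

theorem tensorMap_conjHom_comp (a : (H k g)ˣ) (f : H k g →ₐ[k⟦X⟧] H k g) (Z : H2 k g) :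
    tensorMap ((conjHom a).comp f) ((conjHom a).comp f) Z =
      tmulSelf (a : H k g) * tensorMap f f Z * tmulSelf ((a⁻¹ : (H k g)ˣ) : H k g) := by
  let c : (H2 k g)ˣ := ⟨tmulSelf (a : H k g), tmulSelf ((a⁻¹ : (H k g)ˣ) : H k g),
    tmulSelf_mul_inv a, tmulSelf_inv_mul a⟩
  have h : tensorMap ((conjHom a).comp f) ((conjHom a).comp f) =
      (conjHom c).comp (tensorMap f f) := by
    refine tensor_ext ?_ ?_
    · ext1 x
      change tensorMap ((conjHom a).comp f) ((conjHom a).comp f) (inl x) =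
        (c : H2 k g) * tensorMap f f (inl x) * (c⁻¹ : (H2 k g)ˣ)
      rw [tensorMap_inl, tensorMap_inl, Units.eq_mul_inv_iff_mul_eq]
      change inl ((a : H k g) * f x * ((a⁻¹ : (H k g)ˣ) : H k g)) * (inl (a : H k g) * inr (a : H k g)) =
        inl (a : H k g) * inr (a : H k g) * inl (f x)
      rw [mul_assoc (inl (a : H k g)), ← (inl_inr_commute (f x) (a : H k g)).eq, ← mul_assoc,
        ← map_mul, ← mul_assoc, ← map_mul, mul_assoc, Units.inv_mul, mul_one]
    · ext1 x
      change tensorMap ((conjHom a).comp f) ((conjHom a).comp f) (inr x) =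
        (c : H2 k g) * tensorMap f f (inr x) * (c⁻¹ : (H2 k g)ˣ)
      rw [tensorMap_inr, tensorMap_inr, Units.eq_mul_inv_iff_mul_eq]
      change inr ((a : H k g) * f x * ((a⁻¹ : (H k g)ˣ) : H k g)) * (inl (a : H k g) * inr (a : H k g)) =
        inl (a : H k g) * inr (a : H k g) * inr (f x)
      rw [← mul_assoc, ← (inl_inr_commute (a : H k g) _).eq, mul_assoc, ← map_mul,
        mul_assoc _ _ (a : H k g), Units.inv_mul, mul_one, map_mul, mul_assoc]
  exact DFunLike.congr_fun h Z

theorem comulLeft_tmulSelf (a : H k g) :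
    comulLeft (tmulSelf a) = tmulOne (comul a) * (inr (inr a : H2 k g) : H3 k g) := by
  rw [tmulSelf, map_mul, comulLeft_inl, comulLeft_inr]

theorem comulRight_tmulSelf (a : H k g) :
    comulRight (tmulSelf a) = oneTmul (comul a) * (inl a : H3 k g) := by
  rw [tmulSelf, map_mul, comulRight_inl, comulRight_inr]
  exact inl_inr_commute _ _

theorem tmulOne_tmulSelf_mul (a : H k g) :
    tmulOne (tmulSelf a) * (inr (inr a : H2 k g) : H3 k g) = oneTmul (tmulSelf a) * inl a := by
  rw [tmulSelf, map_mul, tmulOne_inl, tmulOne_inr, mul_assoc, ← map_mul]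
  exact inl_inr_commute _ _

/-- The transform of a twisted endomorphism under a gauge transformation with `ε(a) = 1`. -/
def TwistedEnd.gaugeBy (T : TwistedEnd k g) (a : (H k g)ˣ) (ha : counit (a : H k g) = 1) :
    TwistedEnd k g where
  hom := (conjHom a).comp T.hom
  twist := ⟨tmulSelf (a : H k g), tmulSelf ((a⁻¹ : (H k g)ˣ) : H k g),
    tmulSelf_mul_inv a, tmulSelf_inv_mul a⟩ * T.twist *
    ⟨comul ((a⁻¹ : (H k g)ˣ) : H k g), comul (a : H k g), comul_inv_mul a, comul_mul_inv a⟩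
  conj x := by
    change tmulSelf (a : H k g) * (T.twist : H2 k g) * comul ((a⁻¹ : (H k g)ˣ) : H k g) *
      comul ((a : H k g) * T.hom x * ((a⁻¹ : (H k g)ˣ) : H k g)) =
      tensorMap ((conjHom a).comp T.hom) ((conjHom a).comp T.hom) (comul x) *
        (tmulSelf (a : H k g) * (T.twist : H2 k g) * comul ((a⁻¹ : (H k g)ˣ) : H k g))
    rw [tensorMap_conjHom_comp, mul_assoc _ (tmulSelf ((a⁻¹ : (H k g)ˣ) : H k g)),
      ← mul_assoc (tmulSelf ((a⁻¹ : (H k g)ˣ) : H k g)),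
      ← mul_assoc (tmulSelf ((a⁻¹ : (H k g)ˣ) : H k g)), tmulSelf_inv_mul, one_mul,
      ← mul_assoc (tmulSelf (a : H k g) * _), mul_assoc (tmulSelf (a : H k g)) _ (T.twist : H2 k g),
      ← T.conj, mul_assoc _ (comul ((a⁻¹ : (H k g)ˣ) : H k g)), ← map_mul, mul_assoc (a : H k g),
      Units.inv_mul_cancel_left, map_mul]
    simp only [mul_assoc]
  cocycle := by
    change tmulOne (tmulSelf (a : H k g) * (T.twist : H2 k g) * comul ((a⁻¹ : (H k g)ˣ) : H k g)) *
      comulLeft (tmulSelf (a : H k g) * (T.twist : H2 k g) * comul ((a⁻¹ : (H k g)ˣ) : H k g)) =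
      oneTmul (tmulSelf (a : H k g) * (T.twist : H2 k g) * comul ((a⁻¹ : (H k g)ˣ) : H k g)) *
      comulRight (tmulSelf (a : H k g) * (T.twist : H2 k g) * comul ((a⁻¹ : (H k g)ˣ) : H k g))
    have hl : tmulOne (comul ((a⁻¹ : (H k g)ˣ) : H k g)) * tmulOne (comul (a : H k g)) = 1 := by
      rw [← map_mul, comul_inv_mul, map_one]
    have hr : oneTmul (comul ((a⁻¹ : (H k g)ˣ) : H k g)) * oneTmul (comul (a : H k g)) = 1 := by
      rw [← map_mul, comul_inv_mul, map_one]
    have hc : Commute (oneTmul (T.twist : H2 k g)) (inl (a : H k g) : H3 k g) :=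
      (inl_inr_commute _ _).symm
    simp only [map_mul, comulLeft_tmulSelf, comulRight_tmulSelf, comulLeft_comul]
    -- The factor Δ(a⁻¹) ⊗ 1 cancels the Δ(a) ⊗ 1 contained in (Δ ⊗ I)(a ⊗ a), and likewise for I ⊗
    -- Δ; what remains on both sides is a ⊗ a ⊗ a times the cocycle identity for F.
    calc _ = tmulOne (tmulSelf (a : H k g)) * (tmulOne (T.twist : H2 k g) *
          ((tmulOne (comul ((a⁻¹ : (H k g)ˣ) : H k g)) * tmulOne (comul (a : H k g))) *
          inr (inr (a : H k g)))) * comulLeft (T.twist : H2 k g) *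
          comulRight (comul ((a⁻¹ : (H k g)ˣ) : H k g)) := by simp only [mul_assoc]
      _ = (tmulOne (tmulSelf (a : H k g)) * inr (inr (a : H k g))) *
          (tmulOne (T.twist : H2 k g) * comulLeft (T.twist : H2 k g)) *
          comulRight (comul ((a⁻¹ : (H k g)ˣ) : H k g)) := by
        rw [hl, one_mul, (tmulOne_commute _ _).eq]; simp only [mul_assoc]
      _ = oneTmul (tmulSelf (a : H k g)) * (inl (a : H k g) * oneTmul (T.twist : H2 k g)) *
          comulRight (T.twist : H2 k g) *
          comulRight (comul ((a⁻¹ : (H k g)ˣ) : H k g)) := by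
        rw [tmulOne_tmulSelf_mul, T.cocycle]; simp only [mul_assoc]
      _ = oneTmul (tmulSelf (a : H k g)) * (oneTmul (T.twist : H2 k g) *
          ((oneTmul (comul ((a⁻¹ : (H k g)ˣ) : H k g)) * oneTmul (comul (a : H k g))) *
          inl (a : H k g))) * comulRight (T.twist : H2 k g) *
          comulRight (comul ((a⁻¹ : (H k g)ˣ) : H k g)) := by
        rw [hr, one_mul, hc.eq]
      _ = _ := by simp only [mul_assoc]
  norm_left := by
    change counitLeft (tmulSelf (a : H k g) * (T.twist : H2 k g) * comul ((a⁻¹ : (H k g)ˣ) : H k g)) = 1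
    rw [map_mul, map_mul, T.norm_left, mul_one, counitLeft_comul, tmulSelf, map_mul,
      counitLeft_inl, counitLeft_inr, ha, map_one, one_mul, Units.mul_inv]
  norm_right := by
    change counitRight (tmulSelf (a : H k g) * (T.twist : H2 k g) * comul ((a⁻¹ : (H k g)ˣ) : H k g)) = 1
    rw [map_mul, map_mul, T.norm_right, mul_one, counitRight_comul, tmulSelf, map_mul,
      counitRight_inl, counitRight_inr, ha, map_one, mul_one, Units.mul_inv]

theorem TwistedEnd.gaugeBy_twist (T : TwistedEnd k g) (a : (H k g)ˣ)
    (ha : counit (a : H k g) = 1) : ((T.gaugeBy a ha).twist : H2 k g) =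
      tmulSelf (a : H k g) * (T.twist : H2 k g) * comul ((a⁻¹ : (H k g)ˣ) : H k g) := rfl

theorem TwistedAut.hom_surjective (T : TwistedAut k g) :
    Function.Surjective (T : TwistedEnd k g).hom := fun x =>
  ⟨((T⁻¹ : TwistedAut k g) : TwistedEnd k g).hom x,
    DFunLike.congr_fun (congrArg TwistedEnd.hom T.mul_inv) x⟩

/-! ### Twists modulo powers of `h` -/

/-- Surjectivity passes to the reduction modulo h. It is needed because the conjugation relation
only controls commutation with Δ on the image of that reduction. -/
theorem coeff_zero_algHom_surjective {f : H k g →ₐ[k⟦X⟧] H k g} (hf : Function.Surjective f)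
    (v : U k g) : ∃ u, PowerSeries.coeff 0 (f (PowerSeries.C u)) = v := by
  obtain ⟨w, hw⟩ := hf (PowerSeries.C v)
  refine ⟨PowerSeries.coeff 0 w, ?_⟩
  have h := congrArg (PowerSeries.coeff 0) hw
  rw [series_eq w, map_add, algHom_X_mul, map_add, PowerSeries.coeff_zero_C,
    PowerSeries.coeff_zero_X_mul, add_zero] at h
  exact h

/-- The reduction modulo `h` of an algebra endomorphism of `H`. -/
def reduction (f : H k g →ₐ[k⟦X⟧] H k g) : U k g →ₐ[k] U k g where
  toFun u := PowerSeries.coeff 0 (f (PowerSeries.C u))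
  map_zero' := by simp only [map_zero]
  map_add' x y := by simp only [map_add]
  map_one' := by simp
  map_mul' x y := by rw [map_mul, map_mul, coeff_zero_mul']
  commutes' c := by
    have h := (restrictConst f).commutes c
    change PowerSeries.coeff 0 (restrictConst f _) = _
    rw [h, PowerSeries.algebraMap_apply]
    simp

theorem reduction_apply (f : H k g →ₐ[k⟦X⟧] H k g) (u : U k g) :
    reduction f u = PowerSeries.coeff 0 (f (PowerSeries.C u)) := rfl

/-- The constant coefficient is invertible in U(g) ⊗ U(g), hence a scalar, and the counit condition
makes it 1. This starts the induction on powers of h. -/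
theorem TwistedEnd.coeff_zero_twist (T : TwistedEnd k g) :
    PowerSeries.coeff 0 (T.twist : H2 k g) = 1 := by
  have h1 : PowerSeries.coeff 0 (T.twist : H2 k g) *
      PowerSeries.coeff 0 ((T.twist⁻¹ : (H2 k g)ˣ) : H2 k g) = 1 := by
    rw [← coeff_zero_mul', Units.mul_inv, PowerSeries.coeff_zero_one]
  obtain ⟨c, hc⟩ := tensor_eq_algebraMap_of_mul_eq_one h1
  have h2 : counitLeft₀ k g (PowerSeries.coeff 0 (T.twist : H2 k g)) = 1 := by
    have h := congrArg (PowerSeries.coeff 0) T.norm_left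
    rwa [PowerSeries.coeff_zero_one] at h
  rw [hc, AlgHom.commutes] at h2
  have h3 := congrArg (counit₀ k g) h2
  rw [AlgHom.commutes, map_one] at h3
  have h4 : c = 1 := h3
  rw [hc, h4, map_one]

variable [CharZero k]

/-- The lowest order term of a twist congruent to `1` modulo `hⁿ`. -/
theorem TwistedEnd.exists_lowest_term (T : TwistedEnd k g) (hT : Function.Surjective T.hom)
    {n : ℕ} (hn : 0 < n) (h : EqMod n (T.twist : H2 k g) 1) :
    ∃ (y : invSkew k g) (b : U k g), PowerSeries.coeff n (T.twist : H2 k g) =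
      ιι k g (y : g ⊗[k] g) + cobound b ∧ counit₀ k g b = 0 ∧
      ((∀ x, T.hom x = x) → ∀ u, Commute b u) := by
  set W : H2 k g := (T.twist : H2 k g) with hWdef
  -- At order hⁿ the multiplicative cocycle condition for 1 + hⁿ(…) becomes additive.
  have hcoc : IsCocycle (PowerSeries.coeff n W) := by
    have h1 := congrArg (PowerSeries.coeff n) T.cocycle
    have e1 : EqMod n (tmulOne W) 1 := by have := h.map tmulOne; rwa [map_one] at this
    have e2 : EqMod n (comulLeft W) 1 := by have := h.map comulLeft; rwa [map_one] at this
    have e3 : EqMod n (oneTmul W) 1 := by have := h.map oneTmul; rwa [map_one] at this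
    have e4 : EqMod n (comulRight W) 1 := by have := h.map comulRight; rwa [map_one] at this
    rw [coeff_mul_of_eqMod_one hn e1, coeff_mul_of_eqMod_one hn e3, e2.coeff_zero hn,
      e4.coeff_zero hn, mul_one, mul_one, add_comm, add_comm (PowerSeries.coeff n (comulRight W))]
      at h1
    exact h1
  have hl : counitLeft₀ k g (PowerSeries.coeff n W) = 0 := by
    have h1 := congrArg (PowerSeries.coeff n) T.norm_left
    rwa [PowerSeries.coeff_one, if_neg hn.ne'] at h1
  have hr : counitRight₀ k g (PowerSeries.coeff n W) = 0 := by
    have h1 := congrArg (PowerSeries.coeff n) T.norm_right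
    rwa [PowerSeries.coeff_one, if_neg hn.ne'] at h1
  obtain ⟨y, b, h1, h2, h3, h4⟩ := hcoc.exists_decomposition hl hr
  have hconj : ∀ x : g, Commute (ιι k g y) (comul₀ k g (reduction T.hom (ιU x))) := by
    intro x
    rw [reduction_apply]
    have hx := T.conj (PowerSeries.C (ιU x))
    rw [comul_ι, map_add, tensorMap_inl, tensorMap_inr, ← hWdef] at hx
    set p := T.hom (PowerSeries.C (ιU x)) with hp
    have c0 := congrArg (PowerSeries.coeff 0) hx
    have cn := congrArg (PowerSeries.coeff n) hx
    rw [coeff_zero_mul', coeff_zero_mul', h.coeff_zero hn, one_mul, mul_one] at c0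
    rw [coeff_mul_of_eqMod_one hn h, coeff_mul_of_eqMod_one_right hn h, ← c0, coeff_comul,
      coeff_comul, map_add, coeff_inl, coeff_inr, h1] at cn
    set P := comul₀ k g (PowerSeries.coeff 0 p) with hP
    set q := PowerSeries.coeff n p
    have hτP : τU P = P := comm_comul₀ _
    -- At order hⁿ the conjugation relation expresses the commutator of y with the symmetric element
    -- P through symmetric tensors. Since y is skew, that commutator is also skew, so it vanishes.
    have e1 : ιι k g y * P - P * ιι k g y =
        -cobound q - (cobound b * P - P * cobound b) := by
      change _ = -(comul₀ k g q - q ⊗ₜ 1 - 1 ⊗ₜ q) - _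
      rw [← sub_eq_zero] at cn ⊢
      rw [← cn]
      simp only [mul_add, add_mul]
      abel
    have e2 : τU (ιι k g y * P - P * ιι k g y) = ιι k g y * P - P * ιι k g y := by
      rw [e1, map_sub, map_neg, map_sub, comm_mul, comm_mul, comm_cobound, comm_cobound, hτP]
    rw [map_sub, comm_mul, comm_mul, hτP, h2] at e2
    have e3 : (2 : k) • (ιι k g y * P - P * ιι k g y) = 0 := by
      rw [two_smul]
      nth_rewrite 1 [← e2]
      rw [neg_mul, mul_neg]
      abel
    exact sub_eq_zero.1 ((smul_eq_zero.1 e3).resolve_left two_ne_zero)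
  have hall : ∀ u, Commute (ιι k g y) (comul₀ k g (reduction T.hom u)) :=
    commute_of_commute_ι ((comul₀ k g).comp (reduction T.hom)) hconj
  have hy : y ∈ invSkew k g := (mem_invSkew_iff y).2 ⟨h2, fun x => by
    obtain ⟨u, hu⟩ := coeff_zero_algHom_surjective hT (ιU x)
    rw [← hu]
    exact hall u⟩
  -- If the endomorphism is the identity, the conjugation relation says that the twist commutes with
  -- Δ(H); the decomposition of an invariant cocycle then has b central.
  refine ⟨⟨y, hy⟩, b, h1, h3, fun hid => h4 fun x => ?_⟩
  have hx := T.conj (PowerSeries.C (ιU x))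
  have hid' : T.hom = AlgHom.id _ _ := AlgHom.ext hid
  rw [hid', tensorMap_id, AlgHom.id_apply, AlgHom.id_apply, comul, coeffwise_C] at hx
  exact commute_coeff_of_commute_C hx n

end GaugeTransform

/-! ### Gauging a twist into the form `exp(h X)` -/

section Exponential

variable {k g : Type*} [Field k] [LieRing g] [LieAlgebra k g]

/-- The gauge transformation `p.1` brings the twist of `T` into the form `exp(h p.2)` modulo
`hᵐ⁺¹`. -/
structure IsApprox (T : TwistedEnd k g) (m : ℕ) (p : H k g × InvSkewSeries k g) : Prop where
  coeff_zero : PowerSeries.coeff 0 p.1 = 1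
  counit_eq : counit p.1 = 1
  eqMod : EqMod (m + 1) (tmulSelf p.1 * (T.twist : H2 k g)) (hexp k p.2.toH2 * comul p.1)
  central : (∀ x, T.hom x = x) → ∀ u, Commute p.1 u

theorem isApprox_zero (T : TwistedEnd k g) : IsApprox T 0 (1, 0) where
  coeff_zero := PowerSeries.coeff_zero_one
  counit_eq := map_one _
  eqMod i hi := by
    obtain rfl : i = 0 := by omega
    rw [tmulSelf_one, one_mul, T.coeff_zero_twist, InvSkewSeries.toH2_zero, hexp_zero, map_one,
      one_mul, PowerSeries.coeff_zero_one]
  central _ u := Commute.one_left u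

theorem C_central {A : Type*} [Ring A] {b : A} (hb : ∀ u, Commute b u) (T : A⟦X⟧) :
    Commute (PowerSeries.C b) T :=
  commute_of_coeff fun i j => by
    rw [PowerSeries.coeff_C]
    split_ifs
    · exact hb _
    · exact Commute.zero_left _

theorem InvSkewSeries.toH2_add_single (x : InvSkewSeries k g) (m : ℕ) (y : invSkew k g) :
    InvSkewSeries.toH2 (x + Pi.single m y) =
      x.toH2 + PowerSeries.X ^ m * PowerSeries.C (ιι k g (y : g ⊗[k] g)) := by
  rw [InvSkewSeries.toH2_add]
  congr 1
  ext n
  rw [InvSkewSeries.coeff_toH2, PowerSeries.coeff_X_pow_mul', PowerSeries.coeff_C]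
  by_cases h : n = m
  · subst h
    rw [Pi.single_eq_same, if_pos le_rfl, Nat.sub_self, if_pos rfl]
  · rw [Pi.single_eq_of_ne h, Submodule.coe_zero, map_zero]
    split_ifs with h1 h2
    · omega
    · rfl
    · rfl

variable [CharZero k]

/-- Gauging by a and dividing by exp(hX) leaves a twist that is 1 modulo hᵐ⁺¹. Its next coefficient
y plus a coboundary of b is removed by adding y to X and multiplying a by 1 + hᵐ⁺¹ b. Earlier
coefficients are untouched, so the construction converges. -/
theorem IsApprox.exists_succ {T : TwistedEnd k g} (hT : Function.Surjective T.hom) {m : ℕ}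
    {p : H k g × InvSkewSeries k g} (hp : IsApprox T m p) :
    ∃ q, IsApprox T (m + 1) q ∧ EqMod (m + 1) q.1 p.1 ∧ ∀ i < m, q.2 i = p.2 i := by
  obtain ⟨a', x⟩ := p
  obtain ⟨h0, h1, h2, h3⟩ := hp
  obtain ⟨a, rfl⟩ : ∃ a : (H k g)ˣ, (a : H k g) = a' := isUnit_of_coeff_zero_eq_one h0
  change counit (a : H k g) = 1 at h1
  change EqMod (m + 1) (tmulSelf (a : H k g) * (T.twist : H2 k g))
    (hexp k x.toH2 * comul (a : H k g)) at h2
  change _ → ∀ u, Commute (a : H k g) u at h3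
  set R := expTwistEnd (-x) * T.gaugeBy a h1 with hR
  set W : H2 k g := (R.twist : H2 k g) with hW
  have hWeq : W = tmulSelf (a : H k g) * (T.twist : H2 k g) *
      (comul ((a⁻¹ : (H k g)ˣ) : H k g) * hexp k (-x.toH2)) := by
    rw [hW, hR, TwistedEnd.mul_twist]
    change tensorMap (AlgHom.id _ _) (AlgHom.id _ _) _ * hexp k (InvSkewSeries.toH2 (-x)) = _
    rw [tensorMap_id, AlgHom.id_apply, TwistedEnd.gaugeBy_twist, InvSkewSeries.toH2_neg, mul_assoc]
  have hWF : tmulSelf (a : H k g) * (T.twist : H2 k g) =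
      W * hexp k x.toH2 * comul (a : H k g) := by
    rw [hWeq, mul_assoc _ _ (hexp k x.toH2), mul_assoc (comul _), hexp_neg_mul_hexp, mul_one,
      mul_assoc, comul_inv_mul, mul_one]
  have hW1 : EqMod (m + 1) W 1 := by
    have h := h2.mul (EqMod.refl (comul ((a⁻¹ : (H k g)ˣ) : H k g) * hexp k (-x.toH2)))
    rwa [← hWeq, mul_assoc, ← mul_assoc (comul (a : H k g)), comul_mul_inv, one_mul,
      hexp_mul_hexp_neg] at h
  have hRhom : ∀ u, R.hom u = a * T.hom u * (a⁻¹ : (H k g)ˣ) := fun u => rfl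
  have hRs : Function.Surjective R.hom := fun u => by
    obtain ⟨v, hv⟩ := hT (((a⁻¹ : (H k g)ˣ) : H k g) * u * a)
    refine ⟨v, ?_⟩
    rw [hRhom, hv, mul_assoc, mul_assoc, mul_assoc, Units.mul_inv, mul_one,
      Units.mul_inv_cancel_left]
  obtain ⟨y, b, hy, hb, hbc⟩ := R.exists_lowest_term hRs m.succ_pos hW1
  rw [← hW] at hy
  -- At order m + 1 the element c ⊗ c contributes b ⊗ 1 + 1 ⊗ b and Δ(c) contributes Δ(b); the
  -- difference is the coboundary to be removed.
  set c : H k g := 1 + PowerSeries.X ^ (m + 1) * PowerSeries.C b with hc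
  have hc1 : EqMod (m + 1) c 1 := eqMod_add_X_pow_mul _ _ _
  have hcn : PowerSeries.coeff (m + 1) c = b := by
    rw [hc, map_add, PowerSeries.coeff_X_pow_mul', if_pos le_rfl, Nat.sub_self,
      PowerSeries.coeff_zero_C, PowerSeries.coeff_one, if_neg m.succ_ne_zero, zero_add]
  have hl1 : EqMod (m + 1) (inl c : H2 k g) 1 := by
    have := hc1.map (inl : H k g →ₐ[k⟦X⟧] H2 k g); rwa [map_one] at this
  have hr1 : EqMod (m + 1) (inr c : H2 k g) 1 := by
    have := hc1.map (inr : H k g →ₐ[k⟦X⟧] H2 k g); rwa [map_one] at this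
  have hΔ1 : EqMod (m + 1) (comul c) 1 := by
    have := hc1.map comul; rwa [map_one] at this
  have hs1 : EqMod (m + 1) (tmulSelf c) 1 := by
    have := hl1.mul hr1; rwa [one_mul] at this
  have hsn : PowerSeries.coeff (m + 1) (tmulSelf c) = 1 ⊗ₜ b + b ⊗ₜ 1 := by
    rw [tmulSelf, coeff_mul_of_eqMod_one m.succ_pos hl1, hr1.coeff_zero m.succ_pos, mul_one,
      coeff_inl, coeff_inr, hcn]
  set E := hexp k x.toH2 with hE
  have hE0 : PowerSeries.coeff 0 E = 1 := (hexp_eqMod_one k _).coeff_zero one_pos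
  -- The tensor y enters X in degree m, because exp(hX) shifts degrees by one.
  set x' : InvSkewSeries k g := x + Pi.single m y with hx'
  have hexp' : EqMod (m + 2) (hexp k x'.toH2)
      (E + PowerSeries.X ^ (m + 1) * PowerSeries.C (ιι k g (y : g ⊗[k] g))) := by
    rw [hx', InvSkewSeries.toH2_add_single]
    exact hexp_add_X_pow_mul k _ _ m
  -- When the endomorphism is the identity, a is central, so conjugation by a leaves the identity
  -- and the new b is central too.
  have hcent : (∀ u, T.hom u = u) → ∀ u, Commute (a : H k g) u ∧ Commute c u := fun hid u => by
    refine ⟨h3 hid u, (Commute.one_left u).add_left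
      (((PowerSeries.commute_X u).symm.pow_left _).mul_left (C_central (hbc fun v => ?_) u))⟩
    rw [hRhom, hid, (h3 hid v).eq, Units.mul_inv_cancel_right]
  refine ⟨(c * a, x'), ⟨?_, ?_, ?_, fun hid u => ?_⟩, ?_, fun i hi => ?_⟩
  · change PowerSeries.coeff 0 (c * (a : H k g)) = 1
    rw [coeff_zero_mul', hc1.coeff_zero m.succ_pos, one_mul]
    exact h0
  · change counit (c * (a : H k g)) = 1
    rw [map_mul, h1, mul_one, hc, map_add, map_one, map_mul, map_pow, counit, PowerSeries.map_X,
      PowerSeries.map_C]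
    change 1 + PowerSeries.X ^ (m + 1) * PowerSeries.C (counit₀ k g b) = 1
    rw [hb, map_zero, mul_zero, add_zero]
  · change EqMod (m + 2) (tmulSelf (c * (a : H k g)) * (T.twist : H2 k g))
      (hexp k x'.toH2 * comul (c * (a : H k g)))
    rw [tmulSelf_mul, mul_assoc, hWF, map_mul, ← mul_assoc, ← mul_assoc, ← mul_assoc]
    refine EqMod.mul ?_ (EqMod.refl _)
    refine EqMod.succ ?_ ?_
    · have e1 := (hs1.mul hW1).mul (EqMod.refl E)
      have e2 := (hexp'.mono (Nat.le_succ _)).trans (eqMod_add_X_pow_mul _ _ _)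
      have e3 := e2.mul hΔ1
      rw [one_mul, one_mul] at e1
      rw [mul_one] at e3
      exact e1.trans e3.symm
    · rw [mul_assoc, coeff_mul_of_eqMod_one m.succ_pos hs1, coeff_zero_mul',
        hW1.coeff_zero m.succ_pos, coeff_mul_of_eqMod_one m.succ_pos hW1, hE0,
        coeff_mul_of_eqMod_one_right m.succ_pos hΔ1, hexp' (m + 1) (by omega),
        hexp' 0 (by omega), map_add, map_add, hE0, PowerSeries.coeff_X_pow_mul', if_pos le_rfl,
        Nat.sub_self, PowerSeries.coeff_zero_C, PowerSeries.coeff_X_pow_mul', if_neg (by omega),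
        hsn, hy, coeff_comul, hcn, cobound]
      simp only [mul_one, one_mul, add_zero]
      abel
  · exact (hcent hid u).2.mul_left (hcent hid u).1
  · have := hc1.mul (EqMod.refl (a : H k g))
    rwa [one_mul] at this
  · change x i + (Pi.single m y : InvSkewSeries k g) i = x i
    rw [Pi.single_eq_of_ne (by omega), add_zero]

/-- Every twist is gauge equivalent to one of the form `exp(h X)`. -/
theorem TwistedEnd.exists_gauge_hexp (T : TwistedEnd k g) (hT : Function.Surjective T.hom) :
    ∃ (a : (H k g)ˣ) (x : InvSkewSeries k g),
      tmulSelf (a : H k g) * (T.twist : H2 k g) = hexp k x.toH2 * comul (a : H k g) ∧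
      ((∀ x, T.hom x = x) → ∀ u, Commute (a : H k g) u) := by
  let step : ∀ m, {p // IsApprox T m p} → {p // IsApprox T (m + 1) p} := fun m p =>
    ⟨(p.2.exists_succ hT).choose, (p.2.exists_succ hT).choose_spec.1⟩
  let seq : ∀ m, {p // IsApprox T m p} := fun m => Nat.rec ⟨(1, 0), isApprox_zero T⟩ step m
  have hseq1 : ∀ m, EqMod (m + 1) (seq (m + 1)).1.1 (seq m).1.1 := fun m =>
    ((seq m).2.exists_succ hT).choose_spec.2.1
  have hseq2 : ∀ m, ∀ i < m, (seq (m + 1)).1.2 i = (seq m).1.2 i := fun m =>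
    ((seq m).2.exists_succ hT).choose_spec.2.2
  -- Later stages do not change coefficient n of the gauge after stage n, nor coefficient n of X
  -- after stage n + 1, the stage that sets it.
  let a : H k g := PowerSeries.mk fun n => PowerSeries.coeff n (seq n).1.1
  let x : InvSkewSeries k g := fun n => (seq (n + 1)).1.2 n
  have ha : ∀ m, EqMod (m + 1) a (seq m).1.1 := by
    intro m
    induction m with
    | zero =>
      intro i hi
      obtain rfl : i = 0 := by omega
      exact PowerSeries.coeff_mk _ _
    | succ m ih =>
      exact EqMod.succ (ih.trans (hseq1 m).symm) (PowerSeries.coeff_mk _ _)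
  have hx : ∀ m, ∀ i < m, x i = (seq m).1.2 i := by
    intro m
    induction m with
    | zero => intro i hi; omega
    | succ m ih =>
      intro i hi
      rcases Nat.lt_succ_iff_lt_or_eq.1 hi with h | rfl
      · rw [ih i h, hseq2 m i h]
      · rfl
  have hX : ∀ m, EqMod (m + 1) (hexp k x.toH2) (hexp k (seq m).1.2.toH2) := fun m =>
    EqMod.hexp fun i hi => by
      rw [InvSkewSeries.coeff_toH2, InvSkewSeries.coeff_toH2, hx m i hi]
  have ha0 : PowerSeries.coeff 0 a = 1 := (PowerSeries.coeff_mk _ _).trans (seq 0).2.coeff_zero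
  obtain ⟨a', ha'⟩ := isUnit_of_coeff_zero_eq_one ha0
  refine ⟨a', x, ?_, fun hid u => ?_⟩
  · rw [ha']
    refine eq_of_forall_eqMod fun m => EqMod.mono (Nat.le_succ m) ?_
    have e1 : EqMod (m + 1) (tmulSelf a * (T.twist : H2 k g))
        (tmulSelf (seq m).1.1 * (T.twist : H2 k g)) :=
      (((ha m).map inl).mul ((ha m).map inr)).mul (EqMod.refl _)
    exact (e1.trans (seq m).2.eqMod).trans ((hX m).mul ((ha m).map comul)).symm
  · rw [ha']
    refine commute_of_coeff fun i j => ?_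
    rw [show PowerSeries.coeff i a = PowerSeries.coeff i (seq i).1.1 from PowerSeries.coeff_mk _ _]
    exact commute_coeff_of_commute_C ((seq i).2.central hid _) i

/-! ### Twisted automorphisms are composites of invariant twists and bialgebra automorphisms -/

/-- A bialgebra endomorphism which is invertible as an algebra map is a bialgebra automorphism. -/
def bialgAutOfInverse (f f' : H k g →ₐ[k⟦X⟧] H k g) (h : ∀ x, f (f' x) = x)
    (h' : ∀ x, f' (f x) = x) (hf : f ∈ bialgEnd k g) : BialgAut k g where
  val := ⟨f, hf⟩
  inv := ⟨f', fun x => by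
    have h1 := hf.1 (f' x)
    rw [h] at h1
    rw [h1, tensorMap_tensorMap, (AlgHom.ext h' : f'.comp f = AlgHom.id _ _), tensorMap_id,
      AlgHom.id_apply], fun x => by rw [← hf.2, h]⟩
  val_inv := Subtype.ext (AlgHom.ext h)
  inv_val := Subtype.ext (AlgHom.ext h')

theorem expTwistEnd_mul_twist_of_twist_eq_one (x : InvSkewSeries k g) (T : TwistedEnd k g)
    (hT : (T.twist : H2 k g) = 1) :
    ((expTwistEnd x * T).twist : H2 k g) = hexp k x.toH2 := by
  rw [TwistedEnd.mul_twist, hT, map_one, one_mul]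
  rfl

/-- Once the twist has the form exp(hX), which commutes with Δ(H), it cancels from the conjugation
relation, which then says that a f a⁻¹ respects the coproduct. -/
theorem exists_gaugeIso_expTwist_mul_ofBialg (T : TwistedAut k g) :
    ∃ (x : InvSkewSeries k g) (f : BialgAut k g), TwistedEnd.GaugeIso (T : TwistedEnd k g)
      ((expTwist x * ofBialg f : TwistedAut k g) : TwistedEnd k g) := by
  obtain ⟨a, x, hax, -⟩ := (T : TwistedEnd k g).exists_gauge_hexp (TwistedAut.hom_surjective T)
  set R : TwistedEnd k g := (T : TwistedEnd k g) with hR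
  have hcounit : ∀ y, counit ((conjHom a).comp R.hom y) = counit y := fun y => by
    change counit ((a : H k g) * R.hom y * ((a⁻¹ : (H k g)ˣ) : H k g)) = counit y
    rw [map_mul, map_mul, mul_right_comm, ← map_mul, Units.mul_inv, map_one, one_mul,
      R.counit_hom]
  have hcomul : ∀ y, comul ((conjHom a).comp R.hom y) =
      tensorMap ((conjHom a).comp R.hom) ((conjHom a).comp R.hom) (comul y) := fun y => by
    rw [tensorMap_conjHom_comp]
    let c : (H2 k g)ˣ := ⟨tmulSelf (a : H k g), tmulSelf ((a⁻¹ : (H k g)ˣ) : H k g),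
      tmulSelf_mul_inv a, tmulSelf_inv_mul a⟩
    change _ = (c : H2 k g) * _ * ((c⁻¹ : (H2 k g)ˣ) : H2 k g)
    rw [Units.eq_mul_inv_iff_mul_eq, ← Units.mul_left_inj R.twist]
    change comul ((a : H k g) * R.hom y * ((a⁻¹ : (H k g)ˣ) : H k g)) * tmulSelf (a : H k g) *
      (R.twist : H2 k g) = tmulSelf (a : H k g) * _ * (R.twist : H2 k g)
    rw [mul_assoc, hax, ← mul_assoc, ← (hexp_commute k (toH2_commute_comul x _)).eq, mul_assoc,
      ← map_mul, mul_assoc _ _ (a : H k g), Units.inv_mul, mul_one, map_mul, ← mul_assoc, ← hax,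
      mul_assoc, R.conj, mul_assoc]
  have hinv1 : ∀ y, R.hom (((T⁻¹ : TwistedAut k g) : TwistedEnd k g).hom y) = y := fun y =>
    DFunLike.congr_fun (congrArg TwistedEnd.hom T.mul_inv) y
  have hinv2 : ∀ y, ((T⁻¹ : TwistedAut k g) : TwistedEnd k g).hom (R.hom y) = y := fun y =>
    DFunLike.congr_fun (congrArg TwistedEnd.hom T.inv_mul) y
  refine ⟨x, bialgAutOfInverse ((conjHom a).comp R.hom)
    (((T⁻¹ : TwistedAut k g) : TwistedEnd k g).hom.comp (conjHom a⁻¹)) (fun y => ?_) (fun y => ?_)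
    ⟨hcomul, hcounit⟩, a, fun y => ?_, ?_⟩
  · change (a : H k g) * R.hom (((T⁻¹ : TwistedAut k g) : TwistedEnd k g).hom
      (((a⁻¹ : (H k g)ˣ) : H k g) * y * a)) * ((a⁻¹ : (H k g)ˣ) : H k g) = y
    rw [hinv1]
    simp [mul_assoc]
  · change ((T⁻¹ : TwistedAut k g) : TwistedEnd k g).hom (((a⁻¹ : (H k g)ˣ) : H k g) *
      ((a : H k g) * R.hom y * ((a⁻¹ : (H k g)ˣ) : H k g)) * a) = y
    rw [mul_assoc (a : H k g), Units.inv_mul_cancel_left, Units.inv_mul_cancel_right, hinv2]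
  · change (a : H k g) * R.hom y =
      (a : H k g) * R.hom y * ((a⁻¹ : (H k g)ˣ) : H k g) * (a : H k g)
    rw [Units.inv_mul_cancel_right]
  · rw [hax]
    congr 1
    exact expTwistEnd_mul_twist_of_twist_eq_one x _ rfl

/-- For an invariant twist the gauge transformation can be taken central, so it fixes the identity
endomorphism and no automorphism factor appears. -/
theorem exists_gaugeClass_eq_expTwist {S : TwistedAut k g} (hS : S ∈ invariantTwists k g) :
    ∃ x : InvSkewSeries k g, gaugeClass S = gaugeClass (expTwist x) := by
  obtain ⟨a, x, hax, hc⟩ := (S : TwistedEnd k g).exists_gauge_hexp (TwistedAut.hom_surjective S)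
  have hid : ∀ y, (S : TwistedEnd k g).hom y = y := fun y =>
    DFunLike.congr_fun (congrArg Units.val (MonoidHom.mem_ker.1 hS)) y
  refine ⟨x, gaugeClass_eq_iff.2 ⟨a, fun y => ?_, hax.symm⟩⟩
  rw [hid]
  exact hc hid y

end Exponential

/-! ### The action of bialgebra automorphisms on invariant skew-symmetric tensors -/

section Action

variable {k g : Type*} [Field k] [LieRing g] [LieAlgebra k g]

attribute [local instance] LieRing.ofAssociativeRing

local notation "ιU" => (UniversalEnvelopingAlgebra.ι k : g →ₗ⁅k⁆ U k g)

theorem coeff_tensorMap (f : H k g →ₐ[k⟦X⟧] H k g) (T : H2 k g) (n : ℕ) :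
    PowerSeries.coeff n (tensorMap f f T) = ∑ p ∈ Finset.HasAntidiagonal.antidiagonal n,
      PowerSeries.coeff p.1 (tensorMap f f (PowerSeries.C (PowerSeries.coeff p.2 T))) := by
  refine (coeff_extendFun _ T n).trans (Finset.sum_congr rfl fun p _ => ?_)
  rw [tensorMap, extend_C]

theorem BialgAut.comul_toHom (f : BialgAut k g) (x : H k g) :
    comul (f.toHom x) = tensorMap f.toHom f.toHom (comul x) := f.val.2.1 x

theorem BialgAut.comul_toHom_ι (f : BialgAut k g) (y : g) (n : ℕ) :
    comul₀ k g (PowerSeries.coeff n (f.toHom (PowerSeries.C (ιU y)))) =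
      PowerSeries.coeff n (f.toHom (PowerSeries.C (ιU y))) ⊗ₜ 1 +
      1 ⊗ₜ PowerSeries.coeff n (f.toHom (PowerSeries.C (ιU y))) := by
  have h := congrArg (PowerSeries.coeff n) (f.comul_toHom (PowerSeries.C (ιU y)))
  rwa [comul_ι, map_add, tensorMap_inl, tensorMap_inr, coeff_comul, map_add, coeff_inl,
    coeff_inr] at h

theorem tensorMap_C_tmul (f : H k g →ₐ[k⟦X⟧] H k g) (u v : U k g) :
    tensorMap f f (PowerSeries.C (u ⊗ₜ[k] v)) =
      inl (f (PowerSeries.C u)) * inr (f (PowerSeries.C v)) := by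
  rw [← tensorMap_inl f f, ← tensorMap_inr f f, ← map_mul, inl, inr, coeffwise_C, coeffwise_C,
    ← map_mul]
  congr 2
  change _ = (u ⊗ₜ[k] (1 : U k g)) * ((1 : U k g) ⊗ₜ[k] v)
  rw [Algebra.TensorProduct.tmul_mul_tmul, one_mul, mul_one]

theorem gaugeClass_ofBialg_of_mem_inner {f : BialgAut k g} (hf : f ∈ innerBialg k g) :
    gaugeClass (ofBialg f) = 1 := by
  obtain ⟨a, ha, hfa⟩ := hf
  refine (gaugeClass_eq_iff (T := 1).2 ⟨a, fun x => ?_, ?_⟩).symm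
  · change (a : H k g) * x = f.toHom x * a
    rw [hfa, Units.inv_mul_cancel_right]
  · change 1 * comul (a : H k g) = tmulSelf (a : H k g) * 1
    rw [one_mul, mul_one, ha]

/-- If Y starts in degree n, then exp(hY) - 1 starts in degree n + 1 with the same coefficient. -/
theorem eq_zero_of_hexp_eq_one {A : Type*} [Ring A] [Algebra k A] {Y : A⟦X⟧}
    (h : hexp k Y = 1) : Y = 0 := by
  refine eq_of_forall_eqMod fun n => ?_
  induction n with
  | zero => intro i hi; omega
  | succ n ih =>
    refine ih.succ ?_
    obtain ⟨R, rfl⟩ := ih.exists_eq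
    have h1 := hexp_add_X_pow_mul k 0 R n (n + 1) (by omega)
    rw [h, hexp_zero, map_add, PowerSeries.coeff_X_pow_mul', if_pos le_rfl, Nat.sub_self,
      left_eq_add] at h1
    rw [zero_add, map_zero, PowerSeries.coeff_X_pow_mul', if_pos le_rfl, Nat.sub_self, h1]

theorem ofBialg_hom (f : BialgAut k g) :
    ((ofBialg f : TwistedAut k g) : TwistedEnd k g).hom = f.toHom := rfl

theorem ofBialg_twist (f : BialgAut k g) :
    (((ofBialg f : TwistedAut k g) : TwistedEnd k g).twist : H2 k g) = 1 := rfl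

variable [CharZero k]

theorem expTwist_val (x : InvSkewSeries k g) :
    ((expTwist x : TwistedAut k g) : TwistedEnd k g) = expTwistEnd x := rfl

/-- A bialgebra map sends x in g to a series with primitive coefficients, and the primitive elements
of U(g) are those of g. -/
theorem BialgAut.coeff_tensorMap_ιι (f : BialgAut k g) (t : g ⊗[k] g) (n : ℕ) :
    PowerSeries.coeff n (tensorMap f.toHom f.toHom (PowerSeries.C (ιι k g t))) ∈
      LinearMap.range (ιι k g) := by
  induction t with
  | zero => simp
  | tmul x y =>
    rw [ιι_tmul, tensorMap_C_tmul, PowerSeries.coeff_mul]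
    refine Submodule.sum_mem _ fun p _ => ?_
    rw [coeff_inl, coeff_inr, Algebra.TensorProduct.tmul_mul_tmul, one_mul, mul_one,
      ← ι_toLie_of_primitive (f.comul_toHom_ι x p.1), ← ι_toLie_of_primitive (f.comul_toHom_ι y p.2)]
    exact ⟨_, ιι_tmul _ _⟩
  | add s t hs ht =>
    rw [map_add, map_add, map_add, map_add]
    exact Submodule.add_mem _ hs ht

/-- Skewness is preserved because f ⊗ f commutes with the flip. Invariance is preserved because f is
onto, so each Δ(y) is the image under f ⊗ f of some Δ(y'). -/
theorem BialgAut.exists_toH2_eq_tensorMap (f : BialgAut k g) (x : InvSkewSeries k g) :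
    ∃ y : InvSkewSeries k g, y.toH2 = tensorMap f.toHom f.toHom x.toH2 := by
  refine exists_toH2 (fun n => ?_) ?_ fun y => ?_
  · rw [coeff_tensorMap]
    have h : ∑ p ∈ Finset.HasAntidiagonal.antidiagonal n, PowerSeries.coeff p.1
        (tensorMap f.toHom f.toHom (PowerSeries.C (PowerSeries.coeff p.2 x.toH2))) ∈
        LinearMap.range (ιι k g) := Submodule.sum_mem _ fun p _ => by
      rw [InvSkewSeries.coeff_toH2]
      exact f.coeff_tensorMap_ιι _ _
    obtain ⟨t, ht⟩ := h
    exact ⟨t, ht.symm⟩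
  · rw [flip_tensorMap, flip_toH2, map_neg]
  · rw [← f.toHom_inv y, f.comul_toHom]
    exact (toH2_commute_comul x _).map _

/-- The action of a bialgebra automorphism on `(Λ² g)^g[[h]]`. -/
def BialgAut.act (f : BialgAut k g) (x : InvSkewSeries k g) : InvSkewSeries k g :=
  (f.exists_toH2_eq_tensorMap x).choose

theorem BialgAut.toH2_act (f : BialgAut k g) (x : InvSkewSeries k g) :
    (f.act x).toH2 = tensorMap f.toHom f.toHom x.toH2 :=
  (f.exists_toH2_eq_tensorMap x).choose_spec

theorem BialgAut.one_act (x : InvSkewSeries k g) : (1 : BialgAut k g).act x = x := by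
  apply InvSkewSeries.toH2_injective
  rw [toH2_act]
  exact DFunLike.congr_fun tensorMap_id _

theorem BialgAut.mul_act (f f' : BialgAut k g) (x : InvSkewSeries k g) :
    (f * f').act x = f.act (f'.act x) := by
  apply InvSkewSeries.toH2_injective
  rw [toH2_act, toH2_act, toH2_act, tensorMap_tensorMap]
  rfl

theorem BialgAut.act_add (f : BialgAut k g) (x y : InvSkewSeries k g) :
    f.act (x + y) = f.act x + f.act y := by
  apply InvSkewSeries.toH2_injective
  rw [toH2_act, InvSkewSeries.toH2_add, InvSkewSeries.toH2_add, toH2_act, toH2_act, map_add]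

/-- For group-like a, conjugation by a ⊗ a = Δ(a) fixes an invariant tensor; hence the action
descends to outer automorphisms. -/
theorem BialgAut.act_of_mem_inner {f : BialgAut k g} (hf : f ∈ innerBialg k g)
    (x : InvSkewSeries k g) : f.act x = x := by
  obtain ⟨a, ha, hfa⟩ := hf
  apply InvSkewSeries.toH2_injective
  have hf' : f.toHom = (conjHom a).comp (AlgHom.id _ _) := AlgHom.ext hfa
  rw [toH2_act, hf', tensorMap_conjHom_comp, tensorMap_id, AlgHom.id_apply, ← ha,
    ← (toH2_commute_comul x _).eq, ha, mul_assoc, tmulSelf_mul_inv, mul_one]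

variable (k g) in
/-- The action of bialgebra automorphisms on `(Λ² g)^g[[h]]`, as a homomorphism. -/
def bialgAction : BialgAut k g →* MulAut (Multiplicative (InvSkewSeries k g)) where
  toFun f :=
    { toFun := fun x => Multiplicative.ofAdd (f.act x.toAdd)
      invFun := fun x => Multiplicative.ofAdd (f⁻¹.act x.toAdd)
      left_inv := fun x => by
        change Multiplicative.ofAdd (f⁻¹.act (f.act x.toAdd)) = x
        rw [← BialgAut.mul_act, inv_mul_cancel, BialgAut.one_act]
        rfl
      right_inv := fun x => by
        change Multiplicative.ofAdd (f.act (f⁻¹.act x.toAdd)) = x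
        rw [← BialgAut.mul_act, mul_inv_cancel, BialgAut.one_act]
        rfl
      map_mul' := fun x y => congrArg Multiplicative.ofAdd (f.act_add x.toAdd y.toAdd) }
  map_one' := MulEquiv.ext fun x => congrArg Multiplicative.ofAdd (BialgAut.one_act x.toAdd)
  map_mul' f f' := MulEquiv.ext fun x =>
    congrArg Multiplicative.ofAdd (BialgAut.mul_act f f' x.toAdd)

variable (k g) in
/-- The action of outer bialgebra automorphisms on `(Λ² g)^g[[h]]`. -/
def outAction : OutBialg k g →* MulAut (Multiplicative (InvSkewSeries k g)) :=
  QuotientGroup.lift (innerBialg k g) (bialgAction k g) fun _ hf =>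
    MulEquiv.ext fun x => congrArg Multiplicative.ofAdd (BialgAut.act_of_mem_inner hf x.toAdd)

/-! ### The isomorphism with the group of gauge classes -/

variable (k g) in
/-- `X ↦ [(1, exp(h X))]`. -/
def expClass : Multiplicative (InvSkewSeries k g) →* GaugeClasses k g :=
  MonoidHom.mk' (fun x => gaugeClass (expTwist x.toAdd)) fun x y =>
    gaugeClass_expTwist_add x.toAdd y.toAdd

variable (k g) in
/-- `f ↦ [(f, 1)]`. -/
def outClass : OutBialg k g →* GaugeClasses k g :=
  QuotientGroup.lift (innerBialg k g)
    (MonoidHom.mk' (fun f => gaugeClass (ofBialg f)) fun f f' => by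
      rw [map_mul, gaugeClass_mul]) fun _ hf => gaugeClass_ofBialg_of_mem_inner hf

/-- Both composites are (f, exp(h (f ⊗ f)(X))). This is the compatibility that the semidirect
product requires. -/
theorem ofBialg_mul_expTwist (f : BialgAut k g) (x : InvSkewSeries k g) :
    ofBialg f * expTwist x = expTwist (f.act x) * ofBialg f := by
  refine Units.ext ?_
  rw [Units.val_mul, Units.val_mul]
  refine TwistedEnd.ext (AlgHom.ext fun y => ?_) (Units.ext ?_)
  · rw [TwistedEnd.mul_hom, TwistedEnd.mul_hom, expTwist_val, expTwist_val]
    rfl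
  · rw [expTwist_val, expTwist_val,
      expTwistEnd_mul_twist_of_twist_eq_one (f.act x) _ (ofBialg_twist f), TwistedEnd.mul_twist,
      ofBialg_twist, mul_one, ofBialg_hom, expTwistEnd_twist, map_hexp, BialgAut.toH2_act]

variable (k g) in
/-- The homomorphism from the semidirect product to the group of gauge classes. -/
def semidirectHom :
    Multiplicative (InvSkewSeries k g) ⋊[outAction k g] OutBialg k g →* GaugeClasses k g :=
  SemidirectProduct.lift (expClass k g) (outClass k g) fun q => by
    induction q using QuotientGroup.induction_on with
    | H f =>
      refine MonoidHom.ext fun x => ?_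
      change gaugeClass (expTwist (f.act x.toAdd)) =
        gaugeClass (ofBialg f) * gaugeClass (expTwist x.toAdd) * (gaugeClass (ofBialg f))⁻¹
      rw [eq_mul_inv_iff_mul_eq, ← gaugeClass_mul, ← gaugeClass_mul, ofBialg_mul_expTwist]

theorem semidirectHom_mk (x : InvSkewSeries k g) (f : BialgAut k g) :
    semidirectHom k g ⟨Multiplicative.ofAdd x, f⟩ = gaugeClass (expTwist x * ofBialg f) := rfl

/-- A trivialising gauge a satisfies exp(hX)Δ(a) = a ⊗ a. The flip fixes Δ(a) and a ⊗ a and changes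
the sign of X, so exp(hX) = exp(-hX) and X = 0. Then a is group-like and f is conjugation by a. -/
theorem semidirectHom_injective : Function.Injective (semidirectHom k g) := by
  rw [injective_iff_map_eq_one]
  rintro ⟨x, q⟩ h
  induction q using QuotientGroup.induction_on with
  | H f =>
    obtain ⟨a, h1, h2⟩ := TwistedEnd.GaugeIso.symm (gaugeClass_eq_iff (S := 1).1
      ((semidirectHom_mk x.toAdd f).symm.trans h))
    set X := InvSkewSeries.toH2 x.toAdd with hX
    have e1 : hexp k X * comul (a : H k g) = tmulSelf (a : H k g) := by
      refine Eq.trans ?_ (h2.trans (mul_one _))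
      congr 1
      exact (expTwistEnd_mul_twist_of_twist_eq_one x.toAdd _ rfl).symm
    have e2 : hexp k (-X) * comul (a : H k g) = tmulSelf (a : H k g) := by
      have h3 := congrArg (flip k g) e1
      rwa [map_mul, map_hexp, flip_toH2, flip_comul, flip_tmulSelf] at h3
    have e3 : hexp k X = hexp k (-X) := by
      have h3 := congrArg (· * comul ((a⁻¹ : (H k g)ˣ) : H k g)) (e1.trans e2.symm)
      simpa only [mul_assoc, comul_mul_inv, mul_one] using h3
    have e4 : X + X = 0 := eq_zero_of_hexp_eq_one (k := k) <| by
      rw [hexp_add k (Commute.refl X)]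
      nth_rewrite 1 [e3]
      exact hexp_neg_mul_hexp k X
    have e5 : X = 0 := by
      have h3 : (2 : k) • X = 0 := by rw [two_smul, e4]
      have h4 := congrArg ((2 : k)⁻¹ • ·) h3
      simpa only [smul_smul, inv_mul_cancel₀ (two_ne_zero (α := k)), one_smul, smul_zero] using h4
    have hx : x.toAdd = 0 := InvSkewSeries.toH2_injective (e5.trans InvSkewSeries.toH2_zero.symm)
    have hf : f ∈ innerBialg k g := by
      refine ⟨a, ?_, fun y => ?_⟩
      · rw [e5, hexp_zero, one_mul] at e1
        exact e1
      · rw [Units.eq_mul_inv_iff_mul_eq]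
        exact (h1 y).symm
    exact SemidirectProduct.ext hx ((QuotientGroup.eq_one_iff f).2 hf)

theorem semidirectHom_surjective : Function.Surjective (semidirectHom k g) := by
  intro c
  induction c using Con.induction_on with
  | H T =>
    obtain ⟨x, f, h⟩ := exists_gaugeIso_expTwist_mul_ofBialg T
    exact ⟨⟨Multiplicative.ofAdd x, f⟩, (gaugeClass_eq_iff.2 h).symm⟩

end Action

end TwistedUEA

end

/-! ### Assembly of the main theorem. -/

theorem mainTheorem1 (k : Type*) [Field k] [IsAlgClosed k] [CharZero k]
    (g : Type*) [LieRing g] [LieAlgebra k g] :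
    (∀ T : TwistedUEA.TwistedAut k g,
      ∃ S ∈ TwistedUEA.invariantTwists k g, ∃ f : TwistedUEA.BialgAut k g,
        TwistedUEA.TwistedEnd.GaugeIso
          (T : TwistedUEA.TwistedEnd k g)
          ((S * TwistedUEA.ofBialg f : TwistedUEA.TwistedAut k g) : TwistedUEA.TwistedEnd k g)) ∧
    ∃ (φ : TwistedUEA.OutBialg k g →*
        MulAut (Multiplicative (TwistedUEA.InvSkewSeries k g)))
      (e : Multiplicative (TwistedUEA.InvSkewSeries k g) ⋊[φ] TwistedUEA.OutBialg k g ≃*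
        TwistedUEA.GaugeClasses k g),
      (∀ (f : TwistedUEA.BialgAut k g) (x : TwistedUEA.InvSkewSeries k g),
        TwistedUEA.InvSkewSeries.toH2
            (Multiplicative.toAdd (φ (f : TwistedUEA.OutBialg k g) (Multiplicative.ofAdd x))) =
          TwistedUEA.tensorMap (TwistedUEA.BialgAut.toHom f) (TwistedUEA.BialgAut.toHom f)
            (TwistedUEA.InvSkewSeries.toH2 x)) ∧
      (∀ x : TwistedUEA.InvSkewSeries k g, ∃ S ∈ TwistedUEA.invariantTwists k g,
        (((S : TwistedUEA.TwistedEnd k g).twist : TwistedUEA.H2 k g) =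
            TwistedUEA.expH (TwistedUEA.InvSkewSeries.toH2 x)) ∧
          e (SemidirectProduct.inl (Multiplicative.ofAdd x)) = TwistedUEA.gaugeClass S) ∧
      (∀ S ∈ TwistedUEA.invariantTwists k g, ∃ x : TwistedUEA.InvSkewSeries k g,
        TwistedUEA.gaugeClass S = e (SemidirectProduct.inl (Multiplicative.ofAdd x))) ∧
      (∀ f : TwistedUEA.BialgAut k g,
        e (SemidirectProduct.inr (f : TwistedUEA.OutBialg k g)) =
          TwistedUEA.gaugeClass (TwistedUEA.ofBialg f)) := by
  have hinl : ∀ x : TwistedUEA.InvSkewSeries k g,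
      TwistedUEA.semidirectHom k g (SemidirectProduct.inl (Multiplicative.ofAdd x)) =
        TwistedUEA.gaugeClass (TwistedUEA.expTwist x) := fun x =>
    SemidirectProduct.lift_inl _ _ _ _
  have hinr : ∀ f : TwistedUEA.BialgAut k g,
      TwistedUEA.semidirectHom k g (SemidirectProduct.inr (f : TwistedUEA.OutBialg k g)) =
        TwistedUEA.gaugeClass (TwistedUEA.ofBialg f) := fun f =>
    SemidirectProduct.lift_inr _ _ _ _
  refine ⟨fun T => ?_, TwistedUEA.outAction k g, MulEquiv.ofBijective (TwistedUEA.semidirectHom k g)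
    ⟨TwistedUEA.semidirectHom_injective, TwistedUEA.semidirectHom_surjective⟩,
    fun f x => TwistedUEA.BialgAut.toH2_act f x,
    -- The `rfl` identifies `expH` with `hexp`, which is the same series over a general coefficient
    -- ring.
    fun x => ⟨TwistedUEA.expTwist x, TwistedUEA.expTwist_mem x, rfl, hinl x⟩,
    fun S hS => ?_, hinr⟩
  · obtain ⟨x, f, h⟩ := TwistedUEA.exists_gaugeIso_expTwist_mul_ofBialg T
    exact ⟨_, TwistedUEA.expTwist_mem x, f, h⟩
  · obtain ⟨x, hx⟩ := TwistedUEA.exists_gaugeClass_eq_expTwist hS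
    exact ⟨x, hx.trans (hinl x).symm⟩
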